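/- All graphs are finite and simple. For a graph $G$ let $n=|V(G)|$, let $\Delta=\Delta(G)$ be its maximum degree and $\chi'(G)$ its chromatic index. $G$ is of class 2 if $\chi'(G)=\Delta+1$, and critical if $\chi'(H)<\chi'(G)$ for every proper subgraph $H$ of $G$. The core $G_\Delta$ is the subgraph of $G$ induced by the vertices of degree $\Delta$, and $\delta(G_\Delta)$ is its minimum degree. A vertex $r$ is light if $d(r)=\Delta$ and $d_{G_\Delta}(r)=\delta(G_\Delta)$. A $\Delta$-edge-coloring of a graph assigns to every edge a color from $[\Delta]=\{1,\dots,\Delta\}$ so that adjacent edges get different colors. For an edge $e=rs$ of $G$ and a $\Delta$-edge-coloring $\varphi$ of $G-e$, let $\overline{\varphi}(v)$ be the set of colors in $[\Delta]$ that appear on no edge of $G-e$ incident to $v$. A multi-fan at $r$ with respect to $e$ and $\varphi$ is a sequence $F=(r,e_0,s_0,e_1,s_1,\dots,e_p,s_p)$, $p\ge 0$, of distinct vertices and edges of $G$ with $s_0=s$, $e_0=e$, $e_i=rs_i$ for all $i$, and such that for each $1\le i\le p$ there is $0\le j\le i-1$ with $\varphi(e_i)\in\overline{\varphi}(s_j)$;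 put $V(F)=\{r,s_0,\dots,s_p\}$. The multi-fan $F$ is maximum if $|V(F)|$ is largest among all multi-fans at $r$ with respect to $e$, over all $\Delta$-edge-colorings of $G-e$. **Lemma.** Let $G$ be a critical class 2 graph with $\delta(G_\Delta)=k$ and $\Delta\ge \frac23 n+\frac{3k}{2}$. Let $r$ be a light vertex of $G$ and let $e=rs$ be an edge of $G$ with $d(s)\le\Delta-1$. Let $\varphi$ be a $\Delta$-edge-coloring of $G-e$ under which some multi-fan $F$ at $r$ with respect to $e$ and $\varphi$ is maximum. Then the set of all vertices $v$ of $G$ with $d(v)\ge\Delta-k+1$ is elementary under $\varphi$, that is, $\overline{\varphi}(u)\cap\overline{\varphi}(v)=\emptyset$ for any two distinct vertices $u,v$ of this set. -/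

import Mathlib

namespace SimpleGraph

/-- A proper `k`-edge-coloring of `G`: adjacent edges (distinct edges sharing an endpoint) receive
different colors. The color set `[k]` is represented by `Fin k`. -/
abbrev EdgeColoring {V : Type*} (G : SimpleGraph V) (k : ℕ) : Type _ :=
  G.lineGraph.Coloring (Fin k)

/-- The chromatic index `χ'(G)`: the least `k` such that `G` has a `k`-edge-coloring. -/
noncomputable def chromaticIndex {V : Type*} (G : SimpleGraph V) : ℕ∞ :=
  G.lineGraph.chromaticNumber

/-- `G` is of class 2: `χ'(G) = Δ(G) + 1`. -/
def IsClassTwo {V : Type*} [Fintype V] (G : SimpleGraph V) [DecidableRel G.Adj] : Prop :=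
  G.chromaticIndex = (G.maxDegree : ℕ∞) + 1

/-- `G` is critical: `χ'(H) < χ'(G)` for every proper subgraph `H` of `G` (some vertices and some
edges may be missing from `H`). -/
def IsCritical {V : Type*} (G : SimpleGraph V) : Prop :=
  ∀ H : G.Subgraph, H ≠ ⊤ → H.coe.chromaticIndex < G.chromaticIndex

/-- The vertices of maximum degree of `G`. -/
def coreVertices {V : Type*} [Fintype V] (G : SimpleGraph V) [DecidableRel G.Adj] : Finset V :=
  Finset.univ.filter fun v => G.degree v = G.maxDegree

/-- The core `G_Δ` of `G`: the subgraph induced by the vertices of maximum degree. -/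
abbrev core {V : Type*} [Fintype V] (G : SimpleGraph V) [DecidableRel G.Adj] :
    SimpleGraph (G.coreVertices : Set V) :=
  G.induce (G.coreVertices : Set V)

/-- `r` is light: it has degree `Δ(G)` and its degree in the core is `δ(G_Δ)`. -/
def IsLight {V : Type*} [Fintype V] (G : SimpleGraph V) [DecidableRel G.Adj] (r : V) : Prop :=
  ∃ h : r ∈ (G.coreVertices : Set V), G.core.degree ⟨r, h⟩ = G.core.minDegree

namespace EdgeColoring

variable {V : Type*} {G : SimpleGraph V} {k : ℕ}

/-- The set of colors present at `v`, i.e. the colors of the edges incident to `v`. -/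
def present (φ : G.EdgeColoring k) (v : V) : Set (Fin k) :=
  {c | ∃ f : G.edgeSet, v ∈ (f : Sym2 V) ∧ φ f = c}

/-- The set of colors missing at `v`. -/
def missing (φ : G.EdgeColoring k) (v : V) : Set (Fin k) :=
  (φ.present v)ᶜ

/-- A vertex set is elementary if no color is missing at two distinct vertices of it. -/
def IsElementary (φ : G.EdgeColoring k) (X : Set V) : Prop :=
  ∀ u ∈ X, ∀ v ∈ X, u ≠ v → φ.missing u ∩ φ.missing v = ∅

end EdgeColoring

/-- A multi-fan `(r, e₀, s₀, e₁, s₁, …, eₚ, sₚ)` at `r` with respect to the edge `e = rs` of `G` and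
an edge coloring `φ` of `G - e`. Since `G` is simple, the edges `eᵢ = r sᵢ` are determined by the
vertices `sᵢ` and are not recorded separately; that `r` differs from all `sᵢ` follows from `adj`. -/
structure MultiFan {V : Type*} (G : SimpleGraph V) (r s : V) {k : ℕ}
    (φ : (G.deleteEdges {s(r, s)}).EdgeColoring k) where
  /-- the index of the last vertex -/
  p : ℕ
  /-- the vertices `s₀, …, sₚ` -/
  vert : Fin (p + 1) → V
  injective : Function.Injective vert
  adj : ∀ i, G.Adj r (vert i)
  vert_zero : vert 0 = s
  /-- for `i ≥ 1` the color of `eᵢ = r sᵢ` is missing at some `sⱼ` with `j < i` -/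
  color_mem : ∀ i, i ≠ 0 →
    ∃ j, j < i ∧ ∃ h : s(r, vert i) ∈ (G.deleteEdges {s(r, s)}).edgeSet,
      φ ⟨s(r, vert i), h⟩ ∈ φ.missing (vert j)

namespace MultiFan

variable {V : Type*} {G : SimpleGraph V} {r s : V} {k : ℕ}
  {φ : (G.deleteEdges {s(r, s)}).EdgeColoring k}

/-- The vertex set `V(F) = {r, s₀, …, sₚ}` of a multi-fan. -/
def verts (F : G.MultiFan r s φ) : Set V :=
  insert r (Set.range F.vert)

/-- `F` is maximum: `|V(F)|` is largest among all multi-fans at `r` with respect to `e = rs`, over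
all edge colorings of `G - e` with the same color set. -/
def IsMaximum (F : G.MultiFan r s φ) : Prop :=
  ∀ (ψ : (G.deleteEdges {s(r, s)}).EdgeColoring k) (F' : G.MultiFan r s ψ),
    F'.verts.ncard ≤ F.verts.ncard

end MultiFan

end SimpleGraph

/-!
The coloring `φ` of `G - rs` is encoded by one involution of the vertex set per color, with a vertex
fixed by the involution when the color is missing there (`NearColoring`), and a multi-fan by the set
of its vertices other than the center `r` (`Fan`). By the classical recoloring arguments, in a fan
no color is missing at two of the vertices, nor at a vertex and the center, since `G` has no edge
coloring with `Δ` colors. So suppose that a vertex `v` of degree more than `Δ - k` outside a maximum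
fan shares a missing color with the fan. (Two such vertices outside the fan that share a missing
color reduce to this case: exchange that color with the color missing at `r`. The path of these two
colors from `r` does not end at both of them, so one of them comes to miss the color of `r`.) By
another Kempe change, `v` may be assumed to miss the color of `r`.

Remove from the maximum fan its last vertex, leaving a fan `U`, and move the uncolored edge so that
the last vertex is attached along a color `β` missing at the root `s` (`Fan.reroot`). Now `β` is the
only missing color of `U` whose edge at `r` leaves `U`, and any fan containing `U`, for whichever
coloring, has at most one more vertex (`Core`). Therefore a missing color of `U` cannot lead from
`r` to a vertex of degree less than `Δ` outside `U`, because that vertex would extend the fan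
further.

Consider the common neighbors `z` of `r`, `s` and `v` with `d(z) < Δ`. Apart from those where the
color of `sz` is missing at `r` or leads from `r` to a vertex of degree `Δ` outside `U`, they are
*pivots* (`Pivot`), and the number of exceptions is at most the number `h` of neighbors of `r` of
degree `Δ` outside `U` (`Core.card_not_pivots`). For a pivot `z`, a color missing at `z` can be
freed at `v` by a Kempe change and then given to `vz`, so that the old color `τ` of `vz` becomes
missing at `z`, and the fan arguments apply to `τ`. Follow from `r` the edge of color `τ`, then the
edges whose colors are missing at the vertex reached, as long as they lead to vertices of degree
less than `Δ` outside `U` (`Chain`). The vertices reached share no missing color with each other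
(`Core.chain_disjoint`), with the fan (`Core.pivot_no_chain`), and none of them misses the color of
an edge from `v` to a pivot (`Core.chain_present`). Each vertex reached misses a color, so the
colors `τ` together with the colors missing at the vertices reached outnumber these vertices by at
least the number of pivots. All these colors lead from `r` to the vertices reached, or to neighbors
of degree `Δ` outside `U` other than the one reached by `β`; hence there are at most `h - 1` pivots
(`Core.card_pivots`).

On the other hand, since few vertices of `U` have degree `Δ`, the root has large degree
(`Core.le_degree_root`), and inclusion-exclusion shows that `r`, `s` and `v` have more than `2h - 1`
common neighbors of degree less than `Δ` when `Δ ≥ 2n/3 + 3k/2` (`Core.false_of_degree`).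
-/

namespace SimpleGraph

open Classical

set_option linter.unusedSectionVars false

/-! ### Colorings missing one edge, and Kempe changes -/

/-- A proper edge coloring of `G - rs` with color set `Fin D`, recorded by one involution of the
vertex set per color: `mate c x` is the other end of the edge of color `c` at `x`, and
`mate c x = x` means that the color `c` is missing at `x`. -/
structure NearColoring {V : Type*} (G : SimpleGraph V) (r s : V) (D : ℕ) where
  /-- the neighbor along color `c`, or the vertex itself if `c` is missing there -/
  mate : Fin D → V → V
  inv : ∀ c x, mate c (mate c x) = x
  adj : ∀ c x, mate c x ≠ x → G.Adj x (mate c x)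
  avoid : ∀ c, mate c r ≠ s
  cover : ∀ x y, G.Adj x y → s(x, y) ≠ s(r, s) → ∃ c, mate c x = y
  uniq : ∀ c d x, mate c x = mate d x → mate c x ≠ x → c = d

namespace NearColoring

variable {V : Type*} {G : SimpleGraph V} {r s : V} {D : ℕ}

theorem mate_eq_comm (ψ : G.NearColoring r s D) {c : Fin D} {x y : V} :
    ψ.mate c x = y ↔ ψ.mate c y = x := by
  constructor <;> rintro rfl <;> exact ψ.inv _ _

theorem mate_inj (ψ : G.NearColoring r s D) {c : Fin D} {x y : V}
    (h : ψ.mate c x = ψ.mate c y) : x = y := by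
  rw [← ψ.inv c x, h, ψ.inv]

theorem color_unique (ψ : G.NearColoring r s D) {c d : Fin D} {x y : V} (h : ψ.mate c x = y)
    (h' : ψ.mate d x = y) (hxy : y ≠ x) : c = d :=
  ψ.uniq c d x (h.trans h'.symm) (h ▸ hxy)

/-- A vertex set that is a union of components of the subgraph formed by the colors `a`, `b`. -/
def KempeClosed (ψ : G.NearColoring r s D) (a b : Fin D) (K : Set V) : Prop :=
  ∀ x ∈ K, ψ.mate a x ∈ K ∧ ψ.mate b x ∈ K

theorem KempeClosed.mate_left_iff {ψ : G.NearColoring r s D} {a b : Fin D} {K : Set V}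
    (hK : ψ.KempeClosed a b K) (x : V) : ψ.mate a x ∈ K ↔ x ∈ K :=
  ⟨fun h => ψ.inv a x ▸ (hK _ h).1, fun h => (hK _ h).1⟩

theorem KempeClosed.mate_right_iff {ψ : G.NearColoring r s D} {a b : Fin D} {K : Set V}
    (hK : ψ.KempeClosed a b K) (x : V) : ψ.mate b x ∈ K ↔ x ∈ K :=
  ⟨fun h => ψ.inv b x ▸ (hK _ h).2, fun h => (hK _ h).2⟩

theorem KempeClosed.compl {ψ : G.NearColoring r s D} {a b : Fin D} {K : Set V}
    (hK : ψ.KempeClosed a b K) : ψ.KempeClosed a b Kᶜ := fun x hx =>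
  ⟨fun h => hx ((hK.mate_left_iff x).1 h), fun h => hx ((hK.mate_right_iff x).1 h)⟩

/-- The Kempe change exchanging the colors `a` and `b` on a union `K` of components. -/
noncomputable def kempe (ψ : G.NearColoring r s D) (a b : Fin D) (K : Set V)
    (hK : ψ.KempeClosed a b K) : G.NearColoring r s D where
  mate c x := if x ∈ K then ψ.mate (Equiv.swap a b c) x else ψ.mate c x
  inv c x := by
    have ha := hK.mate_left_iff x
    have hb := hK.mate_right_iff x
    rcases eq_or_ne c a with rfl | hca
    · by_cases hx : x ∈ K
      · simp [hx, hb, ψ.inv]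
      · simp [hx, ha, ψ.inv]
    · rcases eq_or_ne c b with rfl | hcb
      · by_cases hx : x ∈ K
        · simp [hx, ha, ψ.inv]
        · simp [hx, hb, ψ.inv]
      · simp [Equiv.swap_apply_of_ne_of_ne hca hcb, ψ.inv]
  adj c x h := by
    by_cases hx : x ∈ K
    · simp only [hx, if_true] at h ⊢
      exact ψ.adj _ _ h
    · simp only [hx, if_false] at h ⊢
      exact ψ.adj _ _ h
  avoid c := by split_ifs <;> exact ψ.avoid _
  cover x y hxy hne := by
    obtain ⟨c, hc⟩ := ψ.cover x y hxy hne
    by_cases hx : x ∈ K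
    · exact ⟨Equiv.swap a b c, by simpa [hx] using hc⟩
    · exact ⟨c, by simpa [hx] using hc⟩
  uniq c d x h h' := by
    by_cases hx : x ∈ K
    · simp only [hx, if_true] at h h'
      exact (Equiv.swap a b).injective (ψ.uniq _ _ x h h')
    · simp only [hx, if_false] at h h'
      exact ψ.uniq _ _ x h h'

section kempe

variable {ψ : G.NearColoring r s D} {a b : Fin D} {K : Set V} (hK : ψ.KempeClosed a b K)

theorem kempe_of_notMem {c : Fin D} {x : V} (hx : x ∉ K) :
    (ψ.kempe a b K hK).mate c x = ψ.mate c x := by simp [kempe, hx]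

theorem kempe_of_ne {c : Fin D} {x : V} (ha : c ≠ a) (hb : c ≠ b) :
    (ψ.kempe a b K hK).mate c x = ψ.mate c x := by
  simp [kempe, Equiv.swap_apply_of_ne_of_ne ha hb]

theorem kempe_left {x : V} (hx : x ∈ K) :
    (ψ.kempe a b K hK).mate a x = ψ.mate b x := by simp [kempe, hx]

theorem kempe_right {x : V} (hx : x ∈ K) :
    (ψ.kempe a b K hK).mate b x = ψ.mate a x := by simp [kempe, hx]

end kempe

/-- The component of `x` in the subgraph formed by the colors `a` and `b`. -/
def comp (ψ : G.NearColoring r s D) (a b : Fin D) (x : V) : Set V :=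
  {y | Relation.ReflTransGen (fun u w => w = ψ.mate a u ∨ w = ψ.mate b u) x y}

theorem mem_comp_self (ψ : G.NearColoring r s D) (a b : Fin D) (x : V) : x ∈ ψ.comp a b x :=
  Relation.ReflTransGen.refl

theorem comp_closed (ψ : G.NearColoring r s D) (a b : Fin D) (x : V) :
    ψ.KempeClosed a b (ψ.comp a b x) := fun _ hy =>
  ⟨Relation.ReflTransGen.tail hy (Or.inl rfl), Relation.ReflTransGen.tail hy (Or.inr rfl)⟩

theorem comp_subset {ψ : G.NearColoring r s D} {a b : Fin D} {K : Set V}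
    (hK : ψ.KempeClosed a b K) {x : V} (hx : x ∈ K) : ψ.comp a b x ⊆ K := by
  intro y hy
  induction hy with
  | refl => exact hx
  | tail _ h ih =>
    rcases h with rfl | rfl
    exacts [(hK _ ih).1, (hK _ ih).2]

theorem mem_comp_symm {ψ : G.NearColoring r s D} {a b : Fin D} {x y : V}
    (h : y ∈ ψ.comp a b x) : x ∈ ψ.comp a b y := by
  by_contra hx
  exact comp_subset (ψ.comp_closed a b y).compl hx h (ψ.mem_comp_self a b y)

theorem comp_eq {ψ : G.NearColoring r s D} {a b : Fin D} {x y : V}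
    (h : y ∈ ψ.comp a b x) : ψ.comp a b y = ψ.comp a b x :=
  (comp_subset (ψ.comp_closed a b x) h).antisymm
    (comp_subset (ψ.comp_closed a b y) (mem_comp_symm h))

theorem comp_swap_colors (ψ : G.NearColoring r s D) (a b : Fin D) (x : V) :
    ψ.comp a b x = ψ.comp b a x :=
  (comp_subset (fun y hy => (ψ.comp_closed b a x y hy).symm) (ψ.mem_comp_self b a x)).antisymm
    (comp_subset (fun y hy => (ψ.comp_closed a b x y hy).symm) (ψ.mem_comp_self a b x))

/-- The walk from `x` that alternately uses the colors `b` and `a`. -/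
def walk (ψ : G.NearColoring r s D) (a b : Fin D) (x : V) : ℕ → V
  | 0 => x
  | n + 1 => if Even n then ψ.mate b (walk ψ a b x n) else ψ.mate a (walk ψ a b x n)

theorem walk_succ_steps (ψ : G.NearColoring r s D) (a b : Fin D) (x : V) (n : ℕ) :
    (ψ.mate a (ψ.walk a b x (n + 1)) = ψ.walk a b x (n + 2) ∧
      ψ.mate b (ψ.walk a b x (n + 1)) = ψ.walk a b x n) ∨
    (ψ.mate b (ψ.walk a b x (n + 1)) = ψ.walk a b x (n + 2) ∧
      ψ.mate a (ψ.walk a b x (n + 1)) = ψ.walk a b x n) := by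
  by_cases h : Even n
  · left
    have h1 : ψ.walk a b x (n + 1) = ψ.mate b (ψ.walk a b x n) := by simp [walk, h]
    have h2 : ψ.walk a b x (n + 2) = ψ.mate a (ψ.walk a b x (n + 1)) := by
      rw [walk, if_neg (by simpa [Nat.even_add_one] using h)]
    exact ⟨h2.symm, by rw [h1, ψ.inv]⟩
  · right
    have h1 : ψ.walk a b x (n + 1) = ψ.mate a (ψ.walk a b x n) := by simp [walk, h]
    have h2 : ψ.walk a b x (n + 2) = ψ.mate b (ψ.walk a b x (n + 1)) := by
      rw [walk, if_pos (by simpa [Nat.even_add_one] using h)]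
    exact ⟨h2.symm, by rw [h1, ψ.inv]⟩

theorem three_ends_aux (ψ : G.NearColoring r s D) {a b : Fin D} {x y z : V}
    (hx : ψ.mate a x = x) (hy : ψ.mate a y = y ∨ ψ.mate b y = y)
    (hz : ψ.mate a z = z ∨ ψ.mate b z = z) (hxy : x ≠ y) (hxz : x ≠ z) (hyz : y ≠ z)
    (h1 : y ∈ ψ.comp a b x) (h2 : z ∈ ψ.comp a b x) : False := by
  set w := ψ.walk a b x with hw
  have w0 : w 0 = x := rfl
  have w1 : w 1 = ψ.mate b x := by simp [hw, walk]
  have hst := ψ.walk_succ_steps a b x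
  rw [← hw] at hst
  -- an end of the component other than `x` makes the walk stall
  have stall : ∀ j, w j ≠ x → (ψ.mate a (w j) = w j ∨ ψ.mate b (w j) = w j) →
      ∃ i, i + 1 = j ∧ (w (i + 1) = w i ∨ w (i + 2) = w (i + 1)) := by
    intro j hj he
    obtain _ | i := j
    · exact absurd w0 hj
    refine ⟨i, rfl, ?_⟩
    rcases hst i with ⟨p, q⟩ | ⟨p, q⟩ <;> rcases he with he | he
    · exact Or.inr (by rw [← p, he])
    · exact Or.inl (by rw [← q, he])
    · exact Or.inl (by rw [← q, he])
    · exact Or.inr (by rw [← p, he])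
  have hall : ψ.KempeClosed a b {u | ∃ i, w i = u} := by
    rintro _ ⟨i, rfl⟩
    obtain _ | i := i
    · exact ⟨⟨0, by rw [w0, hx]⟩, ⟨1, by rw [w0, w1]⟩⟩
    · rcases hst i with ⟨p, q⟩ | ⟨p, q⟩
      · exact ⟨⟨_, p.symm⟩, ⟨_, q.symm⟩⟩
      · exact ⟨⟨_, q.symm⟩, ⟨_, p.symm⟩⟩
  have hex : ∃ i, w (i + 1) = w i := by
    obtain ⟨j, rfl⟩ := comp_subset hall ⟨0, w0⟩ h1
    obtain ⟨i, rfl, h | h⟩ := stall j hxy.symm hy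
    exacts [⟨_, h⟩, ⟨_, h⟩]
  let N := Nat.find hex
  have hN : w (N + 1) = w N := Nat.find_spec hex
  have hmin : ∀ i, w (i + 1) = w i → N ≤ i := fun i hi => Nat.find_min' hex hi
  -- the walk up to its first stall is the whole component, so its other end is `w N`
  have hcl : ψ.KempeClosed a b {u | ∃ i ≤ N, w i = u} := by
    rintro _ ⟨i, hi, rfl⟩
    have key : ∃ j ≤ N, w j = w (i + 1) := by
      rcases hi.eq_or_lt with rfl | hlt
      · exact ⟨_, le_rfl, hN.symm⟩
      · exact ⟨_, hlt, rfl⟩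
    obtain _ | i := i
    · exact ⟨⟨0, hi, by rw [w0, hx]⟩, by rw [w0, ← w1]; exact key⟩
    · rcases hst i with ⟨p, q⟩ | ⟨p, q⟩
      · exact ⟨p ▸ key, ⟨i, by omega, q.symm⟩⟩
      · exact ⟨⟨i, by omega, q.symm⟩, p ▸ key⟩
  have last : ∀ u, x ≠ u → (ψ.mate a u = u ∨ ψ.mate b u = u) → u ∈ ψ.comp a b x → u = w N := by
    intro u hxu he hu
    obtain ⟨j, hj, rfl⟩ := comp_subset hcl ⟨0, Nat.zero_le _, w0⟩ hu
    obtain ⟨i, rfl, h | h⟩ := stall j hxu.symm he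
    · have := hmin _ h
      omega
    · have := hmin _ h
      rw [show i + 1 = N by omega]
  exact hyz ((last y hxy hy h1).trans (last z hxz hz h2).symm)

/-- A component of two colors is a path or a cycle, so it has at most two ends. -/
theorem three_ends (ψ : G.NearColoring r s D) {a b : Fin D} {x y z : V}
    (hx : ψ.mate a x = x ∨ ψ.mate b x = x) (hy : ψ.mate a y = y ∨ ψ.mate b y = y)
    (hz : ψ.mate a z = z ∨ ψ.mate b z = z) (hxy : x ≠ y) (hxz : x ≠ z) (hyz : y ≠ z)
    (h1 : y ∈ ψ.comp a b x) (h2 : z ∈ ψ.comp a b x) : False := by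
  rcases hx with hx | hx
  · exact ψ.three_ends_aux hx hy hz hxy hxz hyz h1 h2
  · rw [comp_swap_colors] at h1 h2
    exact ψ.three_ends_aux hx hy.symm hz.symm hxy hxz hyz h1 h2

/-- Recoloring the edge `xy` from `a` to a color `b` missing at both ends, as a Kempe change. -/
theorem pair_closed {ψ : G.NearColoring r s D} {a b : Fin D} {x y : V} (h : ψ.mate a x = y)
    (hx : ψ.mate b x = x) (hy : ψ.mate b y = y) : ψ.KempeClosed a b {x, y} := by
  rintro u (rfl | rfl)
  · simp [h, hx]
  · simp [hy, ψ.mate_eq_comm.1 h]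

section degree

/-- The set of colors missing at `x`. -/
noncomputable def missing (ψ : G.NearColoring r s D) (x : V) : Finset (Fin D) :=
  Finset.univ.filter fun c => ψ.mate c x = x

theorem mem_missing {ψ : G.NearColoring r s D} {c : Fin D} {x : V} :
    c ∈ ψ.missing x ↔ ψ.mate c x = x := by simp [missing]

theorem card_missing_add (ψ : G.NearColoring r s D) (x : V) (B : Finset V)
    (hB : ∀ y, (∃ c, ψ.mate c x = y ∧ y ≠ x) ↔ y ∈ B) :
    (ψ.missing x).card + B.card = D := by
  have h1 : (Finset.univ.filter fun c => ¬ ψ.mate c x = x).card = B.card := by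
    refine Finset.card_bij (fun c _ => ψ.mate c x) ?_ ?_ ?_
    · intro c hc
      exact (hB _).1 ⟨c, rfl, by simpa using hc⟩
    · intro c hc d _ h
      exact ψ.uniq c d x h (by simpa using hc)
    · intro y hy
      obtain ⟨c, hc, hne⟩ := (hB y).2 hy
      exact ⟨c, by simpa [hc] using hne, hc⟩
  have h2 := Finset.card_filter_add_card_filter_not (s := (Finset.univ : Finset (Fin D)))
    (fun c => ψ.mate c x = x)
  rw [h1] at h2
  simpa [missing] using h2

variable [Fintype V] [DecidableRel G.Adj]

theorem card_missing (ψ : G.NearColoring r s D) {x : V} (hr : x ≠ r) (hs : x ≠ s) :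
    (ψ.missing x).card + G.degree x = D := by
  refine ψ.card_missing_add x (G.neighborFinset x) fun y => ?_
  rw [mem_neighborFinset]
  constructor
  · rintro ⟨c, rfl, hne⟩
    exact ψ.adj c x hne
  · intro h
    obtain ⟨c, hc⟩ := ψ.cover x y h (by simp [hr, hs])
    exact ⟨c, hc, h.ne'⟩

theorem card_missing_root (ψ : G.NearColoring r s D) (h : G.Adj r s) :
    (ψ.missing s).card + G.degree s = D + 1 := by
  have := ψ.card_missing_add s ((G.neighborFinset s).erase r) fun y => by
    rw [Finset.mem_erase, mem_neighborFinset]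
    constructor
    · rintro ⟨c, rfl, hne⟩
      exact ⟨fun h' => ψ.avoid c (ψ.mate_eq_comm.1 h'), ψ.adj c s hne⟩
    · rintro ⟨hy, h'⟩
      obtain ⟨c, hc⟩ := ψ.cover s y h' (by simp [hy, h.ne'])
      exact ⟨c, hc, h'.ne'⟩
  rw [Finset.card_erase_of_mem (by simpa using h.symm), card_neighborFinset_eq_degree] at this
  have : 0 < G.degree s := by
    rw [← card_neighborFinset_eq_degree]
    exact Finset.card_pos.2 ⟨r, by simpa using h.symm⟩
  omega

theorem card_missing_center (ψ : G.NearColoring r s D) (h : G.Adj r s) :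
    (ψ.missing r).card + G.degree r = D + 1 := by
  have := ψ.card_missing_add r ((G.neighborFinset r).erase s) fun y => by
    rw [Finset.mem_erase, mem_neighborFinset]
    constructor
    · rintro ⟨c, rfl, hne⟩
      exact ⟨ψ.avoid c, ψ.adj c r hne⟩
    · rintro ⟨hy, h'⟩
      obtain ⟨c, hc⟩ := ψ.cover r y h' (by simp [hy, h.ne])
      exact ⟨c, hc, h'.ne'⟩
  rw [Finset.card_erase_of_mem (by simpa using h), card_neighborFinset_eq_degree] at this
  have : 0 < G.degree r := by
    rw [← card_neighborFinset_eq_degree]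
    exact Finset.card_pos.2 ⟨s, by simpa using h⟩
  omega

end degree

/-! ### Multi-fans as vertex sets -/

/-- `ψ.Fan S` says that the vertices of `S` can be ordered into a multi-fan at `r` with respect to
the uncolored edge `rs`: they are obtained from `s` by repeatedly adding a neighbor of `r` along a
color missing at a vertex already present. The center `r` is not an element of `S`. -/
inductive Fan (ψ : G.NearColoring r s D) : Finset V → Prop
  | root : Fan ψ {s}
  | step {S : Finset V} {u w : V} {c : Fin D} : Fan ψ S → u ∈ S → ψ.mate c u = u →
      ψ.mate c r = w → w ∉ S → w ≠ r → Fan ψ (insert w S)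

section fan

variable {ψ ψ' : G.NearColoring r s D} {S T : Finset V}

theorem Fan.root_mem (h : ψ.Fan S) : s ∈ S := by
  induction h with
  | root => simp
  | step _ _ _ _ _ _ ih => exact Finset.mem_insert_of_mem ih

theorem Fan.adj (hrs : G.Adj r s) (h : ψ.Fan S) : ∀ w ∈ S, G.Adj r w := by
  induction h with
  | root => simpa using hrs
  | step _ _ _ hc _ hr ih =>
    intro x hx
    rcases Finset.mem_insert.1 hx with rfl | hx
    · exact hc ▸ ψ.adj _ _ (hc ▸ hr)
    · exact ih x hx

theorem Fan.center_notMem (hrs : G.Adj r s) (h : ψ.Fan S) : r ∉ S :=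
  fun hr => (h.adj hrs r hr).ne rfl

theorem Fan.add (h : ψ.Fan S) {u w : V} {c : Fin D} (hu : u ∈ S) (hc : ψ.mate c u = u)
    (hw : ψ.mate c r = w) (hr : w ≠ r) : ψ.Fan (insert w S) := by
  by_cases hwS : w ∈ S
  · rwa [Finset.insert_eq_self.2 hwS]
  · exact h.step hu hc hw hwS hr

theorem Fan.union (h : ψ.Fan S) (h' : ψ.Fan T) : ψ.Fan (S ∪ T) := by
  induction h' with
  | root => rwa [Finset.union_eq_left.2 (by simpa using h.root_mem)]
  | step _ hu hc hw _ hr ih =>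
    rw [Finset.union_insert]
    exact ih.add (Finset.mem_union_right _ hu) hc hw hr

/-- A fan survives a change of coloring that keeps its edges at `r` and the missing colors used
to build it. -/
theorem Fan.transfer (h : ψ.Fan T)
    (hm : ∀ u ∈ T, ∀ c, ψ.mate c u = u → ψ.mate c r ∈ T → ψ'.mate c u = u)
    (hr : ∀ c, ψ.mate c r ∈ T → ψ'.mate c r = ψ.mate c r) : ψ'.Fan T := by
  induction h with
  | root => exact .root
  | @step S u w c _ hu hc hw hwS hwr ih =>
    refine (ih (fun x hx d h1 h2 => hm x (Finset.mem_insert_of_mem hx) d h1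
      (Finset.mem_insert_of_mem h2)) fun d hd => hr d (Finset.mem_insert_of_mem hd)).step hu
      (hm u (Finset.mem_insert_of_mem hu) c hc (by simp [hw])) ?_ hwS hwr
    rw [hr c (by simp [hw]), hw]

/-- The color of an edge from `r` to a fan vertex is missing somewhere in the fan. -/
theorem Fan.exists_missing (h : ψ.Fan S) {d : Fin D} (hd : ψ.mate d r ∈ S) :
    ∃ u ∈ S, ψ.mate d u = u := by
  induction h with
  | root => exact absurd (Finset.mem_singleton.1 hd) (ψ.avoid d)
  | @step S u w c _ hu hc hw hwS hwr ih =>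
    rcases Finset.mem_insert.1 hd with h1 | h1
    · obtain rfl := ψ.color_unique hw h1 hwr
      exact ⟨u, Finset.mem_insert_of_mem hu, hc⟩
    · obtain ⟨x, hx, hx'⟩ := ih h1
      exact ⟨x, Finset.mem_insert_of_mem hx, hx'⟩

/-- Every fan vertex other than the root is the last vertex of a smaller fan. -/
theorem Fan.exists_prefix (h : ψ.Fan S) {z : V} (hz : z ∈ S) (hzs : z ≠ s) :
    ∃ P : Finset V, ψ.Fan P ∧ z ∉ P ∧ P ⊆ S ∧ z ≠ r ∧
      ∃ u ∈ P, ∃ c, ψ.mate c u = u ∧ ψ.mate c r = z := by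
  induction h with
  | root => exact absurd (Finset.mem_singleton.1 hz) hzs
  | @step S u w c hS hu hc hw hwS hwr ih =>
    rcases Finset.mem_insert.1 hz with rfl | h1
    · exact ⟨S, hS, hwS, Finset.subset_insert _ _, hwr, u, hu, c, hc, hw⟩
    · obtain ⟨P, h2, h3, h4, h5⟩ := ih h1
      exact ⟨P, h2, h3, h4.trans (Finset.subset_insert _ _), h5⟩

/-- A color missing at both ends of the uncolored edge can be given to it. -/
theorem colorable_of_missing (c : Fin D) (hr : ψ.mate c r = r) (hs : ψ.mate c s = s) :
    G.lineGraph.Colorable D := by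
  have hex : ∀ e : G.edgeSet, ∃ d : Fin D, (e.1 = s(r, s) ∧ d = c) ∨
      ∀ x ∈ e.1, ψ.mate d x ≠ x ∧ ψ.mate d x ∈ e.1 := by
    rintro ⟨e, he⟩
    by_cases h : e = s(r, s)
    · exact ⟨c, Or.inl ⟨h, rfl⟩⟩
    · induction e with | _ x y
      obtain ⟨d, hd⟩ := ψ.cover x y he h
      have hxy : x ≠ y := G.ne_of_adj he
      have hd' := ψ.mate_eq_comm.1 hd
      refine ⟨d, Or.inr fun z hz => ?_⟩
      rcases Sym2.mem_iff.1 hz with rfl | rfl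
      · simp [hd, hxy.symm]
      · simp [hd', hxy]
  choose col hcol using hex
  refine ⟨Coloring.mk col ?_⟩
  rintro e f hef heq
  rw [lineGraph_adj_iff_exists] at hef
  obtain ⟨hne, x, hxe, hxf⟩ := hef
  apply hne
  have h3 := hcol f
  have h4 := hcol e
  rw [heq] at h4
  have key : ∀ (p q : Sym2 V), p = s(r, s) → x ∈ p → col f = c →
      (∀ x ∈ q, ψ.mate (col f) x ≠ x ∧ ψ.mate (col f) x ∈ q) → x ∈ q → False := by
    rintro p q rfl hp hc hq hxq
    have := (hq x hxq).1
    rw [hc] at this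
    rcases Sym2.mem_iff.1 hp with rfl | rfl
    exacts [this hr, this hs]
  rcases h4 with ⟨h1, h2⟩ | h1 <;> rcases h3 with ⟨h5, h6⟩ | h5
  · exact Subtype.ext (h1.trans h5.symm)
  · exact (key _ _ h1 hxe h2 h5 hxf).elim
  · exact (key _ _ h5 hxf h6 h1 hxe).elim
  · refine Subtype.ext ?_
    have a1 := h1 x hxe
    have a2 := h5 x hxf
    exact ((Sym2.mem_and_mem_iff a1.1.symm).1 ⟨hxe, a1.2⟩).trans
      ((Sym2.mem_and_mem_iff a2.1.symm).1 ⟨hxf, a2.2⟩).symm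

section noncolorable

variable (hrs : G.Adj r s) (hnc : ¬ G.lineGraph.Colorable D)
include hrs hnc

/-- No color is missing both at the center and at a fan vertex: otherwise shifting colors along
the fan would free a color for the edge `rs`. -/
theorem Fan.ne_of_missing_center (h : ψ.Fan S) : ∀ {w : V} {c : Fin D}, w ∈ S →
    ψ.mate c w = w → ψ.mate c r ≠ r := by
  induction hn : S.card using Nat.strong_induction_on generalizing S ψ with
  | _ n ih
  intro w c hw hcw hcr
  by_cases hws : w = s
  · subst hws
    exact hnc (colorable_of_missing c hcr hcw)
  obtain ⟨P, hP, hwP, hPS, hwr, u, hu, d, hdu, hdr⟩ := h.exists_prefix hw hws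
  have hlt : P.card < n := hn ▸ Finset.card_lt_card ⟨hPS, fun h' => hwP (h' hw)⟩
  have hrP := hP.center_notMem hrs
  let K := ψ.pair_closed hdr hcr hcw
  have hout : ∀ x ∈ P, x ∉ ({r, w} : Set V) := by
    rintro x hx (rfl | rfl)
    exacts [hrP hx, hwP hx]
  have hP' : (ψ.kempe d c _ K).Fan P := by
    refine hP.transfer (fun x hx e he _ => ?_) fun e he => ?_
    · rw [kempe_of_notMem K (hout x hx), he]
    · apply kempe_of_ne
      · rintro rfl
        exact hwP (hdr ▸ he)
      · rintro rfl
        exact hrP (hcr ▸ he)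
  refine ih _ hlt hP' rfl hu (c := d) ?_ ?_
  · rw [kempe_of_notMem K (hout u hu), hdu]
  · rw [kempe_left K (by simp), hcr]

/-- The two-colored path that starts at the center with its missing color `ρ` and a color `c`
missing at a fan vertex ends at that vertex. -/
theorem Fan.mem_comp (h : ψ.Fan S) {ρ : Fin D} (hρ : ψ.mate ρ r = r) : ∀ {w : V} {c : Fin D},
    w ∈ S → ψ.mate c w = w → w ∈ ψ.comp ρ c r := by
  induction hn : S.card using Nat.strong_induction_on generalizing S with
  | _ n ih
  intro w c hw hcw
  by_contra hcon
  have hK := ψ.comp_closed ρ c w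
  have hrK : r ∉ ψ.comp ρ c w := fun h' => hcon (mem_comp_symm h')
  have hr : ∀ e, (ψ.kempe ρ c _ hK).mate e r = ψ.mate e r := fun e => kempe_of_notMem hK hrK
  -- the missing colors of a smaller fan are not affected by the Kempe change at `w`
  have hP : ∀ P, ψ.Fan P → P.card < n → ∀ x ∈ P, ∀ e, ψ.mate e x = x →
      (ψ.kempe ρ c _ hK).mate e x = x := by
    intro P hP hlt x hx e he
    by_cases hxK : x ∈ ψ.comp ρ c w
    · have h1 : e ≠ ρ := by
        rintro rfl
        exact hP.ne_of_missing_center hrs hnc hx he hρ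
      have h2 : e ≠ c := by
        rintro rfl
        have h3 := ih _ hlt hP rfl hx he
        rw [← comp_eq hxK] at hrK
        exact hrK (mem_comp_symm h3)
      rw [kempe_of_ne hK h1 h2, he]
    · rw [kempe_of_notMem hK hxK, he]
  have hcw' : (ψ.kempe ρ c _ hK).mate ρ w = w := by
    rw [kempe_left hK (ψ.mem_comp_self _ _ _), hcw]
  by_cases hws : w = s
  · subst hws
    exact hnc (colorable_of_missing ρ ((hr ρ).trans hρ) hcw')
  obtain ⟨P, hPf, hwP, hPS, hwr, u, hu, d, hdu, hdr⟩ := h.exists_prefix hw hws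
  have hlt : P.card < n := hn ▸ Finset.card_lt_card ⟨hPS, fun h' => hwP (h' hw)⟩
  have hP' : (ψ.kempe ρ c _ hK).Fan P :=
    hPf.transfer (fun x hx e he _ => hP P hPf hlt x hx e he) fun e _ => hr e
  have := hP'.step hu (hP P hPf hlt u hu d hdu) ((hr d).trans hdr) hwP hwr
  exact this.ne_of_missing_center hrs hnc (Finset.mem_insert_self _ _) hcw' ((hr ρ).trans hρ)

/-- Fan vertices have pairwise disjoint sets of missing colors. -/
theorem Fan.elementary (h : ψ.Fan S) {ρ : Fin D} (hρ : ψ.mate ρ r = r) {u w : V} {c : Fin D}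
    (hu : u ∈ S) (hw : w ∈ S) (hcu : ψ.mate c u = u) (hcw : ψ.mate c w = w) : u = w := by
  by_contra hne
  have hr := h.center_notMem hrs
  refine ψ.three_ends (a := ρ) (b := c) (Or.inl hρ) (Or.inr hcu) (Or.inr hcw) ?_ ?_ hne
    (h.mem_comp hrs hnc hρ hu hcu) (h.mem_comp hrs hnc hρ hw hcw)
  · rintro rfl; exact hr hu
  · rintro rfl; exact hr hw

/-- Fan vertices keep their missing colors under a Kempe change that involves the color `ρ`
missing at the center and avoids the center. -/
theorem Fan.kempe_missing_iff (h : ψ.Fan S) {ρ c : Fin D} (hρ : ψ.mate ρ r = r) {K : Set V}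
    (hK : ψ.KempeClosed ρ c K) (hrK : r ∉ K) {w : V} (hw : w ∈ S) (d : Fin D) :
    (ψ.kempe ρ c K hK).mate d w = w ↔ ψ.mate d w = w := by
  by_cases hwK : w ∈ K
  · have h1 : ψ.mate ρ w ≠ w := fun h' => h.ne_of_missing_center hrs hnc hw h' hρ
    have h2 : ψ.mate c w ≠ w := fun h' =>
      hrK (comp_subset hK hwK (mem_comp_symm (h.mem_comp hrs hnc hρ hw h')))
    rcases eq_or_ne d ρ with rfl | h3
    · simp [kempe_left hK hwK, h1, h2]
    rcases eq_or_ne d c with rfl | h4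
    · simp [kempe_right hK hwK, h1, h2]
    rw [kempe_of_ne hK h3 h4]
  · rw [kempe_of_notMem hK hwK]

theorem Fan.kempe (h : ψ.Fan S) {ρ c : Fin D} (hρ : ψ.mate ρ r = r) {K : Set V}
    (hK : ψ.KempeClosed ρ c K) (hrK : r ∉ K) : (ψ.kempe ρ c K hK).Fan S :=
  h.transfer (fun _ hu d hd _ => (h.kempe_missing_iff hrs hnc hρ hK hrK hu d).2 hd)
    fun _ _ => kempe_of_notMem hK hrK

/-- Every fan extends to one that no missing color of a vertex of it can extend further. -/
theorem Fan.exists_closed [Fintype V] (h : ψ.Fan S) : ∃ T, S ⊆ T ∧ ψ.Fan T ∧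
    ∀ u ∈ T, ∀ c, ψ.mate c u = u → ψ.mate c r ∈ T := by
  obtain ⟨T, hT, hmax⟩ := Finset.exists_max_image
    (Finset.univ.filter fun T => S ⊆ T ∧ ψ.Fan T) Finset.card ⟨S, by simp [h]⟩
  simp only [Finset.mem_filter, Finset.mem_univ, true_and] at hT hmax
  refine ⟨T, hT.1, hT.2, fun u hu c hc => ?_⟩
  by_contra hcon
  have := hmax _ ⟨hT.1.trans (Finset.subset_insert (ψ.mate c r) _), hT.2.step hu hc rfl hcon
    (hT.2.ne_of_missing_center hrs hnc hu hc)⟩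
  rw [Finset.card_insert_of_notMem hcon] at this
  omega

end noncolorable

end fan

/-! ### Moving the uncolored edge -/

/-- Color `rs` with the color `c` missing at `s` and uncolor the edge of color `c` at `r`. -/
noncomputable def shift (ψ : G.NearColoring r s D) (hrs : G.Adj r s) {c : Fin D} {w : V}
    (hs : ψ.mate c s = s) (hw : ψ.mate c r = w) (hwr : w ≠ r) : G.NearColoring r w D where
  mate d x := if d = c then (if x = r then s else if x = s then r else if x = w then w else
    ψ.mate c x) else ψ.mate d x
  inv d x := by
    have hw' := ψ.mate_eq_comm.1 hw
    have hsw : s ≠ w := fun h => ψ.avoid c (hw.trans h.symm)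
    by_cases hd : d = c
    · simp only [hd, if_true]
      by_cases h1 : x = r
      · simp [h1, hrs.ne']
      by_cases h2 : x = s
      · simp [h2, hrs.ne']
      by_cases h3 : x = w
      · simp [h3, hwr, hsw.symm]
      have a1 : ψ.mate c x ≠ r := fun h => h3 ((ψ.mate_eq_comm.1 h).symm.trans hw)
      have a2 : ψ.mate c x ≠ s := fun h => h2 ((ψ.mate_eq_comm.1 h).symm.trans hs)
      have a3 : ψ.mate c x ≠ w := fun h => h1 ((ψ.mate_eq_comm.1 h).symm.trans hw')
      simp [h1, h2, h3, a1, a2, a3, ψ.inv]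
    · simp [hd, ψ.inv]
  adj d x := by
    by_cases hd : d = c
    · simp only [hd, if_true]
      split_ifs with h1 h2 h3
      · intro _; rw [h1]; exact hrs
      · intro _; rw [h2]; exact hrs.symm
      · intro h; exact absurd h3.symm h
      · exact ψ.adj c x
    · simpa [hd] using ψ.adj d x
  avoid d := by
    by_cases hd : d = c
    · simpa [hd] using fun h => ψ.avoid c (hw.trans h.symm)
    · simpa [hd] using fun h => hd (ψ.color_unique h hw hwr)
  cover x y hxy hne := by
    by_cases h : s(x, y) = s(r, s)
    · refine ⟨c, ?_⟩
      rcases Sym2.eq_iff.1 h with ⟨rfl, rfl⟩ | ⟨rfl, rfl⟩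
      · simp
      · simp [hrs.ne']
    · obtain ⟨d, hd⟩ := ψ.cover x y hxy h
      refine ⟨d, ?_⟩
      by_cases hdc : d = c
      · subst hdc
        have a1 : x ≠ r := by
          rintro rfl
          exact hne (by rw [← hd, hw])
        have a2 : x ≠ s := by
          rintro rfl
          exact hxy.ne (hs.symm.trans hd)
        have a3 : x ≠ w := by
          rintro rfl
          rw [← hd, ψ.mate_eq_comm.1 hw, Sym2.eq_swap] at hne
          exact hne rfl
        simp [a1, a2, a3, hd]
      · simpa [hdc] using hd
  uniq d e x := by
    have aux : ∀ d, d ≠ c → (if x = r then s else if x = s then r else if x = w then w else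
        ψ.mate c x) = ψ.mate d x → ψ.mate d x ≠ x → False := by
      intro d hd h h'
      split_ifs at h with h1 h2 h3
      · exact ψ.avoid d (h1 ▸ h.symm)
      · exact ψ.avoid d (ψ.mate_eq_comm.1 (h2 ▸ h.symm))
      · exact h' (h.symm.trans h3.symm)
      · exact hd (ψ.uniq _ _ x h.symm h')
    by_cases hd : d = c <;> by_cases he : e = c
    · simp [hd, he]
    · simp only [hd, he, if_true, if_false]
      exact fun h h' => (aux e he h (h ▸ h')).elim
    · simp only [hd, he, if_true, if_false]
      exact fun h h' => (aux d hd h.symm h').elim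
    · simp only [hd, he, if_false]
      exact ψ.uniq d e x

section shift

variable {ψ : G.NearColoring r s D} {S : Finset V}

variable (hrs : G.Adj r s) {c : Fin D} {w : V} (hs : ψ.mate c s = s) (hw : ψ.mate c r = w)
  (hwr : w ≠ r)

theorem shift_of_ne {d : Fin D} (hd : d ≠ c) (x : V) :
    (ψ.shift hrs hs hw hwr).mate d x = ψ.mate d x := by simp [shift, hd]

theorem shift_of_notMem {x : V} (h1 : x ≠ r) (h2 : x ≠ s) (h3 : x ≠ w) (d : Fin D) :
    (ψ.shift hrs hs hw hwr).mate d x = ψ.mate d x := by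
  simp +contextual [shift, h1, h2, h3]

theorem shift_center : (ψ.shift hrs hs hw hwr).mate c r = s := by simp [shift]

theorem shift_new_root : (ψ.shift hrs hs hw hwr).mate c w = w := by
  have : w ≠ s := fun h => ψ.avoid c (hw.trans h)
  simp [shift, hwr, this]

theorem Fan.shift (h : ψ.Fan S) (hwS : w ∈ S) : (ψ.shift hrs hs hw hwr).Fan S := by
  have key : ∀ P, ψ.Fan P → (ψ.shift hrs hs hw hwr).Fan (insert s (insert w P)) := by
    intro P hP
    induction hP with
    | root =>
      have : (insert s (insert w {s}) : Finset V) = insert s {w} := by ext; simp [or_comm]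
      rw [this]
      exact Fan.root.add (Finset.mem_singleton_self w) (shift_new_root hrs hs hw hwr)
        (shift_center hrs hs hw hwr) hrs.ne'
    | @step P u x d hP hu hd hx hxP hxr ih =>
      have e : (insert s (insert w (insert x P)) : Finset V) = insert x (insert s (insert w P)) := by
        ext; simp; tauto
      rw [e]
      by_cases hdc : d = c
      · subst hdc
        rw [Finset.insert_eq_self.2 (by simp [← hx, hw])]
        exact ih
      · exact ih.add (u := u) (by simp [hu]) (by rw [shift_of_ne _ _ _ _ hdc, hd])
          (by rw [shift_of_ne _ _ _ _ hdc, hx]) hxr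
  have := key S h
  rwa [Finset.insert_eq_self.2 hwS, Finset.insert_eq_self.2 h.root_mem] at this

end shift

/-- The uncolored edge can be moved to any edge `ru` of a fan, without changing the vertex set of
the fan, the mates of vertices outside of it, and the colors whose edge at `r` leaves the fan. -/
theorem Fan.reroot {ψ : G.NearColoring r s D} {S : Finset V} (hrs : G.Adj r s) (h : ψ.Fan S) :
    ∀ u ∈ S, ∃ ψ' : G.NearColoring r u D,
      ψ'.Fan S ∧ (∀ x ∉ S, x ≠ r → ∀ c, ψ'.mate c x = ψ.mate c x) ∧
      (∀ c, ψ.mate c r ∉ S → ∀ x, ψ'.mate c x = ψ.mate c x) ∧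
      (∀ c, ψ.mate c r ∈ S → ψ'.mate c r ∈ S) := by
  induction h with
  | root =>
    intro u hu
    obtain rfl := Finset.mem_singleton.1 hu
    exact ⟨ψ, .root, by simp, by simp, by simp⟩
  | @step S u w c hS hu hc hw hwS hwr ih =>
    have hns : ∀ {d}, ψ.mate d r ∉ insert w S → ψ.mate d r ∉ S := fun hd h' =>
      hd (Finset.mem_insert_of_mem h')
    have hcr : ψ.mate c r ∉ S := hw ▸ hwS
    have key : ∀ x ∈ S, ∃ ψ' : G.NearColoring r x D,
        ψ'.Fan (insert w S) ∧ (∀ x ∉ insert w S, x ≠ r → ∀ c, ψ'.mate c x = ψ.mate c x) ∧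
        (∀ c, ψ.mate c r ∉ S → ∀ x, ψ'.mate c x = ψ.mate c x) ∧
        (∀ c, ψ.mate c r ∈ insert w S → ψ'.mate c r ∈ insert w S) := by
      intro x hx
      obtain ⟨ψ', h1, h2, h3, h4⟩ := ih x hx
      refine ⟨ψ', h1.step hu ((h3 c hcr u).trans hc) ((h3 c hcr r).trans hw) hwS hwr,
        fun y hy hyr d => h2 y (fun h => hy (Finset.mem_insert_of_mem h)) hyr d, h3,
        fun d hd => ?_⟩
      by_cases hdS : ψ.mate d r ∈ S
      · exact Finset.mem_insert_of_mem (h4 d hdS)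
      · rwa [h3 d hdS]
    intro x hx
    rcases Finset.mem_insert.1 hx with rfl | hx
    · obtain ⟨ψ', h1, h2, h3, h4⟩ := key u hu
      have b1 := (h3 c hcr u).trans hc
      have b2 := (h3 c hcr r).trans hw
      have hru := hS.adj hrs u hu
      refine ⟨ψ'.shift hru b1 b2 hwr, h1.shift hru b1 b2 hwr (Finset.mem_insert_self _ _),
        fun y hy hyr d => ?_, fun d hd y => ?_, fun d hd => ?_⟩
      · simp only [Finset.mem_insert, not_or] at hy
        rw [shift_of_notMem hru b1 b2 hwr hyr (fun h => hy.2 (h ▸ hu)) hy.1,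
          h2 y (by simp [hy]) hyr]
      · have hne : d ≠ c := by
          rintro rfl
          exact hd (by simp [hw])
        rw [shift_of_ne hru b1 b2 hwr hne, h3 d (hns hd)]
      · by_cases hdc : d = c
        · rw [hdc, shift_center hru b1 b2 hwr]
          exact Finset.mem_insert_of_mem hu
        · rw [shift_of_ne hru b1 b2 hwr hdc]
          exact h4 d hd
    · obtain ⟨ψ', h1, h2, h3, h4⟩ := key x hx
      exact ⟨ψ', h1, h2, fun d hd => h3 d (hns hd), h4⟩

/-! ### A maximum fan minus its last vertex -/

section

variable {V : Type*} [Fintype V] {G : SimpleGraph V} [DecidableRel G.Adj] {r s : V} {D : ℕ}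

/-- The standing situation: `G` is not `D`-edge-colorable, `D` is its maximum degree, attained at
the center `r` but not at the root `s`, and no fan with root `s`, for any coloring, has more than
one vertex beyond those of `U`. -/
structure Core (G : SimpleGraph V) [DecidableRel G.Adj] (r s : V) (D : ℕ) (U : Finset V) :
    Prop where
  adj : G.Adj r s
  degree_center : G.degree r = D
  degree_root : G.degree s < D
  degree_le : ∀ x, G.degree x ≤ D
  not_colorable : ¬ G.lineGraph.Colorable D
  card_le : ∀ (ψ : G.NearColoring r s D) (T : Finset V), U ⊆ T → ψ.Fan T → T.card ≤ U.card + 1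

/-- `U` is a fan which the color `β`, missing at the root, extends by one more vertex. -/
structure Good (ψ : G.NearColoring r s D) (U : Finset V) (β : Fin D) : Prop where
  fan : ψ.Fan U
  root : ψ.mate β s = s
  leaf : ψ.mate β r ∉ U

/-- The color `c` is present at the center and at every vertex of `U`. -/
def Full (ψ : G.NearColoring r s D) (U : Finset V) (c : Fin D) : Prop :=
  ψ.mate c r ≠ r ∧ ∀ u ∈ U, ψ.mate c u ≠ u

/-- The edge of color `c` at the center leads to a vertex outside `U` of less than full degree. -/
def LowEdge (ψ : G.NearColoring r s D) (U : Finset V) (c : Fin D) : Prop :=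
  ψ.mate c r ∉ U ∧ G.degree (ψ.mate c r) < D

/-- The edge of color `c` at the center does not lead to a vertex of degree `D` outside `U`. -/
def Safe (ψ : G.NearColoring r s D) (U : Finset V) (c : Fin D) : Prop :=
  ψ.mate c r = r ∨ ψ.mate c r ∈ U ∨ G.degree (ψ.mate c r) < D

/-- `y` lies outside the fan and shares a missing color with the center or with a fan vertex. -/
def Bad (ψ : G.NearColoring r s D) (U : Finset V) (y : V) : Prop :=
  y ∉ U ∧ y ≠ r ∧ ∃ c, ψ.mate c y = y ∧ ¬ ψ.Full U c

/-- `a'` is the end of an edge at the center whose color is missing at `a`, and `a'` is a vertex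
of less than full degree outside `U`. -/
def Arc (ψ : G.NearColoring r s D) (U : Finset V) (a a' : V) : Prop :=
  ∃ c, ψ.mate c a = a ∧ ψ.mate c r = a' ∧ ψ.LowEdge U c

/-- Walks of `n` arcs from `a` to `y` whose vertices other than `y` satisfy `P`. -/
inductive Chain (ψ : G.NearColoring r s D) (U : Finset V) (P : V → Prop) : ℕ → V → V → Prop
  | nil (a : V) : Chain ψ U P 0 a a
  | cons {n : ℕ} {a a' y : V} : P a → ψ.Arc U a a' → Chain ψ U P n a' y → Chain ψ U P (n + 1) a y

section chain

variable {ψ ψ' : G.NearColoring r s D} {U : Finset V} {P Q : V → Prop} {n : ℕ} {a y : V}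

theorem Chain.mono (h : ψ.Chain U P n a y) (hPQ : ∀ x, P x → Q x) : ψ.Chain U Q n a y := by
  induction h with
  | nil => exact .nil _
  | cons hP hA _ ih => exact .cons (hPQ _ hP) hA ih

/-- Either the tails of a chain avoid `Q`, or the chain starts with a chain to a vertex of `Q`. -/
theorem Chain.avoid_or_prefix (h : ψ.Chain U P n a y) (Q : V → Prop) :
    ψ.Chain U (fun x => P x ∧ ¬ Q x) n a y ∨ ∃ m x, P x ∧ Q x ∧ ψ.Chain U P m a x := by
  induction h with
  | nil a => exact Or.inl (.nil a)
  | @cons n a a' y hP hA _ ih =>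
    by_cases ha : Q a
    · exact Or.inr ⟨0, a, hP, ha, .nil a⟩
    · rcases ih with h1 | ⟨m, x, h0, h1, h2⟩
      · exact Or.inl (.cons ⟨hP, ha⟩ hA h1)
      · exact Or.inr ⟨m + 1, x, h0, h1, .cons hP hA h2⟩

/-- Either the tails of a chain avoid `Q`, or the chain ends with a chain from a vertex of `Q`. -/
theorem Chain.avoid_or_suffix (h : ψ.Chain U P n a y) (Q : V → Prop) :
    ψ.Chain U (fun x => P x ∧ ¬ Q x) n a y ∨ ∃ m x, Q x ∧ ψ.Chain U P m x y := by
  induction h with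
  | nil a => exact Or.inl (.nil a)
  | @cons n a a' y hP hA h ih =>
    by_cases ha : Q a
    · exact Or.inr ⟨n + 1, a, ha, .cons hP hA h⟩
    · rcases ih with h1 | h1
      · exact Or.inl (.cons ⟨hP, ha⟩ hA h1)
      · exact Or.inr h1

theorem Chain.mem_of_closed {T : Finset V} (h : ψ.Chain U P n a y)
    (hT : ∀ u ∈ T, ∀ c, ψ.mate c u = u → ψ.mate c r ∈ T) (ha : a ∈ T) : y ∈ T := by
  induction h with
  | nil a => exact ha
  | cons _ hA _ ih =>
    obtain ⟨c, h1, rfl, _⟩ := hA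
    exact ih (hT _ ha c h1)

/-- Cut a chain at the first vertex satisfying `Q`. -/
theorem Chain.exists_first (h : ψ.Chain U P n a y) (hy : Q y) :
    ∃ m y', Q y' ∧ ψ.Chain U (fun x => P x ∧ ¬ Q x) m a y' := by
  induction h with
  | nil a => exact ⟨0, a, hy, .nil a⟩
  | @cons n a a' y hP hA _ ih =>
    by_cases ha : Q a
    · exact ⟨0, a, ha, .nil a⟩
    · obtain ⟨m, y', h1, h2⟩ := ih hy
      exact ⟨m + 1, y', h1, .cons ⟨hP, ha⟩ hA h2⟩

theorem Chain.snoc {b : V} (h : ψ.Chain U P n a b) (hb : P b) (hA : ψ.Arc U b y) :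
    ψ.Chain U P (n + 1) a y := by
  induction h with
  | nil a => exact .cons hb hA (.nil _)
  | cons hP hA' _ ih => exact .cons hP hA' (ih hb hA)

/-- A chain all of whose arcs survive a change of coloring, unless their tails become bad,
survives or leads to a bad vertex afterwards. -/
theorem Chain.persist (h : ψ.Chain U P n a y)
    (hA : ∀ a a', P a → ψ.Arc U a a' → ψ'.Arc U a a' ∨ ψ'.Bad U a) :
    ψ'.Chain U P n a y ∨ ∃ m y', ψ'.Chain U P m a y' ∧ ψ'.Bad U y' := by
  induction h with
  | nil a => exact Or.inl (.nil a)
  | @cons n a a' y hP hA' _ ih =>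
    rcases hA a a' hP hA' with h1 | h1
    · rcases ih with h2 | ⟨m, y', h2, h3⟩
      · exact Or.inl (.cons hP h1 h2)
      · exact Or.inr ⟨m + 1, y', .cons hP h1 h2, h3⟩
    · exact Or.inr ⟨0, a, .nil a, h1⟩

theorem Chain.map {s' : V} {ψ' : G.NearColoring r s' D} (h : ψ.Chain U P n a y)
    (hA : ∀ a a', P a → ψ.Arc U a a' → ψ'.Arc U a a') : ψ'.Chain U P n a y := by
  induction h with
  | nil a => exact .nil a
  | cons hP hA' _ ih => exact .cons hP (hA _ _ hP hA') ih

/-- If the arcs not touching the end of a chain survive and the tails of the arcs to its end become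
bad, then a shorter chain leads to a bad vertex. -/
theorem Chain.eq_or_shorten (h : ψ.Chain U P n a y)
    (hA : ∀ a a', a ≠ y → a' ≠ y → ψ.Arc U a a' → ψ'.Arc U a a')
    (hB : ∀ a, a ≠ y → ψ.Arc U a y → ψ'.Bad U a) :
    a = y ∨ ∃ m < n, ∃ y', ψ'.Chain U P m a y' ∧ ψ'.Bad U y' := by
  induction h with
  | nil => exact Or.inl rfl
  | @cons m a a' y hP hA' _ ih =>
    by_cases hay : a = y
    · exact Or.inl hay
    right
    rcases ih hA hB with rfl | ⟨m', hm', y', h1, h2⟩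
    · exact ⟨0, by omega, a, .nil a, hB a hay hA'⟩
    by_cases ha'y : a' = y
    · subst ha'y
      exact ⟨0, by omega, a, .nil a, hB a hay hA'⟩
    · exact ⟨m' + 1, by omega, y', .cons hP (hA a a' hay ha'y hA') h1, h2⟩

theorem Chain.eq_or_exists_last (h : ψ.Chain U P n a y) :
    a = y ∨ ∃ c, ψ.mate c r = y ∧ ψ.LowEdge U c := by
  induction h with
  | nil a => exact Or.inl rfl
  | @cons n a a' y _ hA _ ih =>
    obtain ⟨c, _, h2, h3⟩ := hA
    rcases ih with rfl | ih
    · exact Or.inr ⟨c, h2, h3⟩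
    · exact Or.inr ih

/-- A fan swallows every chain that starts in it, gaining only vertices outside `U`. -/
theorem Chain.exists_fan {T : Finset V} (h : ψ.Chain U P n a y) (hr : G.degree r = D)
    (hT : ψ.Fan T) (ha : a ∈ T) :
    ∃ T', ψ.Fan T' ∧ T ⊆ T' ∧ y ∈ T' ∧ ∀ x ∈ T', x ∈ T ∨ x ∉ U := by
  induction h generalizing T with
  | nil a => exact ⟨T, hT, subset_rfl, ha, fun x hx => Or.inl hx⟩
  | @cons n a a' y _ hA _ ih =>
    obtain ⟨c, h1, rfl, h3⟩ := hA
    obtain ⟨T', h4, h5, h6, h7⟩ := ih (hT.add ha h1 rfl fun h => by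
      have := h3.2
      rw [h, hr] at this
      exact lt_irrefl _ this) (Finset.mem_insert_self _ _)
    refine ⟨T', h4, (Finset.subset_insert _ _).trans h5, h6, fun x hx => ?_⟩
    rcases h7 x hx with h8 | h8
    · rcases Finset.mem_insert.1 h8 with rfl | h8
      · exact Or.inr h3.1
      · exact Or.inl h8
    · exact Or.inr h8

theorem Full.notMem {c : Fin D} (h : ψ.Full U c) (hc : ψ.mate c a = a) : a ∉ U := fun ha =>
  h.2 a ha hc

theorem Full.ne_center {c : Fin D} (h : ψ.Full U c) (hc : ψ.mate c a = a) : a ≠ r := by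
  rintro rfl
  exact h.1 hc

theorem Full.edge_notMem {c : Fin D} (h : ψ.Full U c) (hU : ψ.Fan U) : ψ.mate c r ∉ U := fun h' =>
  let ⟨u, hu, hc⟩ := hU.exists_missing h'
  h.2 u hu hc

theorem not_full_iff {c : Fin D} :
    ¬ ψ.Full U c ↔ ψ.mate c r = r ∨ ∃ u ∈ U, ψ.mate c u = u := by
  simp only [Full, not_and_or, not_not, not_forall, exists_prop]

theorem Safe.lowEdge {c : Fin D} (h : ψ.Safe U c) (hU : ψ.Fan U) (hc : ψ.Full U c) :
    ψ.LowEdge U c := by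
  have h1 := hc.edge_notMem hU
  rcases h with h | h | h
  exacts [absurd h hc.1, absurd h h1, ⟨h1, h⟩]

end chain

variable {U : Finset V} (hC : Core G r s D U)
include hC

theorem Core.exists_missing_center (ψ : G.NearColoring r s D) : ∃ ρ, ψ.mate ρ r = r := by
  have h := ψ.card_missing_center hC.adj
  rw [hC.degree_center] at h
  obtain ⟨c, hc⟩ := Finset.card_pos.1 (show 0 < (ψ.missing r).card by omega)
  exact ⟨c, mem_missing.1 hc⟩

theorem Core.missing_center_unique (ψ : G.NearColoring r s D) {c d : Fin D}
    (hc : ψ.mate c r = r) (hd : ψ.mate d r = r) : c = d := by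
  have h := ψ.card_missing_center hC.adj
  rw [hC.degree_center] at h
  exact Finset.card_le_one.1 (show (ψ.missing r).card ≤ 1 by omega) _ (mem_missing.2 hc) _
    (mem_missing.2 hd)

theorem Core.exists_missing (ψ : G.NearColoring r s D) {x : V} (hx : G.degree x < D) :
    ∃ c, ψ.mate c x = x := by
  have hxr : x ≠ r := by
    rintro rfl
    exact hx.ne hC.degree_center
  have : 0 < (ψ.missing x).card := by
    by_cases hxs : x = s
    · subst hxs
      have h := ψ.card_missing_root hC.adj
      omega
    · have h := ψ.card_missing hxr hxs
      omega
  obtain ⟨c, hc⟩ := Finset.card_pos.1 this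
  exact ⟨c, mem_missing.1 hc⟩

omit hC in
theorem degree_lt_of_missing (ψ : G.NearColoring r s D) {x : V} {c : Fin D} (hr : x ≠ r)
    (hs : x ≠ s) (hc : ψ.mate c x = x) : G.degree x < D := by
  have h := ψ.card_missing hr hs
  have := Finset.card_pos.2 ⟨c, mem_missing.2 hc⟩
  omega

variable {ψ : G.NearColoring r s D} {β ρ : Fin D} (hG : ψ.Good U β)
include hG

omit hC in
theorem Good.root_mem : s ∈ U := hG.fan.root_mem

theorem Core.center_notMem : r ∉ U := hG.fan.center_notMem hC.adj

theorem Core.ne_center_of_missing {u : V} {c : Fin D} (hu : u ∈ U) (hc : ψ.mate c u = u) :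
    ψ.mate c r ≠ r := hG.fan.ne_of_missing_center hC.adj hC.not_colorable hu hc

theorem Core.elementary {u w : V} {c : Fin D} (hu : u ∈ U) (hw : w ∈ U) (hcu : ψ.mate c u = u)
    (hcw : ψ.mate c w = w) : u = w := by
  obtain ⟨ρ, hρ⟩ := hC.exists_missing_center ψ
  exact hG.fan.elementary hC.adj hC.not_colorable hρ hu hw hcu hcw

omit hC in
theorem Good.not_full : ¬ ψ.Full U β := fun h => h.2 s hG.root_mem hG.root

/-- A missing color of `U` that leaves `U` at the center leads to a vertex of full degree: from
any other vertex the fan could be extended once more. -/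
theorem Core.degree_leaf {u : V} {c : Fin D} (hu : u ∈ U) (hc : ψ.mate c u = u)
    (hw : ψ.mate c r ∉ U) : ¬ G.degree (ψ.mate c r) < D := by
  intro hlt
  obtain ⟨γ, hγ⟩ := hC.exists_missing ψ hlt
  set w := ψ.mate c r with hw'
  have hwr : w ≠ r := hC.ne_center_of_missing hG hu hc
  have hF := hG.fan.step hu hc hw'.symm hw hwr
  have hwm : w ∈ insert w U := Finset.mem_insert_self _ _
  have h1 := hF.ne_of_missing_center hC.adj hC.not_colorable hwm hγ
  obtain ⟨ρ, hρ⟩ := hC.exists_missing_center ψ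
  have h2 : ψ.mate γ r ∉ insert w U := by
    rw [Finset.mem_insert, not_or]
    refine ⟨fun h => hwr ?_, fun h => ?_⟩
    · rw [← h, ψ.inv] at hγ
      rw [← h, ← hγ]
    · obtain ⟨x, hx, hx'⟩ := hG.fan.exists_missing h
      have := hF.elementary hC.adj hC.not_colorable hρ (Finset.mem_insert_of_mem hx) hwm hx' hγ
      exact hw (this ▸ hx)
  have := hC.card_le ψ _ ((Finset.subset_insert w U).trans (Finset.subset_insert _ _))
    (hF.step hwm hγ rfl h2 h1)
  rw [Finset.card_insert_of_notMem h2, Finset.card_insert_of_notMem hw] at this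
  omega

/-- Only `β` leads from the center out of the fan: by maximality, no second missing color does. -/
theorem Core.edge_mem_of_missing {u : V} {c : Fin D} (hu : u ∈ U) (hc : ψ.mate c u = u)
    (hne : c ≠ β) : ψ.mate c r ∈ U := by
  by_contra hcon
  have hβr := hC.ne_center_of_missing hG hG.root_mem hG.root
  have hcr := hC.ne_center_of_missing hG hu hc
  have h1 := hG.fan.step hG.root_mem hG.root rfl hG.leaf hβr
  have hcon' : ψ.mate c r ∉ insert (ψ.mate β r) U := by
    rw [Finset.mem_insert, not_or]
    exact ⟨fun h => hne (ψ.color_unique h rfl hβr), hcon⟩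
  have := hC.card_le ψ _ ((Finset.subset_insert _ U).trans (Finset.subset_insert _ _))
    (h1.step (Finset.mem_insert_of_mem hu) hc rfl hcon' hcr)
  rw [Finset.card_insert_of_notMem hcon', Finset.card_insert_of_notMem hG.leaf] at this
  omega

theorem Core.full_of_lowEdge {c : Fin D} (h : ψ.LowEdge U c) : ψ.Full U c := by
  by_contra hcon
  rcases not_full_iff.1 hcon with h1 | ⟨u, hu, hc⟩
  · have := h.2
    rw [h1, hC.degree_center] at this
    exact lt_irrefl _ this
  · exact hC.degree_leaf hG hu hc h.1 h.2

/-! ### Kempe changes that preserve the fan -/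

section center

variable (hρ : ψ.mate ρ r = r)
include hρ

theorem Core.mem_comp_center {u : V} {c : Fin D} (hu : u ∈ U) (hc : ψ.mate c u = u) :
    u ∈ ψ.comp ρ c r := hG.fan.mem_comp hC.adj hC.not_colorable hρ hu hc

variable {c : Fin D} {K : Set V} (hK : ψ.KempeClosed ρ c K) (hrK : r ∉ K)
include hrK

theorem Core.good_kempe_center : (ψ.kempe ρ c K hK).Good U β where
  fan := hG.fan.kempe hC.adj hC.not_colorable hρ hK hrK
  root := (hG.fan.kempe_missing_iff hC.adj hC.not_colorable hρ hK hrK hG.root_mem _).2 hG.root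
  leaf := by
    rw [kempe_of_notMem hK hrK]
    exact hG.leaf

theorem Core.full_kempe_center {d : Fin D} : (ψ.kempe ρ c K hK).Full U d ↔ ψ.Full U d := by
  have : ∀ u ∈ U, _ := fun u hu =>
    hG.fan.kempe_missing_iff hC.adj hC.not_colorable hρ hK hrK hu d
  simp +contextual [Full, kempe_of_notMem hK hrK, this]

omit hC hG hρ in
theorem lowEdge_kempe_center {d : Fin D} : (ψ.kempe ρ c K hK).LowEdge U d ↔ ψ.LowEdge U d := by
  rw [LowEdge, kempe_of_notMem hK hrK, LowEdge]

omit hC hG hρ in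
theorem safe_kempe_center {d : Fin D} : (ψ.kempe ρ c K hK).Safe U d ↔ ψ.Safe U d := by
  rw [Safe, kempe_of_notMem hK hrK, Safe]

theorem Core.arc_kempe_center (hc : ¬ ψ.Full U c) {a a' : V} (h : ψ.Arc U a a') :
    (ψ.kempe ρ c K hK).Arc U a a' := by
  obtain ⟨d, h1, h2, h3⟩ := h
  have hfull := hC.full_of_lowEdge hG h3
  refine ⟨d, ?_, (kempe_of_notMem hK hrK).trans h2, (lowEdge_kempe_center hK hrK).2 h3⟩
  rw [kempe_of_ne hK, h1]
  · rintro rfl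
    exact hfull.1 hρ
  · rintro rfl
    exact hc hfull

theorem Core.bad_kempe_center (hc : ¬ ψ.Full U c) {y : V} (h : ψ.Bad U y) :
    (ψ.kempe ρ c K hK).Bad U y := by
  obtain ⟨hyU, hyr, d, hd, hdf⟩ := h
  have hfull := fun e => hC.full_kempe_center hG hρ hK hrK (d := e)
  by_cases hyK : y ∈ K
  · by_cases h1 : d = ρ
    · exact ⟨hyU, hyr, c, by rw [kempe_right hK hyK, ← h1, hd], by rwa [hfull]⟩
    by_cases h2 : d = c
    · refine ⟨hyU, hyr, ρ, by rw [kempe_left hK hyK, ← h2, hd], ?_⟩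
      rw [hfull]
      exact fun h => h.1 hρ
    · exact ⟨hyU, hyr, d, by rw [kempe_of_ne hK h1 h2, hd], by rwa [hfull]⟩
  · exact ⟨hyU, hyr, d, by rw [kempe_of_notMem hK hyK, hd], by rwa [hfull]⟩

end center

section root

variable {τ : Fin D} (hτ : ψ.Full U τ) {K : Set V} (hK : ψ.KempeClosed β τ K)
include hτ

theorem Core.kempe_root_mate {d : Fin D} (hd : ψ.mate d r ∈ U) :
    (ψ.kempe β τ K hK).mate d r = ψ.mate d r := by
  apply kempe_of_ne
  · rintro rfl
    exact hG.leaf hd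
  · rintro rfl
    exact hτ.edge_notMem hG.fan hd

/-- Away from the root, the vertices of `U` keep their missing colors. -/
theorem Core.kempe_root_missing_iff {u : V} (hu : u ∈ U) (hus : u = s → s ∉ K) (d : Fin D) :
    (ψ.kempe β τ K hK).mate d u = u ↔ ψ.mate d u = u := by
  by_cases huK : u ∈ K
  · have hus' : u ≠ s := fun h => hus h (h ▸ huK)
    have h1 : ψ.mate β u ≠ u := fun h => hus' (hC.elementary hG hu hG.root_mem h hG.root)
    rcases eq_or_ne d β with rfl | h3
    · simp [kempe_left hK huK, h1, hτ.2 u hu]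
    rcases eq_or_ne d τ with rfl | h4
    · simp [kempe_right hK huK, h1, hτ.2 u hu]
    rw [kempe_of_ne hK h3 h4]
  · rw [kempe_of_notMem hK huK]

theorem Core.kempe_root_leaf {d : Fin D} (hd : d = β ∨ d = τ) :
    (ψ.kempe β τ K hK).mate d r ∉ U := by
  have h1 := hτ.edge_notMem hG.fan
  by_cases hrK : r ∈ K
  · rcases hd with rfl | rfl
    · rwa [kempe_left hK hrK]
    · rw [kempe_right hK hrK]
      exact hG.leaf
  · rw [kempe_of_notMem hK hrK]
    rcases hd with rfl | rfl
    exacts [hG.leaf, h1]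

theorem Core.fan_kempe_root : (ψ.kempe β τ K hK).Fan U := by
  refine hG.fan.transfer (fun u hu d hd hdr => ?_) fun d hd => hC.kempe_root_mate hG hτ hK hd
  have h1 : d ≠ β := by
    rintro rfl
    exact hG.leaf hdr
  have h2 : d ≠ τ := by
    rintro rfl
    exact hτ.2 u hu hd
  rw [kempe_of_ne hK h1 h2, hd]

theorem Core.good_kempe_root (hs : s ∉ K) : (ψ.kempe β τ K hK).Good U β where
  fan := hC.fan_kempe_root hG hτ hK
  root := by rw [kempe_of_notMem hK hs, hG.root]
  leaf := hC.kempe_root_leaf hG hτ hK (Or.inl rfl)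

theorem Core.kempe_root_center {d : Fin D} : (ψ.kempe β τ K hK).mate d r = r ↔ ψ.mate d r = r := by
  by_cases hrK : r ∈ K
  · have h1 := hC.ne_center_of_missing hG hG.root_mem hG.root
    have h2 := hτ.1
    rcases eq_or_ne d β with rfl | h3
    · simp [kempe_left hK hrK, h1, h2]
    rcases eq_or_ne d τ with rfl | h4
    · simp [kempe_right hK hrK, h1, h2]
    rw [kempe_of_ne hK h3 h4]
  · rw [kempe_of_notMem hK hrK]

theorem Core.full_kempe_root (hs : s ∉ K) {d : Fin D} :
    (ψ.kempe β τ K hK).Full U d ↔ ψ.Full U d := by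
  have h1 : ∀ u ∈ U, _ := fun u hu =>
    hC.kempe_root_missing_iff hG hτ hK hu (fun _ => hs) d
  have h2 := hC.kempe_root_center hG hτ hK (d := d)
  simp +contextual [Full, h1, h2]

include hK in
/-- If a Kempe change away from the root moves the center, then the color `τ` at the center leads
to a vertex of full degree. -/
theorem Core.center_notMem_of_lowEdge (hs : s ∉ K) (h : ψ.LowEdge U τ) : r ∉ K := by
  intro hrK
  have hG' := hC.good_kempe_root hG hτ hK hs
  refine hC.degree_leaf hG' hG'.root_mem hG'.root hG'.leaf ?_
  rw [kempe_left hK hrK]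
  exact h.2

theorem Core.kempe_root_lowEdge_mate (hs : s ∉ K) {d : Fin D} (h : ψ.LowEdge U d) :
    (ψ.kempe β τ K hK).mate d r = ψ.mate d r := by
  rcases eq_or_ne d τ with rfl | h1
  · exact kempe_of_notMem hK (hC.center_notMem_of_lowEdge hG hτ hK hs h)
  · refine kempe_of_ne hK ?_ h1
    rintro rfl
    exact hC.degree_leaf hG hG.root_mem hG.root h.1 h.2

theorem Core.lowEdge_kempe_root (hs : s ∉ K) {d : Fin D} (h : ψ.LowEdge U d) :
    (ψ.kempe β τ K hK).LowEdge U d := by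
  have := hC.kempe_root_lowEdge_mate hG hτ hK hs h
  exact ⟨this ▸ h.1, this ▸ h.2⟩

theorem Core.safe_kempe_root (hs : s ∉ K) {d : Fin D} (h : ψ.Safe U d) (hd : d ≠ β) :
    (ψ.kempe β τ K hK).Safe U d := by
  rcases eq_or_ne d τ with rfl | h1
  · have h2 := hC.lowEdge_kempe_root hG hτ hK hs (h.lowEdge hG.fan hτ)
    exact Or.inr (Or.inr h2.2)
  · unfold Safe at *
    rwa [kempe_of_ne hK hd h1]

theorem Core.arc_kempe_root (hs : s ∉ K) {a a' : V} (h : ψ.Arc U a a') :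
    (ψ.kempe β τ K hK).Arc U a a' ∨ (ψ.kempe β τ K hK).Bad U a := by
  obtain ⟨c, h1, h2, h3⟩ := h
  have hfull := hC.full_of_lowEdge hG h3
  by_cases h4 : c = τ ∧ a ∈ K
  · obtain ⟨rfl, haK⟩ := h4
    refine Or.inr ⟨hfull.notMem h1, hfull.ne_center h1, β, ?_, ?_⟩
    · rw [kempe_left hK haK, h1]
    · rw [hC.full_kempe_root hG hτ hK hs]
      exact hG.not_full
  · refine Or.inl ⟨c, ?_, ?_, hC.lowEdge_kempe_root hG hτ hK hs h3⟩
    · by_cases haK : a ∈ K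
      · rw [kempe_of_ne hK, h1]
        · rintro rfl
          exact hG.not_full hfull
        · exact fun h => h4 ⟨h, haK⟩
      · rw [kempe_of_notMem hK haK, h1]
    · rw [hC.kempe_root_lowEdge_mate hG hτ hK hs h3, h2]

end root

section outside

variable {a b : Fin D} {K : Set V} (hK : ψ.KempeClosed a b K) (hU : ∀ u ∈ U, u ∉ K) (hrK : r ∉ K)
include hU hrK

omit hC in
theorem Good.kempe_outside : (ψ.kempe a b K hK).Good U β where
  fan := hG.fan.transfer (fun u hu d hd _ => by rw [kempe_of_notMem hK (hU u hu), hd])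
    fun d _ => kempe_of_notMem hK hrK
  root := by rw [kempe_of_notMem hK (hU s hG.root_mem), hG.root]
  leaf := by
    rw [kempe_of_notMem hK hrK]
    exact hG.leaf

omit hC hG in
theorem full_kempe_outside {d : Fin D} : (ψ.kempe a b K hK).Full U d ↔ ψ.Full U d := by
  have : ∀ u ∈ U, (ψ.kempe a b K hK).mate d u = ψ.mate d u := fun u hu =>
    kempe_of_notMem hK (hU u hu)
  simp +contextual [Full, kempe_of_notMem hK hrK, this]

end outside

/-! ### Neighbors of the root outside the fan -/

/-- A neighbor of the root along a safe color cannot miss the color `β` of the root: recoloring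
the edge to `β` would contradict the properties of the fan. -/
theorem Core.safe_ne_beta {z : V} {σ : Fin D} (hzU : z ∉ U) (hzr : z ≠ r) (hσ : ψ.mate σ s = z)
    (hsafe : ψ.Safe U σ) : ψ.mate β z ≠ z := by
  intro hβz
  have hsU := hG.root_mem
  have hzs : z ≠ s := fun h => hzU (h ▸ hsU)
  let K := ψ.pair_closed hσ hG.root hβz
  have hσβ : σ ≠ β := by
    rintro rfl
    exact hzs (hσ.symm.trans hG.root)
  have hout : ∀ x, x ≠ s → x ≠ z → x ∉ ({s, z} : Set V) := by
    rintro x h1 h2 (rfl | rfl)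
    exacts [h1 rfl, h2 rfl]
  have hr : r ∉ ({s, z} : Set V) := hout r hC.adj.ne hzr.symm
  have hr' : ∀ d, (ψ.kempe σ β _ K).mate d r = ψ.mate d r := fun d => kempe_of_notMem K hr
  have hu : ∀ u ∈ U, u ≠ s → ∀ d, (ψ.kempe σ β _ K).mate d u = ψ.mate d u := fun u hu hus d =>
    kempe_of_notMem K (hout u hus fun h => hzU (h ▸ hu))
  have hs' : (ψ.kempe σ β _ K).mate σ s = s := by rw [kempe_left K (by simp), hG.root]
  have hF : (ψ.kempe σ β _ K).Fan U := by
    refine hG.fan.transfer (fun u huU d hd hdr => ?_) fun d _ => hr' d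
    by_cases hus : u = s
    · subst hus
      rw [kempe_of_ne K, hd]
      · rintro rfl
        exact hzs (hσ.symm.trans hd)
      · rintro rfl
        exact hG.leaf hdr
    · rw [hu u huU hus, hd]
  by_cases h1 : ψ.mate σ r = r
  · exact hF.ne_of_missing_center hC.adj hC.not_colorable hsU hs' ((hr' σ).trans h1)
  by_cases h2 : ψ.mate σ r ∈ U
  · obtain ⟨x, hx, hxσ⟩ := hG.fan.exists_missing h2
    have hxs : x ≠ s := by
      rintro rfl
      exact hzs (hσ.symm.trans hxσ)
    obtain ⟨ρ, hρ⟩ := hC.exists_missing_center (ψ.kempe σ β _ K)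
    exact hxs (hF.elementary hC.adj hC.not_colorable hρ hx hsU
      ((hu x hx hxs σ).trans hxσ) hs')
  · have hG' : (ψ.kempe σ β _ K).Good U σ := ⟨hF, hs', (hr' σ).symm ▸ h2⟩
    refine hC.degree_leaf hG' hsU hs' hG'.leaf ?_
    rw [hr']
    exact (hsafe.resolve_left h1).resolve_left h2

/-- The same holds for the color `ρ` missing at the center, since `ρ` and `β` can be exchanged at `z`
without affecting the center and the root. -/
theorem Core.safe_ne_rho (hρ : ψ.mate ρ r = r) {z : V} {σ : Fin D} (hzU : z ∉ U) (hzr : z ≠ r)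
    (hσ : ψ.mate σ s = z) (hsafe : ψ.Safe U σ) : ψ.mate ρ z ≠ z := by
  intro hρz
  have hsU := hG.root_mem
  have hzs : z ≠ s := fun h => hzU (h ▸ hsU)
  have hK := ψ.comp_closed ρ β z
  have h1 := hC.mem_comp_center hG hρ hsU hG.root
  have hrK : r ∉ ψ.comp ρ β z := fun h => ψ.three_ends (Or.inl hρ) (Or.inr hG.root) (Or.inl hρz)
    hC.adj.ne hzr.symm hzs.symm h1 (mem_comp_symm h)
  have hsK : s ∉ ψ.comp ρ β z := fun h => by
    rw [← comp_eq h] at hrK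
    exact hrK (mem_comp_symm h1)
  refine hC.safe_ne_beta (hC.good_kempe_center hG hρ hK hrK) hzU hzr (σ := σ) ?_
    ((safe_kempe_center hK hrK).2 hsafe) ?_
  · rw [kempe_of_notMem hK hsK, hσ]
  · rw [kempe_right hK (ψ.mem_comp_self _ _ _), hρz]

omit hG in
/-- No chain leads from a neighbor of the root along a safe color to a bad vertex. Otherwise
recolor the last edge of the chain at the center with the color missing there; this shortens the
chain. -/
theorem Core.no_chain : ∀ (n : ℕ) {ψ : G.NearColoring r s D} {β σ : Fin D} {z y : V}
    {P : V → Prop}, ψ.Good U β → z ∉ U → z ≠ r → ψ.mate σ s = z → ψ.Safe U σ →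
    ψ.Chain U P n z y → ψ.Bad U y → False := by
  intro n
  induction n using Nat.strong_induction_on with
  | _ n ih
  have keyA : ∀ {ψ : G.NearColoring r s D} {β σ ρ : Fin D} {z y : V} {P : V → Prop}, ψ.Good U β →
      z ∉ U → z ≠ r → ψ.mate σ s = z → ψ.Safe U σ → ψ.Chain U P n z y → y ∉ U → y ≠ r →
      ψ.mate ρ r = r → ψ.mate ρ y = y → False := by
    intro ψ β σ ρ z y P hG hzU hzr hσ hsafe hch hyU hyr hρ hρy
    rcases hch.eq_or_exists_last with rfl | ⟨δ, hδ, hδl⟩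
    · exact hC.safe_ne_rho hG hρ hzU hzr hσ hsafe hρy
    have hsU := hG.root_mem
    have hrU := hC.center_notMem hG
    have hδρ : δ ≠ ρ := by
      rintro rfl
      exact hyr (hδ.symm.trans hρ)
    let K := ψ.pair_closed hδ hρ hρy
    have hout : ∀ x, x ≠ r → x ≠ y → x ∉ ({r, y} : Set V) := by
      rintro x h1 h2 (rfl | rfl)
      exacts [h1 rfl, h2 rfl]
    have hu : ∀ u ∈ U, u ∉ ({r, y} : Set V) := fun u hu =>
      hout u (fun h => hrU (h ▸ hu)) fun h => hyU (h ▸ hu)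
    have hδr : (ψ.kempe δ ρ _ K).mate δ r = r := by rw [kempe_left K (by simp), hρ]
    have hρr : (ψ.kempe δ ρ _ K).mate ρ r = y := by rw [kempe_right K (by simp), hδ]
    have hG' : (ψ.kempe δ ρ _ K).Good U β := by
      refine ⟨hG.fan.transfer (fun u huU d hd _ => ?_) fun d hd => ?_, ?_, ?_⟩
      · rw [kempe_of_notMem K (hu u huU), hd]
      · apply kempe_of_ne
        · rintro rfl
          exact hyU (hδ ▸ hd)
        · rintro rfl
          exact hrU (hρ ▸ hd)
      · rw [kempe_of_notMem K (hu s hsU), hG.root]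
      · by_cases h1 : β = δ
        · rwa [h1, hδr]
        by_cases h2 : β = ρ
        · rwa [h2, hρr]
        rw [kempe_of_ne K h1 h2]
        exact hG.leaf
    have hsafe' : (ψ.kempe δ ρ _ K).Safe U σ := by
      by_cases h1 : σ = δ
      · exact Or.inl (h1 ▸ hδr)
      by_cases h2 : σ = ρ
      · exact Or.inr (Or.inr (by rw [h2, hρr, ← hδ]; exact hδl.2))
      unfold Safe at *
      rwa [kempe_of_ne K h1 h2]
    have claim := hch.eq_or_shorten (ψ' := ψ.kempe δ ρ _ K) (fun a a' _ ha' hA => ?_)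
      (fun a ha hA => ?_)
    rotate_left
    · obtain ⟨c, h1, h2, h3⟩ := hA
      have hfull := hC.full_of_lowEdge hG h3
      have e : ∀ x, (ψ.kempe δ ρ _ K).mate c x = ψ.mate c x := by
        intro x
        apply kempe_of_ne
        · rintro rfl
          exact ha' (h2.symm.trans hδ)
        · rintro rfl
          exact hfull.1 hρ
      exact ⟨c, (e a).trans h1, (e r).trans h2, by rw [LowEdge, e]; exact h3⟩
    · obtain ⟨c, h1, h2, h3⟩ := hA
      have hfull := hC.full_of_lowEdge hG h3
      obtain rfl : c = δ := ψ.color_unique h2 hδ hyr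
      refine ⟨hfull.notMem h1, hfull.ne_center h1, c, ?_, fun h4 => h4.1 hδr⟩
      rw [kempe_of_notMem K (hout a (hfull.ne_center h1) ha), h1]
    rcases claim with rfl | ⟨m', hm', y', h1, h2⟩
    · exact hC.safe_ne_rho hG hρ hzU hzr hσ hsafe hρy
    · refine ih m' hm' hG' hzU hzr (σ := σ) ?_ hsafe' h1 h2
      rw [kempe_of_notMem K (hu s hsU), hσ]
  intro ψ β σ z y P hG hzU hzr hσ hsafe hch ⟨hyU, hyr, c, hcy, hcf⟩
  rcases not_full_iff.1 hcf with hcr | ⟨u, hu, hcu⟩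
  · exact keyA hG hzU hzr hσ hsafe hch hyU hyr hcr hcy
  obtain ⟨ρ, hρ⟩ := hC.exists_missing_center ψ
  have hsU := hG.root_mem
  have hrU := hC.center_notMem hG
  have hK := ψ.comp_closed ρ c y
  have hlink := hC.mem_comp_center hG hρ hu hcu
  have hrK : r ∉ ψ.comp ρ c y := fun h => ψ.three_ends (Or.inl hρ) (Or.inr hcu) (Or.inr hcy)
    (fun h => hrU (h ▸ hu)) hyr.symm (fun h => hyU (h ▸ hu)) hlink (mem_comp_symm h)
  have hr' : ∀ d, (ψ.kempe ρ c _ hK).mate d r = ψ.mate d r := fun d => kempe_of_notMem hK hrK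
  have hG' := hC.good_kempe_center hG hρ hK hrK
  have hch' : (ψ.kempe ρ c _ hK).Chain U P n z y :=
    hch.map fun a a' _ hA => hC.arc_kempe_center hG hρ hK hrK hcf hA
  have hρy : (ψ.kempe ρ c _ hK).mate ρ y = y := by
    rw [kempe_left hK (ψ.mem_comp_self _ _ _), hcy]
  have fin : ∀ σ', (ψ.kempe ρ c _ hK).mate σ' s = z → ψ.Safe U σ' → False := fun σ' h1 h2 =>
    keyA hG' hzU hzr h1 ((safe_kempe_center hK hrK).2 h2) hch' hyU hyr ((hr' ρ).trans hρ) hρy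
  by_cases hsK : s ∈ ψ.comp ρ c y
  · have hcβ : c ≠ β := by
      rintro rfl
      rw [← comp_eq hsK] at hrK
      exact hrK (mem_comp_symm (hC.mem_comp_center hG hρ hsU hG.root))
    by_cases h1 : σ = ρ
    · exact fin c (by rw [kempe_right hK hsK, ← h1, hσ])
        (Or.inr (Or.inl (hC.edge_mem_of_missing hG hu hcu hcβ)))
    by_cases h2 : σ = c
    · exact fin ρ (by rw [kempe_left hK hsK, ← h2, hσ]) (Or.inl hρ)
    · exact fin σ (by rw [kempe_of_ne hK h1 h2, hσ]) hsafe
  · exact fin σ (by rw [kempe_of_notMem hK hsK, hσ]) hsafe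

end

/-! ### Exchanging a missing color of a fan vertex -/

section

variable {V : Type*} {G : SimpleGraph V} {r s : V} {D : ℕ}

/-- `ψ'` arises from `ψ` by freeing the color `g` at `v`, away from the fan `S`, and then
recoloring the edge `vz` from `τ` to `g`, where `z` is a vertex of `S` missing `g`. -/
structure Exchanged (ψ ψ' : G.NearColoring r s D) (S : Finset V) (ρ g τ : Fin D) (v z : V) :
    Prop where
  center : ∀ c, ψ'.mate c r = ψ.mate c r
  missing_iff : ∀ u ∈ S, u ≠ z → ∀ c, ψ'.mate c u = u ↔ ψ.mate c u = u
  missing_of_ne : ∀ c, c ≠ g → ψ.mate c z = z → ψ'.mate c z = z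
  missing_right : ψ'.mate τ z = z
  missing_left : ψ'.mate τ v = v
  of_ne : ∀ c, c ≠ ρ → c ≠ g → c ≠ τ → ∀ x, ψ'.mate c x = ψ.mate c x
  of_notMem : ∀ x, x ≠ v → x ≠ z → ψ'.mate τ x = ψ.mate τ x

section exchange

variable {ψ ψ' : G.NearColoring r s D} {S U : Finset V} {ρ g τ : Fin D} {v z : V}

theorem Exchanged.fan (h : Exchanged ψ ψ' S ρ g τ v z) {P : Finset V} (hP : ψ.Fan P) (hPS : P ⊆ S)
    (hz : z ∉ P) : ψ'.Fan P :=
  hP.transfer (fun u hu c hc _ => (h.missing_iff u (hPS hu) (fun h => hz (h ▸ hu)) c).2 hc)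
    fun c _ => h.center c

variable (hrs : G.Adj r s) (hnc : ¬ G.lineGraph.Colorable D)
include hrs hnc

/-- A vertex missing the color `ρ` of the center can be made to miss `g` by a Kempe change away from
the path with these colors between the center and `z`. -/
theorem Fan.exists_exchanged (h : ψ.Fan S) (hρ : ψ.mate ρ r = r) (hvS : v ∉ S) (hvr : v ≠ r)
    (hρv : ψ.mate ρ v = v) (hzS : z ∈ S) (hvz : ψ.mate τ v = z) (hg : ψ.mate g z = z) :
    ∃ ψ', Exchanged ψ ψ' S ρ g τ v z := by
  have hzv : z ≠ v := fun h => hvS (h ▸ hzS)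
  have hzr : z ≠ r := fun h' => h.center_notMem hrs (h' ▸ hzS)
  have hK := ψ.comp_closed ρ g v
  have hzr' := h.mem_comp hrs hnc hρ hzS hg
  have hrK : r ∉ ψ.comp ρ g v := fun h' => ψ.three_ends (Or.inl hρ) (Or.inr hg) (Or.inl hρv)
    hzr.symm hvr.symm hzv hzr' (mem_comp_symm h')
  have hτρ : τ ≠ ρ := by
    rintro rfl
    exact hzv (hvz.symm.trans hρv)
  have hτg : τ ≠ g := by
    rintro rfl
    exact hzv (hg.symm.trans (ψ.mate_eq_comm.1 hvz))
  have hiff := fun u hu => h.kempe_missing_iff hrs hnc hρ hK hrK (w := u) hu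
  have hvz' : (ψ.kempe ρ g _ hK).mate τ v = z := by rw [kempe_of_ne hK hτρ hτg, hvz]
  have hv' : (ψ.kempe ρ g _ hK).mate g v = v := by
    rw [kempe_right hK (ψ.mem_comp_self _ _ _), hρv]
  have hz' : (ψ.kempe ρ g _ hK).mate g z = z := (hiff z hzS g).2 hg
  have hL := pair_closed hvz' hv' hz'
  have hout : ∀ x, x ≠ v → x ≠ z → x ∉ ({v, z} : Set V) := by
    rintro x h1 h2 (rfl | rfl)
    exacts [h1 rfl, h2 rfl]
  refine ⟨(ψ.kempe ρ g _ hK).kempe τ g _ hL, fun c => ?_, fun u hu huz c => ?_,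
    fun c hcg hc => ?_, ?_, ?_, fun c h1 h2 h3 x => ?_, fun x h1 h2 => ?_⟩
  · rw [kempe_of_notMem hL (hout r hvr.symm hzr.symm), kempe_of_notMem hK hrK]
  · rw [kempe_of_notMem hL (hout u (fun h => hvS (h ▸ hu)) huz), hiff u hu]
  · rw [kempe_of_ne hL _ hcg, hiff z hzS, hc]
    rintro rfl
    exact hzv (hc.symm.trans (ψ.mate_eq_comm.1 hvz))
  · rw [kempe_left hL (by simp), hz']
  · rw [kempe_left hL (by simp), hv']
  · rw [kempe_of_ne hL h3 h2, kempe_of_ne hK h1 h2]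
  · rw [kempe_of_notMem hL (hout x h1 h2), kempe_of_ne hK hτρ hτg]

/-- If the root misses two colors, then after exchanging one or the other of them a given vertex
of the fan still belongs to a fan. -/
theorem Fan.exists_exchanged_root [Fintype V] (h : ψ.Fan U) (hρ : ψ.mate ρ r = r) (hvU : v ∉ U)
    (hvr : v ≠ r) (hρv : ψ.mate ρ v = v) (hvs : ψ.mate τ v = s) {g₁ g₂ : Fin D}
    (h1 : ψ.mate g₁ s = s) (h2 : ψ.mate g₂ s = s) (hne : g₁ ≠ g₂) {w : V} (hw : w ∈ U) :
    ∃ (g : Fin D) (ψ' : G.NearColoring r s D) (T : Finset V), ψ.mate g s = s ∧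
      Exchanged ψ ψ' U ρ g τ v s ∧ ψ'.Fan T ∧ w ∈ T ∧
      ∀ u ∈ T, ∀ c, ψ'.mate c u = u → ψ'.mate c r ∈ T := by
  obtain ⟨ψ₁, e₁⟩ := h.exists_exchanged hrs hnc hρ hvU hvr hρv h.root_mem hvs h1
  obtain ⟨ψ₂, e₂⟩ := h.exists_exchanged hrs hnc hρ hvU hvr hρv h.root_mem hvs h2
  obtain ⟨T₁, hs₁, hT₁, hcl₁⟩ := (Fan.root (ψ := ψ₁)).exists_closed hrs hnc
  obtain ⟨T₂, hs₂, hT₂, hcl₂⟩ := (Fan.root (ψ := ψ₂)).exists_closed hrs hnc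
  have claim : ∀ S, ψ.Fan S → S ⊆ U → ∀ x ∈ S, x ∈ T₁ ∨ x ∈ T₂ := by
    intro S hS
    induction hS with
    | root =>
      intro _ x hx
      exact Or.inl (hs₁ hx)
    | @step S u x c _ hu hc hx hxS hxr ih =>
      intro hSU y hy
      have hSU' := (Finset.subset_insert x S).trans hSU
      rcases Finset.mem_insert.1 hy with rfl | hy
      · by_cases hus : u = s
        · subst hus
          by_cases hcg : c = g₁
          · right
            have := hcl₂ u hT₂.root_mem c (e₂.missing_of_ne c (hcg ▸ hne) hc)
            rwa [e₂.center, hx] at this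
          · left
            have := hcl₁ u hT₁.root_mem c (e₁.missing_of_ne c hcg hc)
            rwa [e₁.center, hx] at this
        · rcases ih hSU' u hu with h3 | h3
          · left
            have := hcl₁ u h3 c ((e₁.missing_iff u (hSU' hu) hus c).2 hc)
            rwa [e₁.center, hx] at this
          · right
            have := hcl₂ u h3 c ((e₂.missing_iff u (hSU' hu) hus c).2 hc)
            rwa [e₂.center, hx] at this
      · exact ih hSU' y hy
  rcases claim U h subset_rfl w hw with h3 | h3
  · exact ⟨g₁, ψ₁, T₁, h1, e₁, hT₁, h3, hcl₁⟩
  · exact ⟨g₂, ψ₂, T₂, h2, e₂, hT₂, h3, hcl₂⟩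

end exchange

variable [Fintype V] [DecidableRel G.Adj]

/-! ### Pivots -/

/-- `z` is a vertex outside the fan joined to the root by an edge of the safe color `σ`, which is
present at the center. -/
structure RootNbr (ψ : G.NearColoring r s D) (U : Finset V) (σ : Fin D) (z : V) : Prop where
  notMem : z ∉ U
  ne_center : z ≠ r
  edge : ψ.mate σ s = z
  safe : ψ.Safe U σ
  ne_rho : ψ.mate σ r ≠ r

/-- A neighbor `z` of `v` along color `τ`, of less than full degree, which lies in the fan or is
joined to the root as in `RootNbr`. -/
structure Pivot (ψ : G.NearColoring r s D) (U : Finset V) (v : V) (τ : Fin D) (z : V) : Prop where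
  low : G.degree z < D
  edge : ψ.mate τ v = z
  ne : z ≠ v
  kind : (∃ σ, ψ.RootNbr U σ z) ∨ z ∈ U ∧ z ≠ s

section core

variable {U : Finset V} (hC : Core G r s D U) {ψ ψ' : G.NearColoring r s D} {β γ ρ σ τ : Fin D}
  {v z : V} (hG : ψ.Good U β)
include hC hG

omit hC in
theorem Good.ne_root (hz : ψ.RootNbr U σ z) : z ≠ s := fun h => hz.notMem (h ▸ hG.root_mem)

omit hC in
theorem Good.rootNbr_color_ne (hz : ψ.RootNbr U σ z) {c : Fin D}
    (hc : ψ.mate c s = s ∨ ψ.mate c z = z) : σ ≠ c := by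
  rintro rfl
  rcases hc with hc | hc
  · exact hG.ne_root hz (hz.edge.symm.trans hc)
  · exact hG.ne_root hz (hc.symm.trans (ψ.mate_eq_comm.1 hz.edge))

/-- `Core.no_chain` for a vertex as in `RootNbr`. -/
theorem Core.rootNbr_no_chain (hz : ψ.RootNbr U σ z) {P : V → Prop} {n : ℕ} {y : V}
    (h : ψ.Chain U P n z y) (hy : ψ.Bad U y) : False :=
  hC.no_chain n hG hz.notMem hz.ne_center hz.edge hz.safe h hy

theorem Core.rootNbr_full (hz : ψ.RootNbr U σ z) (hγ : ψ.mate γ z = z) : ψ.Full U γ := by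
  by_contra h
  exact hC.rootNbr_no_chain hG hz (.nil (P := fun _ => True) z) ⟨hz.notMem, hz.ne_center, γ, hγ, h⟩

theorem Core.rootNbr_kempe_root (hz : ψ.RootNbr U σ z) (hτ : ψ.Full U τ) {K : Set V}
    (hK : ψ.KempeClosed β τ K) (hs : s ∉ K) : (ψ.kempe β τ K hK).RootNbr U σ z where
  notMem := hz.notMem
  ne_center := hz.ne_center
  edge := by rw [kempe_of_notMem hK hs, hz.edge]
  safe := hC.safe_kempe_root hG hτ hK hs hz.safe (hG.rootNbr_color_ne hz (Or.inl hG.root))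
  ne_rho := fun h => hz.ne_rho ((hC.kempe_root_center hG hτ hK).1 h)

theorem Core.rootNbr_mem_comp_center (hz : ψ.RootNbr U σ z) (hγ : ψ.mate γ z = z)
    (hρ : ψ.mate ρ r = r) : z ∈ ψ.comp ρ γ r := by
  by_contra h
  have hK := ψ.comp_closed ρ γ z
  have hrK : r ∉ ψ.comp ρ γ z := fun h' => h (mem_comp_symm h')
  refine hC.safe_ne_rho (ρ := ρ) (hC.good_kempe_center hG hρ hK hrK)
    ((kempe_of_notMem hK hrK).trans hρ) hz.notMem hz.ne_center (σ := σ) ?_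
    ((safe_kempe_center hK hrK).2 hz.safe) ?_
  · rw [kempe_of_ne hK _ (hG.rootNbr_color_ne hz (Or.inr hγ)), hz.edge]
    rintro rfl
    exact hz.ne_rho hρ
  · rw [kempe_left hK (ψ.mem_comp_self _ _ _), hγ]

theorem Core.rootNbr_mem_comp_root (hz : ψ.RootNbr U σ z) (hγ : ψ.mate γ z = z) :
    z ∈ ψ.comp β γ s := by
  by_contra h
  have hK := ψ.comp_closed β γ z
  have hsK : s ∉ ψ.comp β γ z := fun h' => h (mem_comp_symm h')
  have hγf := hC.rootNbr_full hG hz hγ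
  have hz' := hC.rootNbr_kempe_root hG hz hγf hK hsK
  refine hC.safe_ne_beta (hC.good_kempe_root hG hγf hK hsK) hz'.notMem hz'.ne_center hz'.edge
    hz'.safe ?_
  rw [kempe_left hK (ψ.mem_comp_self _ _ _), hγ]

/-- No other vertex outside the fan that misses `γ` lies in the component of the root. -/
theorem Core.notMem_comp_root (hz : ψ.RootNbr U σ z) (hγ : ψ.mate γ z = z) {y : V} (hyU : y ∉ U)
    (hyz : y ≠ z) (hy : ψ.mate β y = y ∨ ψ.mate γ y = y) : y ∉ ψ.comp β γ s := fun h =>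
  ψ.three_ends (Or.inl hG.root) hy (Or.inr hγ) (fun h => hyU (h ▸ hG.root_mem))
    (hG.ne_root hz).symm hyz h (hC.rootNbr_mem_comp_root hG hz hγ)

/-- If `v` misses the color of the center, then the edge from `v` to a pivot does not have the
color `β` missing at the root. Otherwise exchange it for a color missing at the pivot. -/
theorem Core.pivot_color_ne_root (hρ : ψ.mate ρ r = r) (hvU : v ∉ U) (hvr : v ≠ r)
    (hρv : ψ.mate ρ v = v) (hz : ψ.Pivot U v β z) : False := by
  obtain ⟨γ, hγ⟩ := hC.exists_missing ψ hz.low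
  have hzv := hz.edge
  have hsU := hG.root_mem
  rcases hz.kind with ⟨σ, h⟩ | ⟨h, hzs⟩
  · have hzr := h.ne_center
    have hK := ψ.comp_closed ρ γ v
    have hlink := hC.rootNbr_mem_comp_center hG h hγ hρ
    have hrK : r ∉ ψ.comp ρ γ v := fun h' => ψ.three_ends (Or.inl hρ) (Or.inr hγ) (Or.inl hρv)
      hzr.symm hvr.symm hz.ne hlink (mem_comp_symm h')
    have hzK : z ∉ ψ.comp ρ γ v := fun h' => by
      rw [← comp_eq h'] at hrK
      exact hrK (mem_comp_symm hlink)
    have hβρ : β ≠ ρ := by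
      rintro rfl
      exact hC.ne_center_of_missing hG hsU hG.root hρ
    have hβγ : β ≠ γ := by
      rintro rfl
      exact hz.ne (hγ.symm.trans (ψ.mate_eq_comm.1 hzv))
    have hG1 := hC.good_kempe_center hG hρ hK hrK
    have hL := pair_closed (ψ := ψ.kempe ρ γ _ hK) (a := β) (b := γ) (x := v) (y := z)
      (by rw [kempe_of_ne hK hβρ hβγ, hzv])
      (by rw [kempe_right hK (ψ.mem_comp_self _ _ _), hρv]) (by rw [kempe_of_notMem hK hzK, hγ])
    have hout : ∀ x, x ≠ v → x ≠ z → x ∉ ({v, z} : Set V) := by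
      rintro x h1 h2 (rfl | rfl)
      exacts [h1 rfl, h2 rfl]
    have hrL := hout r hvr.symm hzr.symm
    have hUL : ∀ u ∈ U, u ∉ ({v, z} : Set V) := fun u hu =>
      hout u (fun h => hvU (h ▸ hu)) fun h' => h.notMem (h' ▸ hu)
    refine hC.safe_ne_beta (hG1.kempe_outside hL hUL hrL) h.notMem h.ne_center (σ := σ) ?_ ?_ ?_
    · rw [kempe_of_notMem hL (hUL s hsU), kempe_of_ne hK _ (hG.rootNbr_color_ne h (Or.inr hγ)),
        h.edge]
      rintro rfl
      exact h.ne_rho hρ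
    · rw [Safe, kempe_of_notMem hL hrL]
      exact (safe_kempe_center hK hrK).2 h.safe
    · rw [kempe_left hL (by simp), kempe_of_notMem hK hzK, hγ]
  · obtain ⟨ψ', e⟩ := hG.fan.exists_exchanged hC.adj hC.not_colorable hρ hvU hvr hρv h hzv hγ
    obtain ⟨P, hP, hzP, hPU, hzr, u, hu, c, hc, hcr⟩ := hG.fan.exists_prefix h hzs
    have hF := (e.fan hP hPU hzP).step hu ((e.missing_iff u (hPU hu) (fun h => hzP (h ▸ hu)) c).2 hc)
      ((e.center c).trans hcr) hzP hzr
    exact hzs (hF.elementary hC.adj hC.not_colorable ((e.center ρ).trans hρ)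
      (Finset.mem_insert_self _ _) hF.root_mem e.missing_right
      ((e.missing_iff s hsU hzs.symm β).2 hG.root))

/-! ### Toggling a pivot outside the fan -/

/-- `ψ'` arises from `ψ` by freeing the color `γ`, missing at `z`, at the vertex `v` and then
recoloring the edge `vz` from `τ` to `γ`, all without affecting the root. -/
structure Toggled (ψ ψ' : G.NearColoring r s D) (U : Finset V) (β γ τ : Fin D) (v z : V) :
    Prop where
  good : ψ'.Good U β
  full : ∀ c, ψ'.Full U c ↔ ψ.Full U c
  rootNbr : ∀ σ x, ψ.RootNbr U σ x → ψ'.RootNbr U σ x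
  missing_left : ψ'.mate τ v = v
  missing_right : ψ'.mate τ z = z
  edge : ψ'.mate γ v = z
  of_ne : ∀ c, c ≠ β → c ≠ γ → c ≠ τ → ∀ x, ψ'.mate c x = ψ.mate c x
  missing : ∀ x, x ≠ v → x ≠ z → ψ.mate τ x = x → ψ'.mate τ x = x
  lowEdge : ∀ c, ψ.LowEdge U c → ψ'.LowEdge U c
  lowEdge_mate : ∀ c, ψ.LowEdge U c → ψ'.mate c r = ψ.mate c r
  arc : ∀ a a', a ≠ v → a ≠ z → ψ.Arc U a a' → ψ'.Arc U a a' ∨ ψ'.Bad U a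
  bad : ∀ y, y ≠ v → y ≠ z → ψ.Bad U y → ψ'.Bad U y ∨ ψ'.mate γ y = y

theorem Core.exists_toggled (hvU : v ∉ U) (hvr : v ≠ r) (hβv : ψ.mate β v = v)
    (hz : ψ.RootNbr U σ z) (hvz : ψ.mate τ v = z) (hzv : z ≠ v) (hγ : ψ.mate γ z = z) :
    ∃ ψ', Toggled ψ ψ' U β γ τ v z := by
  have hγf := hC.rootNbr_full hG hz hγ
  have hK := ψ.comp_closed β γ v
  have hzs := hC.rootNbr_mem_comp_root hG hz hγ
  have hsK : s ∉ ψ.comp β γ v := fun h =>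
    hC.notMem_comp_root hG hz hγ hvU hzv.symm (Or.inl hβv) (mem_comp_symm h)
  have hzK : z ∉ ψ.comp β γ v := fun h => by
    rw [← comp_eq h] at hsK
    exact hsK (mem_comp_symm hzs)
  have hτβ : τ ≠ β := by
    rintro rfl
    exact hzv (hvz.symm.trans hβv)
  have hτγ : τ ≠ γ := by
    rintro rfl
    exact hzv (hγ.symm.trans (ψ.mate_eq_comm.1 hvz))
  have hG1 := hC.good_kempe_root hG hγf hK hsK
  have hfull1 := fun c => hC.full_kempe_root hG hγf hK hsK (d := c)
  set ψ₁ := ψ.kempe β γ _ hK with hψ₁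
  have e1 : ψ₁.mate τ v = z := by rw [hψ₁, kempe_of_ne hK hτβ hτγ, hvz]
  have e2 : ψ₁.mate γ v = v := by rw [hψ₁, kempe_right hK (ψ.mem_comp_self _ _ _), hβv]
  have e3 : ψ₁.mate γ z = z := by rw [hψ₁, kempe_of_notMem hK hzK, hγ]
  have hL := pair_closed e1 e2 e3
  have hout : ∀ x, x ≠ v → x ≠ z → x ∉ ({v, z} : Set V) := by
    rintro x h1 h2 (rfl | rfl)
    exacts [h1 rfl, h2 rfl]
  have hrL := hout r hvr.symm hz.ne_center.symm
  have hUL : ∀ u ∈ U, u ∉ ({v, z} : Set V) := fun u hu =>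
    hout u (fun h => hvU (h ▸ hu)) fun h' => hz.notMem (h' ▸ hu)
  have hG2 := hG1.kempe_outside hL hUL hrL
  have hfull2 : ∀ c, (ψ₁.kempe τ γ _ hL).Full U c ↔ ψ.Full U c := fun c =>
    (full_kempe_outside hL hUL hrL).trans (hfull1 c)
  have hlow1 : ∀ c, ψ.LowEdge U c → ψ₁.LowEdge U c := fun c =>
    hC.lowEdge_kempe_root hG hγf hK hsK
  have hr2 : ∀ c, (ψ₁.kempe τ γ _ hL).mate c r = ψ₁.mate c r := fun c => kempe_of_notMem hL hrL
  have hbad2 : ∀ y, y ≠ v → y ≠ z → ψ₁.Bad U y → (ψ₁.kempe τ γ _ hL).Bad U y := by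
    rintro y h1 h2 ⟨h3, h4, c, h5, h6⟩
    refine ⟨h3, h4, c, by rw [kempe_of_notMem hL (hout y h1 h2), h5], ?_⟩
    rwa [full_kempe_outside hL hUL hrL]
  refine ⟨ψ₁.kempe τ γ _ hL, hG2, hfull2, fun σ x hx => ?_, ?_, ?_, ?_, fun c h1 h2 h3 x => ?_,
    fun x h1 h2 h3 => ?_, fun c hc => ?_, fun c hc => ?_, fun a a' h1 h2 hA => ?_,
    fun y h1 h2 hy => ?_⟩
  · have h1 := hC.rootNbr_kempe_root hG hx hγf hK hsK
    refine ⟨h1.notMem, h1.ne_center, ?_, ?_, ?_⟩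
    · rw [kempe_of_notMem hL (hUL s hG.root_mem)]
      exact h1.edge
    · rw [Safe, hr2]
      exact h1.safe
    · rw [hr2]
      exact h1.ne_rho
  · rw [kempe_left hL (by simp), e2]
  · rw [kempe_left hL (by simp), e3]
  · rw [kempe_right hL (by simp), e1]
  · rw [kempe_of_ne hL h3 h2, hψ₁, kempe_of_ne hK h1 h2]
  · rw [kempe_of_notMem hL (hout x h1 h2), hψ₁, kempe_of_ne hK hτβ hτγ, h3]
  · rw [LowEdge, hr2]
    exact hlow1 c hc
  · rw [hr2]
    exact hC.kempe_root_lowEdge_mate hG hγf hK hsK hc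
  · rcases hC.arc_kempe_root hG hγf hK hsK hA with ⟨c, h3, h4, h5⟩ | h3
    · refine Or.inl ⟨c, ?_, ?_, ?_⟩
      · rw [kempe_of_notMem hL (hout a h1 h2)]
        exact h3
      · rw [hr2]
        exact h4
      · rw [LowEdge, hr2]
        exact h5
    · exact Or.inr (hbad2 a h1 h2 h3)
  · obtain ⟨h3, h4, c, h5, h6⟩ := hy
    by_cases hc : c = β ∧ y ∈ ψ.comp β γ v
    · right
      rw [kempe_of_notMem hL (hout y h1 h2), hψ₁, kempe_right hK hc.2, ← hc.1, h5]
    · refine Or.inl (hbad2 y h1 h2 ⟨h3, h4, c, ?_, by rwa [hfull1]⟩)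
      by_cases hyK : y ∈ ψ.comp β γ v
      · rw [hψ₁, kempe_of_ne hK (fun h => hc ⟨h, hyK⟩), h5]
        rintro rfl
        exact h6 hγf
      · rw [hψ₁, kempe_of_notMem hK hyK, h5]

/-! ### Switching between the colors of the center and of the root -/

/-- `ψ'` arises from `ψ` by a Kempe change with the color missing at the center and the color `β`
missing at the root, away from both. -/
structure Switched (ψ ψ' : G.NearColoring r s D) (U : Finset V) (β : Fin D) : Prop where
  good : ψ'.Good U β
  center : ∀ c, ψ'.mate c r = ψ.mate c r
  root : ∀ c, ψ'.mate c s = ψ.mate c s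
  full : ∀ c, ψ'.Full U c ↔ ψ.Full U c
  of_ne : ∀ c, ψ.mate c r ≠ r → c ≠ β → ∀ x, ψ'.mate c x = ψ.mate c x
  bad : ∀ y, ψ.Bad U y → ψ'.Bad U y
  arc : ∀ a a', ψ.Arc U a a' → ψ'.Arc U a a'

omit hC in
theorem Switched.rootNbr (h : Switched ψ ψ' U β) {x : V} (hx : ψ.RootNbr U σ x) :
    ψ'.RootNbr U σ x where
  notMem := hx.notMem
  ne_center := hx.ne_center
  edge := (h.root σ).trans hx.edge
  safe := by
    rw [Safe, h.center]
    exact hx.safe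
  ne_rho := by
    rw [h.center]
    exact hx.ne_rho

omit hC in
theorem Switched.pivot (h : Switched ψ ψ' U β) (hz : ψ.Pivot U v τ z) (hτ : ψ.mate τ r ≠ r)
    (hτβ : τ ≠ β) : ψ'.Pivot U v τ z where
  low := hz.low
  edge := (h.of_ne τ hτ hτβ v).trans hz.edge
  ne := hz.ne
  kind := hz.kind.imp (fun ⟨σ, hσ⟩ => ⟨σ, h.rootNbr hG hσ⟩) id

omit hG hC in
theorem Switched.lowEdge (h : Switched ψ ψ' U β) (hτ : ψ.LowEdge U τ) : ψ'.LowEdge U τ := by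
  rwa [LowEdge, h.center]

theorem Core.exists_switched (hρ : ψ.mate ρ r = r) (hvU : v ∉ U) (hvr : v ≠ r)
    (hv : ψ.mate ρ v = v ∨ ψ.mate β v = v) :
    ∃ ψ', Switched ψ ψ' U β ∧ ψ'.mate ρ v = ψ.mate β v ∧ ψ'.mate β v = ψ.mate ρ v := by
  have hsU := hG.root_mem
  have hK := ψ.comp_closed ρ β v
  have hlink := hC.mem_comp_center hG hρ hsU hG.root
  have hrK : r ∉ ψ.comp ρ β v := fun h' => ψ.three_ends (Or.inl hρ) (Or.inr hG.root) hv
    hC.adj.ne hvr.symm (fun h => hvU (h ▸ hsU)) hlink (mem_comp_symm h')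
  have hsK : s ∉ ψ.comp ρ β v := fun h => by
    rw [← comp_eq h] at hrK
    exact hrK (mem_comp_symm hlink)
  refine ⟨ψ.kempe ρ β _ hK, ⟨hC.good_kempe_center hG hρ hK hrK, fun c => kempe_of_notMem hK hrK,
    fun c => kempe_of_notMem hK hsK, fun c => hC.full_kempe_center hG hρ hK hrK,
    fun c h1 h2 x => kempe_of_ne hK ?_ h2,
    fun y => hC.bad_kempe_center hG hρ hK hrK hG.not_full,
    fun a a' => hC.arc_kempe_center hG hρ hK hrK hG.not_full⟩,
    kempe_left hK (ψ.mem_comp_self _ _ _), kempe_right hK (ψ.mem_comp_self _ _ _)⟩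
  rintro rfl
  exact h1 hρ

/-- `v` misses the color of the center or the color `β` of the root. -/
def Loose (ψ : G.NearColoring r s D) (β : Fin D) (v : V) : Prop :=
  (∃ ρ, ψ.mate ρ r = r ∧ ψ.mate ρ v = v) ∨ ψ.mate β v = v

omit hC hG in
theorem Switched.refl (hG : ψ.Good U β) : Switched ψ ψ U β :=
  ⟨hG, fun _ => rfl, fun _ => rfl, fun _ => Iff.rfl, fun _ _ _ _ => rfl, fun _ => id,
    fun _ _ => id⟩

theorem Core.exists_switched_root (hvU : v ∉ U) (hvr : v ≠ r) (hv : ψ.Loose β v) :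
    ∃ ψ', Switched ψ ψ' U β ∧ ψ'.mate β v = v := by
  rcases hv with ⟨ρ, hρ, hv⟩ | hv
  · obtain ⟨ψ', h1, h2, h3⟩ := hC.exists_switched hG hρ hvU hvr (Or.inl hv)
    exact ⟨ψ', h1, h3.trans hv⟩
  · exact ⟨ψ, .refl hG, hv⟩

theorem Core.exists_switched_center (hvU : v ∉ U) (hvr : v ≠ r) (hv : ψ.Loose β v) :
    ∃ ψ', Switched ψ ψ' U β ∧ ∃ ρ, ψ'.mate ρ r = r ∧ ψ'.mate ρ v = v := by
  rcases hv with ⟨ρ, hρ, hv⟩ | hv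
  · exact ⟨ψ, .refl hG, ρ, hρ, hv⟩
  · obtain ⟨ρ, hρ⟩ := hC.exists_missing_center ψ
    obtain ⟨ψ', h1, h2, h3⟩ := hC.exists_switched hG hρ hvU hvr (Or.inr hv)
    exact ⟨ψ', h1, ρ, (h1.center ρ).trans hρ, h2.trans hv⟩

end core

end

/-! ### Colors of the edges from `v` to pivots -/

section

variable {V : Type*} [Fintype V] {G : SimpleGraph V} [DecidableRel G.Adj] {r s : V} {D : ℕ}
  {U : Finset V} (hC : Core G r s D U) {ψ ψ' : G.NearColoring r s D} {β γ ρ σ τ : Fin D}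
  {v z : V} (hG : ψ.Good U β)
include hC hG

/-- A pivot in the fan can be made the root. If the color of `vz` were missing in the fan, then
exchanging it for a color missing at `z` would give a fan missing it twice. -/
theorem Core.pivot_full_of_mem (hρ : ψ.mate ρ r = r) (hvU : v ∉ U) (hvr : v ≠ r)
    (hρv : ψ.mate ρ v = v) (hz : ψ.Pivot U v τ z) (hzU : z ∈ U) : ψ.Full U τ := by
  by_contra hcon
  have hrz := hG.fan.adj hC.adj z hzU
  have hrU := hC.center_notMem hG
  obtain ⟨ψr, hF, hout, hfull, hin⟩ := hG.fan.reroot hC.adj z hzU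
  have hρ' : ψr.mate ρ r = r := by rw [hfull ρ (by rwa [hρ]), hρ]
  have hvz' : ψr.mate τ v = z := by rw [hout v hvU hvr, hz.edge]
  obtain ⟨u, hu, hτu⟩ : ∃ u ∈ U, ψr.mate τ u = u := by
    by_cases h1 : ψ.mate τ r ∈ U
    · exact hF.exists_missing (hin τ h1)
    rcases not_full_iff.1 hcon with h2 | ⟨u, hu, hτu⟩
    · obtain rfl := hC.missing_center_unique ψ h2 hρ
      exact absurd (hz.edge.symm.trans hρv) hz.ne
    · exact ⟨u, hu, by rw [hfull τ h1, hτu]⟩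
  have hcard := ψr.card_missing_root hrz
  have hlow := hz.low
  obtain ⟨g₁, h1, g₂, h2, hne⟩ := Finset.one_lt_card.1
    (show 1 < (ψr.missing z).card by omega)
  obtain ⟨g, ψ', T, hg, e, hT, huT, -⟩ := hF.exists_exchanged_root hrz hC.not_colorable hρ' hvU hvr
    (by rw [hout v hvU hvr, hρv]) hvz' (mem_missing.1 h1) (mem_missing.1 h2) hne hu
  have huz : u ≠ z := by
    rintro rfl
    exact hz.ne (hτu.symm.trans (ψr.mate_eq_comm.1 hvz'))
  exact huz (hT.elementary hrz hC.not_colorable ((e.center ρ).trans hρ') huT hT.root_mem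
    ((e.missing_iff u hu huz τ).2 hτu) e.missing_right)

/-- The edge from a loose vertex `v` to a pivot has a color present at all vertices of the fan. -/
theorem Core.pivot_full (hvU : v ∉ U) (hvr : v ≠ r) (hv : ψ.Loose β v) (hz : ψ.Pivot U v τ z) :
    ψ.Full U τ := by
  obtain ⟨ρ, hρ⟩ := hC.exists_missing_center ψ
  have hne : ∀ {c : Fin D}, ψ.mate c v = v → τ ≠ c := by
    rintro c hc rfl
    exact hz.ne (hz.edge.symm.trans hc)
  have hv' : ψ.mate ρ v = v ∨ ψ.mate β v = v := by
    rcases hv with ⟨ρ', h1, h2⟩ | h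
    · rw [hC.missing_center_unique ψ hρ h1]
      exact Or.inl h2
    · exact Or.inr h
  obtain ⟨ψ', hS, h1, h2⟩ := hC.exists_switched hG hρ hvU hvr hv'
  have hρ' : ψ'.mate ρ r = r := (hS.center ρ).trans hρ
  -- in both situations the edge has neither of the two colors switched
  have hτ : τ ≠ ρ ∧ τ ≠ β := by
    rcases hv' with h | h
    · refine ⟨hne h, ?_⟩
      rintro rfl
      exact hC.pivot_color_ne_root hG hρ hvU hvr h hz
    · refine ⟨?_, hne h⟩
      rintro rfl
      exact hC.pivot_color_ne_root hS.good hρ' hvU hvr (h1.trans h) ⟨hz.low, h2.trans hz.edge, hz.ne,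
        hz.kind.imp (fun ⟨σ, hσ⟩ => ⟨σ, hS.rootNbr hG hσ⟩) id⟩
  have hτr : ψ.mate τ r ≠ r := fun h => hτ.1 (hC.missing_center_unique ψ h hρ)
  have hz' := hS.pivot hG hz hτr hτ.2
  have outer : ∀ {ψ : G.NearColoring r s D}, ψ.Good U β → ψ.mate β v = v → ψ.Pivot U v τ z →
      (∃ σ, ψ.RootNbr U σ z) → ψ.Full U τ := by
    rintro ψ hG hβv hz ⟨σ, hσ⟩
    obtain ⟨γ, hγ⟩ := hC.exists_missing ψ hz.low
    obtain ⟨ψ', hT⟩ := hC.exists_toggled hG hvU hvr hβv hσ hz.edge hz.ne hγ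
    exact (hT.full τ).1 (hC.rootNbr_full hT.good (hT.rootNbr σ z hσ) hT.missing_right)
  rcases hv' with h | h
  · rcases hz'.kind with h3 | h3
    · exact (hS.full τ).1 (outer hS.good (h2.trans h) hz' h3)
    · exact hC.pivot_full_of_mem hG hρ hvU hvr h hz h3.1
  · rcases hz.kind with h3 | h3
    · exact outer hG h hz h3
    · exact (hS.full τ).1 (hC.pivot_full_of_mem hS.good hρ' hvU hvr (h1.trans h) hz' h3.1)

/-- The case of `Core.no_chain_to_missing` in which `v` misses the color `β` of the root. -/
theorem Core.no_chain_to_missing_aux (hvU : v ∉ U) (hvr : v ≠ r) (hβv : ψ.mate β v = v)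
    (hz : ψ.Pivot U v τ z) {z' q : V} (hz' : ψ.RootNbr U σ z') {P : V → Prop} {n : ℕ}
    (hch : ψ.Chain U P n z' q) (hq : ψ.mate τ q = q) : False := by
  have hτ := hC.pivot_full hG hvU hvr (Or.inr hβv) hz
  obtain ⟨ρ, hρ⟩ := hC.exists_missing_center ψ
  have hsU := hG.root_mem
  obtain ⟨m, q, hq, hch⟩ := hch.exists_first (Q := fun x => ψ.mate τ x = x) hq
  have hqU := hτ.notMem hq
  have hqr := hτ.ne_center hq
  have hqv : q ≠ v := by
    rintro rfl
    exact hz.ne (hz.edge.symm.trans hq)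
  have hqs : q ≠ s := fun h => hqU (h ▸ hsU)
  have hvs : v ≠ s := fun h => hvU (h ▸ hsU)
  have hτβ : τ ≠ β := by
    rintro rfl
    exact hG.not_full hτ
  have hτρ : τ ≠ ρ := by
    rintro rfl
    exact hτ.1 hρ
  have hβρ : β ≠ ρ := by
    rintro rfl
    exact hC.ne_center_of_missing hG hsU hG.root hρ
  have hσβ := hG.rootNbr_color_ne hz' (Or.inl hG.root)
  by_cases hqC : q ∈ ψ.comp β τ s
  swap
  · have hK := ψ.comp_closed β τ q
    have hsK : s ∉ ψ.comp β τ q := fun h => hqC (mem_comp_symm h)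
    have hG' := hC.good_kempe_root hG hτ hK hsK
    have hz'' := hC.rootNbr_kempe_root hG hz' hτ hK hsK
    rcases hch.persist fun a a' _ hA => hC.arc_kempe_root hG hτ hK hsK hA with h | ⟨m, y, h, hy⟩
    · refine hC.rootNbr_no_chain hG' hz'' h ⟨hqU, hqr, β, ?_, hG'.not_full⟩
      rw [kempe_left hK (ψ.mem_comp_self _ _ _), hq]
    · exact hC.rootNbr_no_chain hG' hz'' h hy
  -- exchange the colors on the component of the root, which contains `q` but not `v`
  have hK := ψ.comp_closed β τ s
  have hsK := ψ.mem_comp_self β τ s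
  have hvK : v ∉ ψ.comp β τ s := fun h => ψ.three_ends (Or.inl hG.root) (Or.inr hq) (Or.inl hβv)
    hqs.symm hvs.symm hqv hqC h
  set ψ₁ := ψ.kempe β τ _ hK with hψ₁
  have hG1 : ψ₁.Good U τ := ⟨hC.fan_kempe_root hG hτ hK, (kempe_right hK hsK).trans hG.root,
    hC.kempe_root_leaf hG hτ hK (Or.inr rfl)⟩
  have hne1 : ∀ {c}, c ≠ β → c ≠ τ → ∀ x, ψ₁.mate c x = ψ.mate c x := fun h1 h2 x =>
    kempe_of_ne hK h1 h2
  have hρ1 : ψ₁.mate ρ r = r := (hne1 hβρ.symm hτρ.symm r).trans hρ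
  have hq1 : ψ₁.mate β q = q := (kempe_left hK hqC).trans hq
  have hv1 : ψ₁.mate β v = v := (kempe_of_notMem hK hvK).trans hβv
  obtain ⟨σ₁, hz1⟩ : ∃ σ₁, ψ₁.RootNbr U σ₁ z' := by
    by_cases hστ : σ = τ
    · subst hστ
      have hlow := hz'.safe.lowEdge hG.fan hτ
      have hrK : r ∈ ψ.comp β σ s := by
        by_contra hrK
        have e : ψ₁.mate σ r = ψ.mate σ r := kempe_of_notMem hK hrK
        exact hC.degree_leaf hG1 hsU hG1.root hG1.leaf (by rw [e]; exact hlow.2)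
      have e : ψ₁.mate β r = ψ.mate σ r := kempe_left hK hrK
      exact ⟨β, hz'.notMem, hz'.ne_center, (kempe_left hK hsK).trans hz'.edge,
        Or.inr (Or.inr (by rw [e]; exact hlow.2)), by rw [e]; exact hτ.1⟩
    · have e := hne1 hσβ hστ
      exact ⟨σ, hz'.notMem, hz'.ne_center, (e s).trans hz'.edge, by rw [Safe, e]; exact hz'.safe,
        by rw [e]; exact hz'.ne_rho⟩
  have hmove : ∀ (K : Set V) (hK' : ψ₁.KempeClosed ρ β K),
      (ψ₁.kempe ρ β K hK').Chain U (fun _ => True) m z' q := fun K hK' => by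
    refine (hch.map fun a a' ha hA => ?_).mono fun _ _ => trivial
    obtain ⟨c, h1, h2, h3⟩ := hA
    have hfull := hC.full_of_lowEdge hG h3
    have hcβ : c ≠ β := by
      rintro rfl
      exact hG.not_full hfull
    have e : ∀ x, (ψ₁.kempe ρ β K hK').mate c x = ψ.mate c x := fun x => by
      rw [kempe_of_ne hK' _ hcβ, hne1 hcβ]
      · rintro rfl
        exact ha.2 h1
      · rintro rfl
        exact hfull.1 hρ
    exact ⟨c, (e a).trans h1, (e r).trans h2, by rw [LowEdge, e]; exact h3⟩
  by_cases hqr' : q ∈ ψ₁.comp ρ β r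
  swap
  · have hL := ψ₁.comp_closed ρ β q
    have hrL : r ∉ ψ₁.comp ρ β q := fun h => hqr' (mem_comp_symm h)
    have hG2 := hC.good_kempe_center hG1 hρ1 hL hrL
    have fin : ∀ σ₂, (ψ₁.kempe ρ β _ hL).mate σ₂ s = z' → ψ₁.Safe U σ₂ → False :=
      fun σ₂ h1 h2 => hC.no_chain m hG2 hz'.notMem hz'.ne_center h1
        ((safe_kempe_center hL hrL).2 h2) (hmove _ hL) ⟨hqU, hqr, ρ,
          (kempe_left hL (ψ₁.mem_comp_self _ _ _)).trans hq1,
          fun h => h.1 ((kempe_of_notMem hL hrL).trans hρ1)⟩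
    have hσρ : σ₁ ≠ ρ := by
      rintro rfl
      exact hz1.ne_rho hρ1
    by_cases hsL : s ∈ ψ₁.comp ρ β q
    · by_cases hσ : σ₁ = β
      · exact fin ρ ((kempe_left hL hsL).trans (hσ ▸ hz1.edge)) (Or.inl hρ1)
      · exact fin σ₁ ((kempe_of_ne hL hσρ hσ).trans hz1.edge) hz1.safe
    · exact fin σ₁ ((kempe_of_notMem hL hsL).trans hz1.edge) hz1.safe
  -- now `v` can be moved to the color of the center, while `vz` has the color of the root
  have hL := ψ₁.comp_closed ρ β v
  have hrL : r ∉ ψ₁.comp ρ β v := fun h => ψ₁.three_ends (Or.inl hρ1) (Or.inr hq1) (Or.inr hv1)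
    hqr.symm hvr.symm hqv hqr' (mem_comp_symm h)
  refine hC.pivot_color_ne_root (ρ := ρ) (v := v) (z := z) (hC.good_kempe_center hG1 hρ1 hL hrL)
    ((kempe_of_notMem hL hrL).trans hρ1) hvU hvr
    ((kempe_left hL (ψ₁.mem_comp_self _ _ _)).trans hv1)
    ⟨hz.low, ?_, hz.ne, hz.kind.imp (fun ⟨σ, hσ⟩ => ⟨σ, ?_⟩) id⟩
  · rw [kempe_of_ne hL hτρ hτβ, hψ₁, kempe_of_notMem hK hvK, hz.edge]
  · have h1 : σ ≠ β := hG.rootNbr_color_ne hσ (Or.inl hG.root)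
    have h2 : σ ≠ τ := by
      rintro rfl
      exact hvs (ψ.mate_inj (hz.edge.trans hσ.edge.symm))
    have h3 : σ ≠ ρ := by
      rintro rfl
      exact hσ.ne_rho hρ
    have e : ∀ x, (ψ₁.kempe ρ β _ hL).mate σ x = ψ.mate σ x := fun x => by
      rw [kempe_of_ne hL h3 h1, hne1 h1 h2]
    exact ⟨hσ.notMem, hσ.ne_center, (e s).trans hσ.edge, by rw [Safe, e]; exact hσ.safe,
      by rw [e]; exact hσ.ne_rho⟩

/-- No chain leads from a neighbor of the root to a vertex missing the color of the edge between
`v` and a pivot. -/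
theorem Core.no_chain_to_missing (hvU : v ∉ U) (hvr : v ≠ r) (hv : ψ.Loose β v)
    (hz : ψ.Pivot U v τ z) {z' q : V} (hz' : ψ.RootNbr U σ z') {P : V → Prop} {n : ℕ}
    (hch : ψ.Chain U P n z' q) (hq : ψ.mate τ q = q) : False := by
  have hτ := hC.pivot_full hG hvU hvr hv hz
  have hτβ : τ ≠ β := by
    rintro rfl
    exact hG.not_full hτ
  obtain ⟨ψ', hS, hv'⟩ := hC.exists_switched_root hG hvU hvr hv
  exact hC.no_chain_to_missing_aux hS.good hvU hvr hv' (hS.pivot hG hz hτ.1 hτβ)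
    (hS.rootNbr hG hz') (hch.map fun a a' _ hA => hS.arc a a' hA)
    ((hS.of_ne τ hτ.1 hτβ q).trans hq)

omit hC in
theorem Good.ne_of_full (hτ : ψ.Full U τ) : τ ≠ β := by
  rintro rfl
  exact hG.not_full hτ

/-! ### No bad vertex is reachable from a pivot -/

/-- A chain with arcs at the tails that survive toggling continues the new arc from `z`. -/
theorem Core.chain_of_toggled (hT : Toggled ψ ψ' U β γ τ v z) (hlow : ψ.LowEdge U τ)
    (hz : ψ.RootNbr U σ z) {P : V → Prop} {n : ℕ} {y : V}
    (hch : ψ.Chain U P n (ψ.mate τ r) y) (hP : ∀ x, P x → x ≠ v ∧ x ≠ z) :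
    ψ'.Chain U (fun _ => True) (n + 1) z y := by
  have hA : ψ'.Arc U z (ψ.mate τ r) :=
    ⟨τ, hT.missing_right, hT.lowEdge_mate τ hlow, hT.lowEdge τ hlow⟩
  have hz' := hT.rootNbr σ z hz
  rcases hch.persist fun a a' ha hA => hT.arc a a' (hP a ha).1 (hP a ha).2 hA with
    h | ⟨m, y, h, hy⟩
  · exact .cons trivial hA (h.mono fun _ _ => trivial)
  · exact (hC.rootNbr_no_chain hT.good hz'
      (.cons trivial hA (h.mono fun _ _ => trivial)) hy).elim

/-- For a pivot outside the fan, toggling makes it miss `τ`, and a chain from the color `τ` then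
becomes a chain from a neighbor of the root. -/
theorem Core.pivot_no_chain_of_rootNbr (hvU : v ∉ U) (hvr : v ≠ r) (hβv : ψ.mate β v = v)
    (hz : ψ.Pivot U v τ z) (hσ : ψ.RootNbr U σ z) (hlow : ψ.LowEdge U τ) {P : V → Prop} {n : ℕ}
    {y : V} (hch : ψ.Chain U P n (ψ.mate τ r) y) (hy : ψ.Bad U y) : False := by
  obtain ⟨m, y, hy, hch⟩ := hch.exists_first hy
  obtain ⟨γ, hγ⟩ := hC.exists_missing ψ hz.low
  have hvbad : ψ.Bad U v := ⟨hvU, hvr, β, hβv, hG.not_full⟩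
  have hyz : y ≠ z := by
    rintro rfl
    exact hC.rootNbr_no_chain hG hσ (.nil (P := fun _ => True) _) hy
  rcases hch.avoid_or_suffix (· = z) with hch | ⟨m, _, rfl, hch⟩
  swap
  · exact hC.rootNbr_no_chain hG hσ hch hy
  obtain ⟨ψ', hT⟩ := hC.exists_toggled hG hvU hvr hβv hσ hz.edge hz.ne hγ
  have hσ' := hT.rootNbr σ z hσ
  have hch' := hC.chain_of_toggled hG hT hlow hσ hch
    fun x hx => ⟨fun h => hx.1.2 (h ▸ hvbad), hx.2⟩
  -- free the color `β` at `v` again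
  have hτ := hC.rootNbr_full hT.good hσ' hT.missing_right
  have hK := (ψ'.comp_closed β τ s).compl
  have hsK : s ∉ (ψ'.comp β τ s)ᶜ := fun h => h (ψ'.mem_comp_self _ _ _)
  have hvK : v ∈ (ψ'.comp β τ s)ᶜ := hC.notMem_comp_root hT.good hσ' hT.missing_right hvU
    hz.ne.symm (Or.inr hT.missing_left)
  have hG' := hC.good_kempe_root hT.good hτ hK hsK
  have hσ'' := hC.rootNbr_kempe_root hT.good hσ' hτ hK hsK
  have hv' : (ψ'.kempe β τ _ hK).mate β v = v := (kempe_left hK hvK).trans hT.missing_left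
  have hch'' : (ψ'.kempe β τ _ hK).Chain U (fun _ => True) (m + 1) z y := by
    rcases hch'.persist fun a a' _ hA => hC.arc_kempe_root hT.good hτ hK hsK hA with
      h | ⟨m, y, h, hy⟩
    · exact h
    · exact (hC.rootNbr_no_chain hG' hσ'' h hy).elim
  by_cases hyv : y = v
  · subst hyv
    exact hC.rootNbr_no_chain hG' hσ'' hch'' ⟨hvU, hvr, β, hv', hG'.not_full⟩
  rcases hT.bad y hyv hyz hy with h | h
  · exact hC.rootNbr_no_chain hT.good hσ' hch' h
  · have hγβ : γ ≠ β := by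
      rintro rfl
      exact hG.not_full (hC.rootNbr_full hG hσ hγ)
    have hγτ : γ ≠ τ := by
      rintro rfl
      exact hz.ne (hγ.symm.trans (ψ.mate_eq_comm.1 hz.edge))
    have e : ∀ x, (ψ'.kempe β τ _ hK).mate γ x = ψ'.mate γ x := fun x => kempe_of_ne hK hγβ hγτ
    exact hC.no_chain_to_missing hG' hvU hvr (Or.inr hv')
      ⟨hz.low, (e v).trans hT.edge, hz.ne, Or.inl ⟨σ, hσ''⟩⟩ hσ'' hch'' ((e y).trans h)

/-- For a pivot in the fan, recoloring `vz` makes the pivot miss `τ`, and a chain from the color `τ`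
then becomes a part of a fan, which is too large or misses some color twice. -/
theorem Core.pivot_no_chain_of_mem (hρ : ψ.mate ρ r = r) (hvU : v ∉ U) (hvr : v ≠ r)
    (hρv : ψ.mate ρ v = v) (hz : ψ.Pivot U v τ z) (hzU : z ∈ U) (hzs : z ≠ s)
    (hlow : ψ.LowEdge U τ) {P : V → Prop} {n : ℕ} {y : V}
    (hch : ψ.Chain U P n (ψ.mate τ r) y) (hy : ψ.Bad U y) : False := by
  obtain ⟨m, y, hy, hch⟩ := hch.exists_first hy
  obtain ⟨γ, hγ⟩ := hC.exists_missing ψ hz.low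
  have hvbad : ψ.Bad U v := ⟨hvU, hvr, ρ, hρv, fun h => h.1 hρ⟩
  have hτ := hC.full_of_lowEdge hG hlow
  have hzr : z ≠ r := fun h => hC.center_notMem hG (h ▸ hzU)
  have hγf : ¬ ψ.Full U γ := fun h => h.2 z hzU hγ
  have hout : ∀ x, x ≠ v → x ≠ z → x ∉ ({v, z} : Set V) := by
    rintro x h1 h2 (rfl | rfl)
    exacts [h1 rfl, h2 rfl]
  -- the contradiction once `v` and `z` both miss `γ`
  have fin : ∀ {ψ : G.NearColoring r s D}, ψ.Good U β → ψ.mate ρ r = r → ψ.mate γ v = v →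
      ψ.mate γ z = z → ψ.mate τ v = z → ψ.Full U τ →
      ψ.Chain U (fun x => x ≠ v) m (ψ.mate τ r) y → y ∉ U → y ≠ r →
      (y = v ∨ ψ.mate ρ y = y ∨ ψ.mate γ y = y) → False := by
    intro ψ hG hρ hγv hγz hvz hτ hch hyU hyr hyc
    have hL := pair_closed hvz hγv hγz
    have hrL := hout r hvr.symm hzr.symm
    set ψ₂ := ψ.kempe τ γ _ hL with hψ₂
    have hr2 : ∀ c, ψ₂.mate c r = ψ.mate c r := fun c => kempe_of_notMem hL hrL
    have hx2 : ∀ x, x ≠ v → x ≠ z → ∀ c, ψ₂.mate c x = ψ.mate c x := fun x h1 h2 c =>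
      kempe_of_notMem hL (hout x h1 h2)
    have hzτ : ψ₂.mate τ z = z := (kempe_left hL (by simp)).trans hγz
    have hvτ : ψ₂.mate τ v = v := (kempe_left hL (by simp)).trans hγv
    have hu2 : ∀ u ∈ U, u ≠ z → ∀ c, ψ₂.mate c u = ψ.mate c u := fun u hu huz c =>
      hx2 u (fun h => hvU (h ▸ hu)) huz c
    obtain ⟨Q, hQ, hzQ, hQU, -, u, hu, c, hc, hcr⟩ := hG.fan.exists_prefix hzU hzs
    have hQz : ∀ x ∈ Q, x ≠ z := fun x hx h => hzQ (h ▸ hx)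
    have hQ2 : ψ₂.Fan Q := hQ.transfer
      (fun x hx d hd _ => (hu2 x (hQU hx) (hQz x hx) d).trans hd) fun d _ => hr2 d
    obtain ⟨T, hQT, hT, hcl⟩ := (hQ2.step hu ((hu2 u (hQU hu) (hQz u hu) c).trans hc)
      ((hr2 c).trans hcr) hzQ hzr).exists_closed hC.adj hC.not_colorable
    have hzT : z ∈ T := hQT (Finset.mem_insert_self _ _)
    have haT : ψ.mate τ r ∈ T := by
      rw [← hr2]
      exact hcl z hzT τ hzτ
    have hch2 : ψ₂.Chain U (fun x => x ≠ v) m (ψ.mate τ r) y := hch.map fun a a' ha hA => by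
      obtain ⟨d, h1, h2, h3⟩ := hA
      have haU := (hC.full_of_lowEdge hG h3).notMem h1
      exact ⟨d, (hx2 a ha (fun h => haU (h ▸ hzU)) d).trans h1, (hr2 d).trans h2,
        by rw [LowEdge, hr2]; exact h3⟩
    have hyT : y ∈ T := hch2.mem_of_closed hcl haT
    have hyz : y ≠ z := fun h => hyU (h ▸ hzU)
    by_cases hyv : y = v
    · subst hyv
      exact hyz (hT.elementary hC.adj hC.not_colorable ((hr2 ρ).trans hρ) hyT hzT hvτ hzτ)
    rcases hyc.resolve_left hyv with h | h
    · exact hT.ne_of_missing_center hC.adj hC.not_colorable hyT ((hx2 y hyv hyz ρ).trans h)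
        ((hr2 ρ).trans hρ)
    -- the new fan contains `U`, the last vertex of the maximum fan, and `y`
    have hγT : ψ.mate γ r ∈ T := by
      rw [← hr2]
      exact hcl y hyT γ ((hx2 y hyv hyz γ).trans h)
    have hUT : ∀ S, ψ.Fan S → S ⊆ U → S ⊆ T := by
      intro S hS
      induction hS with
      | root => exact fun _ => by simpa using hT.root_mem
      | @step S x w d _ hx hd hw _ _ ih =>
        intro hSU
        have hS' := ih ((Finset.subset_insert w S).trans hSU)
        refine Finset.insert_subset ?_ hS'
        have hxU : x ∈ U := hSU (Finset.mem_insert_of_mem hx)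
        by_cases hxz : x = z
        · subst hxz
          by_cases hdγ : d = γ
          · rw [← hw, hdγ]
            exact hγT
          · have : d ≠ τ := by
              rintro rfl
              exact hτ.2 x hxU hd
            rw [← hw, ← hr2]
            exact hcl x hzT d ((kempe_of_ne hL this hdγ).trans hd)
        · rw [← hw, ← hr2]
          exact hcl x (hS' hx) d ((hu2 x hxU hxz d).trans hd)
    have hβT : ψ.mate β r ∈ T := by
      rw [← hr2]
      exact hcl s hT.root_mem β ((hu2 s hG.root_mem hzs.symm β).trans hG.root)
    have hyβ : y ∉ insert (ψ.mate β r) U := by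
      rw [Finset.mem_insert, not_or]
      refine ⟨?_, hyU⟩
      rintro rfl
      exact hC.degree_leaf hG hG.root_mem hG.root hG.leaf (degree_lt_of_missing ψ hyr
        (fun h' => hyU (by rw [h']; exact hG.root_mem)) h)
    have hsub : insert y (insert (ψ.mate β r) U) ⊆ T :=
      Finset.insert_subset hyT (Finset.insert_subset hβT (hUT U hG.fan subset_rfl))
    have h1 := Finset.card_le_card hsub
    have h2 := hC.card_le ψ₂ T (hUT U hG.fan subset_rfl) hT
    rw [Finset.card_insert_of_notMem hyβ, Finset.card_insert_of_notMem hG.leaf] at h1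
    omega
  -- first free `γ` at `v`
  have hK := ψ.comp_closed ρ γ v
  have hlink := hC.mem_comp_center hG hρ hzU hγ
  have hrK : r ∉ ψ.comp ρ γ v := fun h' => ψ.three_ends (Or.inl hρ) (Or.inr hγ) (Or.inl hρv)
    hzr.symm hvr.symm hz.ne hlink (mem_comp_symm h')
  set ψ₁ := ψ.kempe ρ γ _ hK with hψ₁
  have hG1 : ψ₁.Good U β := hC.good_kempe_center hG hρ hK hrK
  have hr1 : ∀ c, ψ₁.mate c r = ψ.mate c r := fun c => kempe_of_notMem hK hrK
  have hρ1 : ψ₁.mate ρ r = r := (hr1 ρ).trans hρ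
  have hmiss1 : ∀ u ∈ U, ∀ c, ψ₁.mate c u = u ↔ ψ.mate c u = u := fun u hu =>
    hG.fan.kempe_missing_iff hC.adj hC.not_colorable hρ hK hrK hu
  have hfull1 : ∀ {c}, ψ₁.Full U c ↔ ψ.Full U c := hC.full_kempe_center hG hρ hK hrK
  have hγv1 : ψ₁.mate γ v = v := (kempe_right hK (ψ.mem_comp_self _ _ _)).trans hρv
  have hγz1 : ψ₁.mate γ z = z := (hmiss1 z hzU γ).2 hγ
  have hτρ : τ ≠ ρ := by
    rintro rfl
    exact hτ.1 hρ
  have hτγ : τ ≠ γ := by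
    rintro rfl
    exact hγf hτ
  have hvz1 : ψ₁.mate τ v = z := (kempe_of_ne hK hτρ hτγ).trans hz.edge
  have hch1 : ψ₁.Chain U (fun x => x ≠ v) m (ψ₁.mate τ r) y := by
    rw [hr1]
    exact (hch.map fun a a' _ hA => hC.arc_kempe_center hG hρ hK hrK hγf hA).mono
      fun x hx h => hx.2 (h ▸ hvbad)
  obtain ⟨hyU, hyr, c, hcy, hcf⟩ : ψ₁.Bad U y := hC.bad_kempe_center hG hρ hK hrK hγf hy
  by_cases hyv : y = v
  · exact fin hG1 hρ1 hγv1 hγz1 hvz1 (hfull1.2 hτ) hch1 hyU hyr (Or.inl hyv)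
  by_cases hcρ : c = ρ
  · exact fin hG1 hρ1 hγv1 hγz1 hvz1 (hfull1.2 hτ) hch1 hyU hyr (Or.inr (Or.inl (by rw [← hcρ, hcy])))
  by_cases hcγ : c = γ
  · exact fin hG1 hρ1 hγv1 hγz1 hvz1 (hfull1.2 hτ) hch1 hyU hyr (Or.inr (Or.inr (by rw [← hcγ, hcy])))
  -- then free the color of the center at `y`
  obtain ⟨u, hu, hcu⟩ := (not_full_iff.1 hcf).resolve_left
    fun h => hcρ (hC.missing_center_unique ψ₁ h hρ1)
  have hM := ψ₁.comp_closed ρ c y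
  have hlink1 := hC.mem_comp_center hG1 hρ1 hu hcu
  have hrM : r ∉ ψ₁.comp ρ c y := fun h' => ψ₁.three_ends (Or.inl hρ1) (Or.inr hcu) (Or.inr hcy)
    (fun h => hC.center_notMem hG (h ▸ hu)) hyr.symm (fun h => hyU (h ▸ hu)) hlink1
    (mem_comp_symm h')
  have hγρ : γ ≠ ρ := by
    rintro rfl
    exact hC.ne_center_of_missing hG hzU hγ hρ
  have hγM : ∀ x, (ψ₁.kempe ρ c _ hM).mate γ x = ψ₁.mate γ x := fun x =>
    kempe_of_ne hM hγρ (Ne.symm hcγ)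
  have hτc : τ ≠ c := by
    rintro rfl
    exact hcf (hfull1.2 hτ)
  refine fin (hC.good_kempe_center hG1 hρ1 hM hrM) ((kempe_of_notMem hM hrM).trans hρ1)
    ((hγM v).trans hγv1) ((hγM z).trans hγz1) ((kempe_of_ne hM hτρ hτc).trans hvz1)
    ((hC.full_kempe_center hG1 hρ1 hM hrM).2 (hfull1.2 hτ)) ?_ hyU hyr
    (Or.inr (Or.inl ((kempe_left hM (ψ₁.mem_comp_self _ _ _)).trans hcy)))
  rw [kempe_of_notMem hM hrM]
  exact hch1.map fun a a' _ hA => hC.arc_kempe_center hG1 hρ1 hM hrM hcf hA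

/-- Let `vz` be an edge of color `τ` from a loose vertex to a pivot. No chain starting at the end of
the edge of color `τ` at the center leads to a bad vertex. -/
theorem Core.pivot_no_chain (hvU : v ∉ U) (hvr : v ≠ r) (hv : ψ.Loose β v)
    (hz : ψ.Pivot U v τ z) (hlow : ψ.LowEdge U τ) {P : V → Prop} {n : ℕ} {y : V}
    (hch : ψ.Chain U P n (ψ.mate τ r) y) (hy : ψ.Bad U y) : False := by
  have hτ := hC.full_of_lowEdge hG hlow
  have hτβ := hG.ne_of_full hτ
  have go : ∀ {ψ'}, Switched ψ ψ' U β → ψ'.Chain U P n (ψ'.mate τ r) y := fun hS => by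
    rw [hS.center]
    exact hch.map fun a a' _ => hS.arc a a'
  rcases hz.kind with ⟨σ, hσ⟩ | ⟨hzU, hzs⟩
  · obtain ⟨ψ', hS, hv'⟩ := hC.exists_switched_root hG hvU hvr hv
    exact hC.pivot_no_chain_of_rootNbr hS.good hvU hvr hv' (hS.pivot hG hz hτ.1 hτβ)
      (hS.rootNbr hG hσ) (hS.lowEdge hlow) (go hS) (hS.bad y hy)
  · obtain ⟨ψ', hS, ρ, hρ, hv'⟩ := hC.exists_switched_center hG hvU hvr hv
    exact hC.pivot_no_chain_of_mem hS.good hρ hvU hvr hv' (hS.pivot hG hz hτ.1 hτβ) hzU hzs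
      (hS.lowEdge hlow) (go hS) (hS.bad y hy)

end

/-! ### Missing colors along chains -/

section

variable {V : Type*} [Fintype V] {G : SimpleGraph V} [DecidableRel G.Adj] {r s : V} {D : ℕ}
  {U : Finset V} (hC : Core G r s D U) {ψ ψ' : G.NearColoring r s D} {β γ ρ σ τ τ' : Fin D}
  {v z z' : V} (hG : ψ.Good U β)
include hC hG

theorem Core.pivot_kempe_root (hz : ψ.Pivot U v τ z) (hγ : ψ.Full U γ) {K : Set V}
    (hK : ψ.KempeClosed β γ K) (hs : s ∉ K) (hτβ : τ ≠ β) (hτγ : τ ≠ γ) :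
    (ψ.kempe β γ K hK).Pivot U v τ z where
  low := hz.low
  edge := (kempe_of_ne hK hτβ hτγ).trans hz.edge
  ne := hz.ne
  kind := hz.kind.imp (fun ⟨σ, hσ⟩ => ⟨σ, hC.rootNbr_kempe_root hG hσ hγ hK hs⟩) id

/-- If a chain from the color `τ` of a pivot edge ends at a vertex missing a color `c ≠ τ` present
on the fan, then this vertex lies in the component of the root for `β` and `c`: otherwise it could
be made bad. -/
theorem Core.chain_mem_comp_root (hvU : v ∉ U) (hvr : v ≠ r) (hρ : ψ.mate ρ r = r)
    (hρv : ψ.mate ρ v = v) (hz : ψ.Pivot U v τ z) (hlow : ψ.LowEdge U τ) {P : V → Prop} {n : ℕ}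
    {y : V} (hch : ψ.Chain U P n (ψ.mate τ r) y) (hy : ψ.mate γ y = y) (hγ : ψ.Full U γ)
    (hτγ : τ ≠ γ) : y ∈ ψ.comp β γ s := by
  by_contra h
  have hτ := hC.full_of_lowEdge hG hlow
  have hK := ψ.comp_closed β γ y
  have hsK : s ∉ ψ.comp β γ y := fun h' => h (mem_comp_symm h')
  have hG' := hC.good_kempe_root hG hγ hK hsK
  have hρβ : ρ ≠ β := by
    rintro rfl
    exact hC.ne_center_of_missing hG hG.root_mem hG.root hρ
  have hργ : ρ ≠ γ := by
    rintro rfl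
    exact hγ.1 hρ
  have hv' : (ψ.kempe β γ _ hK).Loose β v := Or.inl
    ⟨ρ, (kempe_of_ne hK hρβ hργ).trans hρ, (kempe_of_ne hK hρβ hργ).trans hρv⟩
  have hz'' := hC.pivot_kempe_root hG hz hγ hK hsK (hG.ne_of_full hτ) hτγ
  have hlow' := hC.lowEdge_kempe_root hG hγ hK hsK hlow
  rw [← hC.kempe_root_lowEdge_mate hG hγ hK hsK hlow] at hch
  rcases hch.persist fun a a' _ hA => hC.arc_kempe_root hG hγ hK hsK hA with h1 | ⟨m, x, h1, h2⟩
  · exact hC.pivot_no_chain hG' hvU hvr hv' hz'' hlow' h1 ⟨hγ.notMem hy, hγ.ne_center hy, β,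
      (kempe_left hK (ψ.mem_comp_self _ _ _)).trans hy, hG'.not_full⟩
  · exact hC.pivot_no_chain hG' hvU hvr hv' hz'' hlow' h1 h2

/-- Chains do not share missing colors with a pivot outside the fan. -/
theorem Core.chain_present_of_rootNbr (hvU : v ∉ U) (hvr : v ≠ r) (hv : ψ.Loose β v)
    (hz : ψ.Pivot U v τ z) (hlow : ψ.LowEdge U τ) {P : V → Prop} {n : ℕ}
    {y : V} (hch : ψ.Chain U P n (ψ.mate τ r) y) (hσ : ψ.RootNbr U σ z') (hγ : ψ.mate γ z' = z')
    (hyz : y ≠ z') : ψ.mate γ y ≠ y := by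
  intro hy
  have hτ := hC.full_of_lowEdge hG hlow
  obtain ⟨ψ', hS, ρ, hρ, hρv⟩ := hC.exists_switched_center hG hvU hvr hv
  have hγf := hC.rootNbr_full hG hσ hγ
  have hγ' := hS.of_ne γ hγf.1 (hG.ne_of_full hγf)
  have hτγ : τ ≠ γ := by
    rintro rfl
    exact hC.no_chain_to_missing hG hvU hvr hv hz hσ (.nil (P := fun _ => True) z') hγ
  refine hC.notMem_comp_root hS.good (hS.rootNbr hG hσ) ((hγ' z').trans hγ) (hγf.notMem hy) hyz
    (Or.inr ((hγ' y).trans hy)) ?_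
  refine hC.chain_mem_comp_root hS.good hvU hvr hρ hρv (hS.pivot hG hz hτ.1 (hG.ne_of_full hτ))
    (hS.lowEdge hlow) (P := P) (n := n) ?_ ((hγ' y).trans hy) ((hS.full γ).2 hγf) hτγ
  rw [hS.center]
  exact hch.map fun a a' _ => hS.arc a a'

theorem Core.arc_of_toggled (hT : Toggled ψ ψ' U β γ τ v z) {a a' : V} (hav : a ≠ v) (haz : a ≠ z)
    (hγ : ψ.mate γ a ≠ a) (hA : ψ.Arc U a a') : ψ'.Arc U a a' := by
  obtain ⟨c, h1, h2, h3⟩ := hA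
  refine ⟨c, ?_, (hT.lowEdge_mate c h3).trans h2, hT.lowEdge c h3⟩
  by_cases hcτ : c = τ
  · subst hcτ
    exact hT.missing a hav haz h1
  · rw [hT.of_ne c (hG.ne_of_full (hC.full_of_lowEdge hG h3)) _ hcτ, h1]
    rintro rfl
    exact hγ h1

/-- The case of `Core.chain_present` in which both pivots lie in the fan. The edges from `v` to them
are recolored, so that the fan grows along the chain to a vertex missing `τ` while `z` also does. -/
theorem Core.chain_present_of_mem (hvU : v ∉ U) (hvr : v ≠ r) (hρ : ψ.mate ρ r = r)
    (hρv : ψ.mate ρ v = v) (hz : ψ.Pivot U v τ z) (hzU : z ∈ U) (hzs : z ≠ s)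
    (hz' : ψ.Pivot U v τ' z') (hzU' : z' ∈ U) (hlow : ψ.LowEdge U τ') {n : ℕ}
    {y : V} (hch : ψ.Chain U (fun x => x ≠ v) n (ψ.mate τ' r) y) : ψ.mate τ y ≠ y := by
  intro hy
  have hnc := hC.not_colorable
  have hv : ψ.Loose β v := Or.inl ⟨ρ, hρ, hρv⟩
  have hτ := hC.pivot_full hG hvU hvr hv hz
  have hτ' := hC.full_of_lowEdge hG hlow
  have hρf : ¬ ψ.Full U ρ := fun h => h.1 hρ
  have ne_of : ∀ {c d}, ψ.Full U c → ¬ ψ.Full U d → c ≠ d := by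
    rintro c d h1 h2 rfl
    exact h2 h1
  have hyU := hτ.notMem hy
  have hyv : y ≠ v := by
    rintro rfl
    exact hz.ne (hz.edge.symm.trans hy)
  have hyz : y ≠ z := fun h => hyU (h ▸ hzU)
  have hrU := hC.center_notMem hG
  have hzr : z ≠ r := fun h => hrU (h ▸ hzU)
  by_cases hzz : z = z'
  · subst hzz
    obtain rfl : τ = τ' := ψ.color_unique hz.edge hz'.edge hz.ne
    obtain ⟨γ, hγ⟩ := hC.exists_missing ψ hz.low
    have hγf : ¬ ψ.Full U γ := fun h => h.2 z hzU hγ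
    obtain ⟨ψ', e⟩ := hG.fan.exists_exchanged hC.adj hnc hρ hvU hvr hρv hzU hz.edge hγ
    obtain ⟨Q, hQ, hzQ, hQU, -, u, hu, c, hc, hcr⟩ := hG.fan.exists_prefix hzU hzs
    obtain ⟨T, hQT, hT, hcl⟩ := ((e.fan hQ hQU hzQ).step hu
      ((e.missing_iff u (hQU hu) (fun h => hzQ (h ▸ hu)) c).2 hc)
      ((e.center c).trans hcr) hzQ hzr).exists_closed hC.adj hnc
    have hzT : z ∈ T := hQT (Finset.mem_insert_self _ _)
    have haT := hcl z hzT τ e.missing_right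
    rw [e.center] at haT
    have hch' : ψ'.Chain U (fun x => x ≠ v) n (ψ.mate τ r) y := hch.map fun a a' ha hA => by
      obtain ⟨d, h1, h2, h3⟩ := hA
      have hd := hC.full_of_lowEdge hG h3
      refine ⟨d, ?_, (e.center d).trans h2, by rw [LowEdge, e.center]; exact h3⟩
      by_cases hdτ : d = τ
      · rw [hdτ] at h1 ⊢
        rw [e.of_notMem a ha (fun h => hτ.notMem h1 (h ▸ hzU)), h1]
      · rw [e.of_ne d (ne_of hd hρf) (ne_of hd hγf) hdτ, h1]
    exact hyz (hT.elementary hC.adj hnc ((e.center ρ).trans hρ) (hch'.mem_of_closed hcl haT) hzT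
      ((e.of_notMem y hyv hyz).trans hy) e.missing_right)
  -- make `z'` the root, and exchange one of two colors missing there
  have hττ : τ ≠ τ' := by
    rintro rfl
    exact hzz (hz.edge.symm.trans hz'.edge)
  have hrz := hG.fan.adj hC.adj z' hzU'
  obtain ⟨ψr, hF, hout, hfull, -⟩ := hG.fan.reroot hC.adj z' hzU'
  have hfr : ∀ {c}, ψ.Full U c → ∀ x, ψr.mate c x = ψ.mate c x := fun {c} h =>
    hfull c (h.edge_notMem hG.fan)
  have hρr : ∀ x, ψr.mate ρ x = ψ.mate ρ x := hfull ρ (by rwa [hρ])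
  have hcard := ψr.card_missing_root hrz
  have hlow' := hz'.low
  obtain ⟨g₁, h1, g₂, h2, hne⟩ := Finset.one_lt_card.1
    (show 1 < (ψr.missing z').card by omega)
  obtain ⟨g, ψ₁, T, hg, e, hT, hzT, -⟩ := hF.exists_exchanged_root hrz hnc ((hρr r).trans hρ) hvU hvr
    ((hρr v).trans hρv) ((hfr hτ' v).trans hz'.edge) (mem_missing.1 h1) (mem_missing.1 h2) hne hzU
  have hgf : ¬ ψ.Full U g := fun h => h.2 z' hzU' ((hfr h z').symm.trans hg)
  have e1 : ∀ {c}, ψ.Full U c → c ≠ τ' → ∀ x, ψ₁.mate c x = ψ.mate c x := fun hc hcτ x =>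
    (e.of_ne _ (ne_of hc hρf) (ne_of hc hgf) hcτ x).trans (hfr hc x)
  have er : ∀ {c}, ψ.Full U c → ψ₁.mate c r = ψ.mate c r := fun hc =>
    (e.center _).trans (hfr hc r)
  have hρ1 : ψ₁.mate ρ r = r := (e.center ρ).trans ((hρr r).trans hρ)
  have hch1 : ψ₁.Chain U (fun x => x ≠ v) n (ψ.mate τ' r) y := hch.map fun a a' ha hA => by
    obtain ⟨d, h1, h2, h3⟩ := hA
    have hd := hC.full_of_lowEdge hG h3
    refine ⟨d, ?_, (er hd).trans h2, by rw [LowEdge, er hd]; exact h3⟩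
    by_cases hdτ : d = τ'
    · rw [hdτ] at h1 ⊢
      rw [e.of_notMem a ha (fun h => hτ'.notMem h1 (h ▸ hzU')), hfr hτ', h1]
    · rw [e1 hd hdτ, h1]
  -- a fan containing `y` but not `z`, to which `z` can be attached
  obtain ⟨P₀, hP₀, -, hyP, hP⟩ := hch1.exists_fan hC.degree_center
    (Fan.root.add (Finset.mem_singleton_self z') e.missing_right (er hτ') hτ'.1)
    (Finset.mem_insert_self _ _)
  have hzP : z ∉ P₀ := fun h => by
    rcases hP z h with h1 | h1
    · rcases Finset.mem_insert.1 h1 with h2 | h2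
      · exact hlow.1 (h2 ▸ hzU)
      · exact hzz (Finset.mem_singleton.1 h2)
    · exact h1 hzU
  obtain ⟨P₁, hP₁, hzP₁, -, -, u, hu, c, hc, hcr⟩ := hT.exists_prefix hzT hzz
  have hQ := hP₀.union hP₁
  have hzQ : z ∉ P₀ ∪ P₁ := by simp [hzP, hzP₁]
  have huQ : u ∈ P₀ ∪ P₁ := Finset.mem_union_right _ hu
  have hyQ : y ∈ P₀ ∪ P₁ := Finset.mem_union_left _ hyP
  have hS := hQ.step huQ hc hcr hzQ hzr
  have hvS : v ∉ insert z (P₀ ∪ P₁) := fun h => hvU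
    (hS.elementary hrz hnc hρ1 h hS.root_mem e.missing_left e.missing_right ▸ hzU')
  -- move `v` back to the color of the center, then exchange a color at `z`
  have hK := ψ₁.comp_closed ρ τ' v
  have hrK : r ∉ ψ₁.comp ρ τ' v := fun h' => ψ₁.three_ends (Or.inl hρ1) (Or.inr e.missing_right)
    (Or.inr e.missing_left) hrz.ne hvr.symm hz'.ne (hS.mem_comp hrz hnc hρ1 hS.root_mem
      e.missing_right) (mem_comp_symm h')
  have hiff := fun w hw => hS.kempe_missing_iff hrz hnc hρ1 hK hrK (w := w) hw
  have hτ1 : ∀ x, (ψ₁.kempe ρ τ' _ hK).mate τ x = ψ.mate τ x := fun x =>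
    (kempe_of_ne hK (ne_of hτ hρf) hττ).trans (e1 hτ hττ x)
  have hcard' := (ψ₁.kempe ρ τ' _ hK).card_missing hzr hzz
  have hlowz := hz.low
  obtain ⟨δ, hδ⟩ := Finset.card_pos.1
    (show 0 < ((ψ₁.kempe ρ τ' _ hK).missing z).card by omega)
  obtain ⟨ψ₂, e'⟩ := (hS.kempe hrz hnc hρ1 hK hrK).exists_exchanged hrz hnc
    ((kempe_of_notMem hK hrK).trans hρ1) hvS hvr
    ((kempe_left hK (ψ₁.mem_comp_self _ _ _)).trans e.missing_left) (Finset.mem_insert_self _ _)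
    ((hτ1 v).trans hz.edge) (mem_missing.1 hδ)
  have hF2 := (e'.fan (hQ.kempe hrz hnc hρ1 hK hrK) (Finset.subset_insert _ _) hzQ).step huQ
    ((e'.missing_iff u (Finset.mem_insert_of_mem huQ) (fun h => hzQ (h ▸ huQ)) c).2
      ((hiff u (Finset.mem_insert_of_mem huQ) c).2 hc))
    ((e'.center c).trans ((kempe_of_notMem hK hrK).trans hcr)) hzQ hzr
  exact hyz (hF2.elementary hrz hnc ((e'.center ρ).trans ((kempe_of_notMem hK hrK).trans hρ1))
    (Finset.mem_insert_of_mem hyQ) (Finset.mem_insert_self _ _)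
    ((e'.of_notMem y hyv hyz).trans ((hτ1 y).trans hy)) e'.missing_right)

/-- The case of `Core.chain_present` in which `v` misses the color `β` of the root. -/
theorem Core.chain_present_aux (hvU : v ∉ U) (hvr : v ≠ r) (hβv : ψ.mate β v = v)
    (hz : ψ.Pivot U v τ z) (hz' : ψ.Pivot U v τ' z') (hlow : ψ.LowEdge U τ') {P : V → Prop}
    {n : ℕ} {y : V} (hch : ψ.Chain U P n (ψ.mate τ' r) y) : ψ.mate τ y ≠ y := by
  intro hy
  have hv : ψ.Loose β v := Or.inr hβv
  have hf := hC.pivot_full hG hvU hvr hv hz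
  have hf' := hC.full_of_lowEdge hG hlow
  have hτβ := hG.ne_of_full hf
  have hτβ' := hG.ne_of_full hf'
  have hyv : y ≠ v := by
    rintro rfl
    exact hz.ne (hz.edge.symm.trans hy)
  have hyz : y ≠ z := by
    rintro rfl
    exact hz.ne (hy.symm.trans (ψ.mate_eq_comm.1 hz.edge))
  rcases hch.avoid_or_prefix (· = v) with hch | ⟨m, _, -, rfl, hch⟩
  swap
  · exact hC.pivot_no_chain hG hvU hvr hv hz' hlow hch ⟨hvU, hvr, β, hβv, hG.not_full⟩
  rcases hch.avoid_or_suffix (fun x => ∃ σ, ψ.RootNbr U σ x) with hch | ⟨m, x, ⟨σ, hσ⟩, hch⟩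
  swap
  · exact hC.no_chain_to_missing hG hvU hvr hv hz hσ hch hy
  have hP : ∀ {σ x}, ψ.RootNbr U σ x → ∀ a, ((P a ∧ ¬ a = v) ∧ ¬ ∃ σ, ψ.RootNbr U σ a) →
      a ≠ v ∧ a ≠ x := fun hσ a ha => ⟨ha.1.2, fun h => ha.2 ⟨_, h ▸ hσ⟩⟩
  rcases hz'.kind with ⟨σ, hσ⟩ | ⟨hzU', hzs'⟩
  · have hyz' : y ≠ z' := by
      rintro rfl
      exact hC.no_chain_to_missing hG hvU hvr hv hz hσ (.nil (P := fun _ => True) y) hy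
    obtain ⟨γ, hγ⟩ := hC.exists_missing ψ hz'.low
    obtain ⟨ψ', hT⟩ := hC.exists_toggled hG hvU hvr hβv hσ hz'.edge hz'.ne hγ
    have hσ' := hT.rootNbr σ z' hσ
    have hch' := hC.chain_of_toggled hG hT hlow hσ hch (hP hσ)
    have hτ' := hC.rootNbr_full hT.good hσ' hT.missing_right
    have hK := (ψ'.comp_closed β τ' s).compl
    have hsK : s ∉ (ψ'.comp β τ' s)ᶜ := fun h => h (ψ'.mem_comp_self _ _ _)
    have hG' := hC.good_kempe_root hT.good hτ' hK hsK
    have hσ'' := hC.rootNbr_kempe_root hT.good hσ' hτ' hK hsK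
    have hch'' : (ψ'.kempe β τ' _ hK).Chain U (fun _ => True) (n + 1) z' y := by
      rcases hch'.persist fun a a' _ hA => hC.arc_kempe_root hT.good hτ' hK hsK hA with
        h | ⟨m, y, h, hy⟩
      · exact h
      · exact (hC.rootNbr_no_chain hG' hσ'' h hy).elim
    by_cases hzz : z' = z
    · subst hzz
      obtain rfl : τ = τ' := ψ.color_unique hz.edge hz'.edge hz.ne
      have hy' := hT.missing y hyv hyz hy
      have hyK : y ∈ (ψ'.comp β τ s)ᶜ := hC.notMem_comp_root hT.good hσ' hT.missing_right
        (hf.notMem hy) hyz (Or.inr hy')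
      exact hC.rootNbr_no_chain hG' hσ'' hch'' ⟨hf.notMem hy, hf.ne_center hy, β,
        (kempe_left hK hyK).trans hy', hG'.not_full⟩
    · have hττ : τ ≠ τ' := by
        rintro rfl
        exact hzz (hz'.edge.symm.trans hz.edge)
      have hτγ : τ ≠ γ := by
        rintro rfl
        exact hC.no_chain_to_missing hG hvU hvr hv hz hσ (.nil (P := fun _ => True) z') hγ
      have hvK : v ∈ (ψ'.comp β τ' s)ᶜ := hC.notMem_comp_root hT.good hσ' hT.missing_right hvU
        hz'.ne.symm (Or.inr hT.missing_left)
      have e : ∀ x, (ψ'.kempe β τ' _ hK).mate τ x = ψ.mate τ x := fun x =>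
        (kempe_of_ne hK hτβ hττ).trans (hT.of_ne τ hτβ hτγ hττ x)
      exact hC.no_chain_to_missing hG' hvU hvr (Or.inr ((kempe_left hK hvK).trans hT.missing_left))
        ⟨hz.low, (e v).trans hz.edge, hz.ne, hz.kind.imp (fun ⟨σ, h⟩ => ⟨σ,
          hC.rootNbr_kempe_root hT.good (hT.rootNbr σ z h) hτ' hK hsK⟩) id⟩ hσ'' hch''
        ((e y).trans hy)
  rcases hz.kind with ⟨σ, hσ⟩ | ⟨hzU, hzs⟩
  · obtain ⟨γ, hγ⟩ := hC.exists_missing ψ hz.low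
    have hττ : τ' ≠ τ := by
      rintro rfl
      exact hσ.notMem (hz'.edge.symm.trans hz.edge ▸ hzU')
    have hτγ : τ' ≠ γ := by
      rintro rfl
      exact hC.no_chain_to_missing hG hvU hvr hv hz' hσ (.nil (P := fun _ => True) z) hγ
    obtain ⟨ψ', hT⟩ := hC.exists_toggled hG hvU hvr hβv hσ hz.edge hz.ne hγ
    -- no tail of the chain misses `γ`
    have hch' : ψ'.Chain U (fun _ => True) n (ψ.mate τ' r) y := by
      rcases hch.avoid_or_prefix (fun x => ψ.mate γ x = x) with hch | ⟨m, x, hx', hx, hch⟩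
      · exact (hch.map fun a a' ha hA => hC.arc_of_toggled hG hT (hP hσ a ha.1).1 (hP hσ a ha.1).2
          ha.2 hA).mono fun _ _ => trivial
      · refine absurd hx (hC.chain_present_of_rootNbr hG hvU hvr hv hz' hlow hch hσ hγ ?_)
        exact (hP hσ x hx').2
    have hσ' := hT.rootNbr σ z hσ
    have hτ := hC.rootNbr_full hT.good hσ' hT.missing_right
    have hK := (ψ'.comp_closed β τ s).compl
    have hsK : s ∉ (ψ'.comp β τ s)ᶜ := fun h => h (ψ'.mem_comp_self _ _ _)
    have hy' := hT.missing y hyv hyz hy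
    have hyK : y ∈ (ψ'.comp β τ s)ᶜ := hC.notMem_comp_root hT.good hσ' hT.missing_right
      (hf.notMem hy) hyz (Or.inr hy')
    have hvK : v ∈ (ψ'.comp β τ s)ᶜ := hC.notMem_comp_root hT.good hσ' hT.missing_right hvU
      hz.ne.symm (Or.inr hT.missing_left)
    have hG' := hC.good_kempe_root hT.good hτ hK hsK
    have hlow' := hT.lowEdge τ' hlow
    have e : ∀ x, (ψ'.kempe β τ _ hK).mate τ' x = ψ.mate τ' x := fun x =>
      (kempe_of_ne hK hτβ' hττ).trans (hT.of_ne τ' hτβ' hτγ hττ x)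
    have fin := fun {m x} (P : V → Prop) => hC.pivot_no_chain (P := P) (n := m) (y := x)
      hG' hvU hvr (Or.inr ((kempe_left hK hvK).trans hT.missing_left))
      ⟨hz'.low, (e v).trans hz'.edge, hz'.ne, Or.inr ⟨hzU', hzs'⟩⟩
      (hC.lowEdge_kempe_root hT.good hτ hK hsK hlow')
    rw [e] at fin
    rcases hch'.persist fun a a' _ hA => hC.arc_kempe_root hT.good hτ hK hsK hA with
      h | ⟨m, x, h, hx⟩
    · exact fin _ h ⟨hf.notMem hy, hf.ne_center hy, β, (kempe_left hK hyK).trans hy',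
        hG'.not_full⟩
    · exact fin _ h hx
  · obtain ⟨ψ', hS, ρ, hρ, hρv⟩ := hC.exists_switched_center hG hvU hvr hv
    refine hC.chain_present_of_mem hS.good hvU hvr hρ hρv (hS.pivot hG hz hf.1 hτβ) hzU hzs
      (hS.pivot hG hz' hf'.1 hτβ') hzU' (hS.lowEdge hlow) (n := n) (y := y) ?_
      ((hS.of_ne τ hf.1 hτβ y).trans hy)
    rw [hS.center]
    exact (hch.map fun a a' _ => hS.arc a a').mono fun x hx => hx.1.2

/-- No vertex reached by a chain from the color of a pivot edge misses the color of a pivot edge. -/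
theorem Core.chain_present (hvU : v ∉ U) (hvr : v ≠ r) (hv : ψ.Loose β v)
    (hz : ψ.Pivot U v τ z) (hz' : ψ.Pivot U v τ' z') (hlow : ψ.LowEdge U τ') {P : V → Prop}
    {n : ℕ} {y : V} (hch : ψ.Chain U P n (ψ.mate τ' r) y) : ψ.mate τ y ≠ y := by
  intro hy
  obtain ⟨ψ', hS, hβv⟩ := hC.exists_switched_root hG hvU hvr hv
  have hf := hC.pivot_full hG hvU hvr hv hz
  have hf' := hC.full_of_lowEdge hG hlow
  have hτβ := hG.ne_of_full hf
  refine hC.chain_present_aux hS.good hvU hvr hβv (hS.pivot hG hz hf.1 hτβ)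
    (hS.pivot hG hz' hf'.1 (hG.ne_of_full hf')) (hS.lowEdge hlow) (P := P) (n := n) (y := y) ?_
    ((hS.of_ne τ hf.1 hτβ y).trans hy)
  rw [hS.center]
  exact hch.map fun a a' _ => hS.arc a a'

/-- Distinct vertices reached by chains from the colors of pivot edges share no missing color. -/
theorem Core.chain_disjoint (hvU : v ∉ U) (hvr : v ≠ r) (hρ : ψ.mate ρ r = r)
    (hρv : ψ.mate ρ v = v) (hz : ψ.Pivot U v τ z) (hlow : ψ.LowEdge U τ) (hz' : ψ.Pivot U v τ' z')
    (hlow' : ψ.LowEdge U τ') {P : V → Prop} {n n' : ℕ} {y y' : V}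
    (hch : ψ.Chain U P n (ψ.mate τ r) y) (hch' : ψ.Chain U P n' (ψ.mate τ' r) y')
    (hy : ψ.mate γ y = y) (hy' : ψ.mate γ y' = y') : y = y' := by
  by_contra hne
  have hv : ψ.Loose β v := Or.inl ⟨ρ, hρ, hρv⟩
  have hlow_out : ∀ {τ y n}, ψ.LowEdge U τ → ψ.Chain U P n (ψ.mate τ r) y → y ∉ U ∧ y ≠ r := by
    intro τ y n hl h
    have : ∃ c, ψ.mate c r = y ∧ ψ.LowEdge U c := by
      rcases h.eq_or_exists_last with rfl | h
      exacts [⟨τ, rfl, hl⟩, h]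
    obtain ⟨c, rfl, hc⟩ := this
    exact ⟨hc.1, (hC.full_of_lowEdge hG hc).1⟩
  obtain ⟨hyU, hyr⟩ := hlow_out hlow hch
  obtain ⟨hyU', hyr'⟩ := hlow_out hlow' hch'
  have hγ : ψ.Full U γ := by
    by_contra h
    exact hC.pivot_no_chain hG hvU hvr hv hz hlow hch ⟨hyU, hyr, γ, hy, h⟩
  have h1 : τ ≠ γ := by
    rintro rfl
    exact hC.chain_present hG hvU hvr hv hz hz hlow hch hy
  have h2 : τ' ≠ γ := by
    rintro rfl
    exact hC.chain_present hG hvU hvr hv hz' hz' hlow' hch' hy'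
  exact ψ.three_ends (Or.inl hG.root) (Or.inr hy) (Or.inr hy') (fun h => hyU (h ▸ hG.root_mem))
    (fun h => hyU' (h ▸ hG.root_mem)) hne
    (hC.chain_mem_comp_root hG hvU hvr hρ hρv hz hlow hch hy hγ h1)
    (hC.chain_mem_comp_root hG hvU hvr hρ hρv hz' hlow' hch' hy' hγ h2)

end

/-! ### Counting -/

section

variable {V : Type*} [Fintype V] {G : SimpleGraph V} [DecidableRel G.Adj] {r s : V} {D : ℕ}
  {U : Finset V} (hC : Core G r s D U) {ψ : G.NearColoring r s D} {β ρ : Fin D}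
  {v : V} (hG : ψ.Good U β)
include hC hG

/-- The neighbors of full degree of the center outside `U`. -/
noncomputable def fullNeighbors (G : SimpleGraph V) [DecidableRel G.Adj] (r : V) (D : ℕ)
    (U : Finset V) : Finset V :=
  (G.neighborFinset r).filter fun x => G.degree x = D ∧ x ∉ U

theorem Core.leaf_mem : ψ.mate β r ∈ fullNeighbors G r D U := by
  have h1 := hC.degree_leaf hG hG.root_mem hG.root hG.leaf
  have h2 := hC.degree_le (ψ.mate β r)
  simp only [fullNeighbors, Finset.mem_filter, mem_neighborFinset]
  exact ⟨ψ.adj β r (hC.ne_center_of_missing hG hG.root_mem hG.root), by omega, hG.leaf⟩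

theorem Core.mem_fullNeighbors_erase {c : Fin D} (hr : ψ.mate c r ≠ r) (hU : ψ.mate c r ∉ U)
    (hd : ¬ G.degree (ψ.mate c r) < D) (hβ : c ≠ β) :
    ψ.mate c r ∈ (fullNeighbors G r D U).erase (ψ.mate β r) := by
  have h2 := hC.degree_le (ψ.mate c r)
  simp only [fullNeighbors, Finset.mem_erase, Finset.mem_filter, mem_neighborFinset]
  exact ⟨fun h => hβ (ψ.uniq c β r h hr), ψ.adj c r hr, by omega, hU⟩

/-- The colors of the pivot edges, and the colors missing at the vertices reached by chains from
them, lead from the center to these vertices or to neighbors of full degree. -/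
theorem Core.card_pivots (hvU : v ∉ U) (hvr : v ≠ r) (hρ : ψ.mate ρ r = r) (hρv : ψ.mate ρ v = v)
    (Z : Finset V) (hZ : ∀ z ∈ Z, ∃ τ, ψ.Pivot U v τ z) :
    Z.card + 1 ≤ (fullNeighbors G r D U).card := by
  have hv : ψ.Loose β v := Or.inl ⟨ρ, hρ, hρv⟩
  let Y : Finset V := Finset.univ.filter fun y => ∃ z τ n, ψ.Pivot U v τ z ∧ ψ.LowEdge U τ ∧
    ψ.Chain U (fun _ => True) n (ψ.mate τ r) y
  let A : Finset (Fin D) := Finset.univ.filter fun c => ∃ z, ψ.Pivot U v c z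
  let B : Finset (Fin D) := Finset.univ.filter fun c => ∃ y ∈ Y, ψ.mate c y = y
  have hYlow : ∀ y ∈ Y, y ∉ U ∧ y ≠ r ∧ G.degree y < D := by
    intro y hy
    obtain ⟨z, τ, n, -, h2, h3⟩ := (Finset.mem_filter.1 hy).2
    have : ∃ c, ψ.mate c r = y ∧ ψ.LowEdge U c := by
      rcases h3.eq_or_exists_last with rfl | h
      exacts [⟨τ, rfl, h2⟩, h]
    obtain ⟨c, rfl, hc⟩ := this
    exact ⟨hc.1, (hC.full_of_lowEdge hG hc).1, hc.2⟩
  have hA : Z.card ≤ A.card := by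
    refine (Finset.card_le_card fun z hz => ?_).trans
      (Finset.card_image_le (s := A) (f := fun c => ψ.mate c v))
    obtain ⟨τ, hτ⟩ := hZ z hz
    exact Finset.mem_image.2 ⟨τ, by simpa [A] using ⟨z, hτ⟩, hτ.edge⟩
  have hB : Y.card ≤ B.card := by
    have : ∀ y : Y, ∃ c, ψ.mate c y.1 = y.1 := fun y =>
      hC.exists_missing ψ (hYlow y y.2).2.2
    choose f hf using this
    refine Finset.card_le_card_of_injOn (fun y => if h : y ∈ Y then f ⟨y, h⟩ else ρ)
      (fun y hy => ?_) fun y hy y' hy' h => ?_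
    · have hy : y ∈ Y := hy
      refine Finset.mem_coe.2 (Finset.mem_filter.2 ⟨Finset.mem_univ _, y, hy, ?_⟩)
      simpa only [hy, dif_pos] using hf ⟨y, hy⟩
    · have hy : y ∈ Y := hy
      have hy' : y' ∈ Y := hy'
      simp only [hy, hy', dif_pos] at h
      have h1 := hf ⟨y, hy⟩
      have h2 := hf ⟨y', hy'⟩
      rw [← h] at h2
      obtain ⟨z, τ, n, a1, a2, a3⟩ := (Finset.mem_filter.1 hy).2
      obtain ⟨z', τ', n', b1, b2, b3⟩ := (Finset.mem_filter.1 hy').2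
      exact hC.chain_disjoint hG hvU hvr hρ hρv a1 a2 b1 b2 a3 b3 h1 h2
  have hAB : Disjoint A B := by
    rw [Finset.disjoint_left]
    intro c hcA hcB
    obtain ⟨z, hz⟩ := (Finset.mem_filter.1 hcA).2
    obtain ⟨y, hy, hc⟩ := (Finset.mem_filter.1 hcB).2
    obtain ⟨z', τ', n', b1, b2, b3⟩ := (Finset.mem_filter.1 hy).2
    exact hC.chain_present hG hvU hvr hv hz b1 b2 b3 hc
  have hfull : ∀ c ∈ A ∪ B, ψ.Full U c := by
    intro c hc
    rcases Finset.mem_union.1 hc with hc | hc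
    · obtain ⟨z, hz⟩ := (Finset.mem_filter.1 hc).2
      exact hC.pivot_full hG hvU hvr hv hz
    · obtain ⟨y, hy, hc⟩ := (Finset.mem_filter.1 hc).2
      obtain ⟨z', τ', n', b1, b2, b3⟩ := (Finset.mem_filter.1 hy).2
      by_contra h
      obtain ⟨h1, h2, -⟩ := hYlow y hy
      exact hC.pivot_no_chain hG hvU hvr hv b1 b2 b3 ⟨h1, h2, c, hc, h⟩
  have hmap : (A ∪ B).card ≤ (Y ∪ (fullNeighbors G r D U).erase (ψ.mate β r)).card := by
    refine Finset.card_le_card_of_injOn (fun c => ψ.mate c r) (fun c hc => ?_)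
      fun c hc d hd h => ψ.uniq c d r h (hfull c hc).1
    have hcf := hfull c hc
    have hcU := hcf.edge_notMem hG.fan
    rw [Finset.mem_coe, Finset.mem_union]
    by_cases hd : G.degree (ψ.mate c r) < D
    · left
      rcases Finset.mem_union.1 hc with hc | hc
      · obtain ⟨z, hz⟩ := (Finset.mem_filter.1 hc).2
        exact Finset.mem_filter.2 ⟨Finset.mem_univ _, z, c, 0, hz, ⟨hcU, hd⟩, .nil _⟩
      · obtain ⟨y, hy, hc⟩ := (Finset.mem_filter.1 hc).2
        obtain ⟨z', τ', n', b1, b2, b3⟩ := (Finset.mem_filter.1 hy).2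
        exact Finset.mem_filter.2 ⟨Finset.mem_univ _, z', τ', n' + 1, b1, b2,
          b3.snoc trivial ⟨c, hc, rfl, hcU, hd⟩⟩
    · exact Or.inr (hC.mem_fullNeighbors_erase hG hcf.1 hcU hd (hG.ne_of_full hcf))
  rw [Finset.card_union_of_disjoint hAB] at hmap
  have h1 := hmap.trans (Finset.card_union_le _ _)
  have h2 := hC.leaf_mem hG
  have h3 := Finset.card_pos.2 ⟨_, h2⟩
  rw [Finset.card_erase_of_mem h2] at h1
  omega

/-- A common neighbor of `s` and `v` of less than full degree is a pivot unless the edge joining it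
to `s` has the color of the center or leads from the center to a vertex of full degree. -/
theorem Core.card_not_pivots (hvU : v ∉ U) (hvr : v ≠ r) (hρ : ψ.mate ρ r = r)
    (Z : Finset V) (hZ : ∀ z ∈ Z, G.Adj s z ∧ G.Adj v z ∧ G.degree z < D ∧
      ¬ ∃ τ, ψ.Pivot U v τ z) :
    Z.card ≤ (fullNeighbors G r D U).card := by
  let H := (fullNeighbors G r D U).erase (ψ.mate β r)
  let C₁ : Finset (Fin D) := Finset.univ.filter fun c => ψ.mate c r ∈ H
  have hC₁ : C₁.card ≤ H.card :=
    Finset.card_le_card_of_injOn (fun c => ψ.mate c r)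
      (fun c hc => (Finset.mem_filter.1 (Finset.mem_coe.1 hc)).2) fun c hc d _ h => by
        refine ψ.uniq c d r h fun h' => ?_
        have h1 := (Finset.mem_filter.1 (Finset.mem_coe.1 hc)).2
        have h2 := (Finset.mem_filter.1 (Finset.mem_of_mem_erase h1)).1
        rw [h', mem_neighborFinset] at h2
        exact h2.ne rfl
  have hsub : Z ⊆ (insert ρ C₁).image fun c => ψ.mate c s := by
    intro z hz
    obtain ⟨hsz, hvz, hd, hp⟩ := hZ z hz
    have hzr : z ≠ r := by
      rintro rfl
      exact hd.ne hC.degree_center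
    have hvs : v ≠ s := fun h => hvU (h ▸ hG.root_mem)
    obtain ⟨τ, hτ⟩ := ψ.cover v z hvz (by simp [hvr, hvs])
    have hzU : z ∉ U := fun h => hp ⟨τ, hd, hτ, hvz.ne', Or.inr ⟨h, hsz.ne'⟩⟩
    obtain ⟨σ, hσ⟩ := ψ.cover s z hsz (by simp [hzr, hC.adj.ne'])
    refine Finset.mem_image.2 ⟨σ, ?_, hσ⟩
    rw [Finset.mem_insert]
    by_cases h1 : ψ.mate σ r = r
    · exact Or.inl (hC.missing_center_unique ψ h1 hρ)
    right
    by_cases h2 : ψ.Safe U σ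
    · exact absurd ⟨τ, hd, hτ, hvz.ne', Or.inl ⟨σ, hzU, hzr, hσ, h2, h1⟩⟩ hp
    simp only [Safe, not_or] at h2
    refine Finset.mem_filter.2 ⟨Finset.mem_univ _,
      hC.mem_fullNeighbors_erase hG h1 h2.2.1 h2.2.2 ?_⟩
    rintro rfl
    exact hsz.ne (hG.root.symm.trans hσ)
  have h1 := (Finset.card_le_card hsub).trans Finset.card_image_le
  have h2 := Finset.card_insert_le ρ C₁
  have h3 := hC.leaf_mem hG
  have h4 := Finset.card_pos.2 ⟨_, h3⟩
  have h5 : H.card = (fullNeighbors G r D U).card - 1 := Finset.card_erase_of_mem h3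
  omega

/-- The colors missing in the fan lead from the center back into the fan, except for `β`, so there
are at most `|U|` of them. -/
theorem Core.le_degree_root : D ≤ G.degree s + (U.filter fun u => G.degree u = D).card := by
  have hsU := hG.root_mem
  have hM : (U.biUnion ψ.missing).card ≤ U.card := by
    have hβ : β ∈ U.biUnion ψ.missing :=
      Finset.mem_biUnion.2 ⟨s, hsU, mem_missing.2 hG.root⟩
    have h1 : ((U.biUnion ψ.missing).erase β).card ≤ (U.erase s).card := by
      refine Finset.card_le_card_of_injOn (fun c => ψ.mate c r) (fun c hc => ?_)
        fun c hc d _ h => ψ.uniq c d r h ?_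
      · obtain ⟨h1, h2⟩ := Finset.mem_erase.1 (Finset.mem_coe.1 hc)
        obtain ⟨u, hu, h3⟩ := Finset.mem_biUnion.1 h2
        exact Finset.mem_erase.2 ⟨ψ.avoid c, hC.edge_mem_of_missing hG hu (mem_missing.1 h3) h1⟩
      · obtain ⟨h1, h2⟩ := Finset.mem_erase.1 (Finset.mem_coe.1 hc)
        obtain ⟨u, hu, h3⟩ := Finset.mem_biUnion.1 h2
        exact hC.ne_center_of_missing hG hu (mem_missing.1 h3)
    rw [Finset.card_erase_of_mem hβ, Finset.card_erase_of_mem hsU] at h1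
    have := Finset.card_pos.2 ⟨_, hβ⟩
    have := Finset.card_pos.2 ⟨_, hsU⟩
    omega
  rw [Finset.card_biUnion fun u hu w hw hne => Finset.disjoint_left.2 fun c hc hc' =>
    hne (hC.elementary hG hu hw (mem_missing.1 hc) (mem_missing.1 hc')),
    ← Finset.add_sum_erase U _ hsU] at hM
  have h1 : ((U.filter fun u => G.degree u ≠ D).erase s).card ≤
      ∑ u ∈ U.erase s, (ψ.missing u).card := by
    have hsub : (U.filter fun u => G.degree u ≠ D).erase s ⊆ U.erase s :=
      Finset.erase_subset_erase s (Finset.filter_subset _ _)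
    refine le_trans ?_ (Finset.sum_le_sum_of_subset hsub)
    rw [Finset.card_eq_sum_ones]
    refine Finset.sum_le_sum fun u hu => ?_
    obtain ⟨h2, h3⟩ := Finset.mem_erase.1 hu
    have h4 := (Finset.mem_filter.1 h3).2
    have h5 := hC.degree_le u
    obtain ⟨c, hc⟩ := hC.exists_missing ψ (show G.degree u < D by omega)
    exact Finset.card_pos.2 ⟨c, mem_missing.2 hc⟩
  have h2 := ψ.card_missing_root hC.adj
  have h3 := Finset.card_filter_add_card_filter_not (s := U) (fun u => G.degree u = D)
  have h4 : s ∈ U.filter fun u => G.degree u ≠ D :=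
    Finset.mem_filter.2 ⟨hsU, hC.degree_root.ne⟩
  rw [Finset.card_erase_of_mem h4] at h1
  have := Finset.card_pos.2 ⟨_, h4⟩
  simp only [ne_eq] at *
  omega

/-- A vertex outside the fan missing the color of the center has small degree, by comparing the
number of common neighbors of `r`, `s` and `v` with the number of full-degree neighbors of `r`. -/
theorem Core.false_of_degree {k : ℕ} (hvU : v ∉ U) (hvr : v ≠ r) (hρ : ψ.mate ρ r = r)
    (hρv : ψ.mate ρ v = v)
    (hk : ((G.neighborFinset r).filter fun x => G.degree x = D).card = k)
    (hv : D + 1 ≤ G.degree v + k) (hn : 4 * Fintype.card V + 9 * k ≤ 6 * D) : False := by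
  have h0 := hC.le_degree_root hG
  let L := (G.neighborFinset r).filter fun x => ¬ G.degree x = D
  have hL : L.card + k = D := by
    rw [← hk, add_comm, Finset.card_filter_add_card_filter_not, card_neighborFinset_eq_degree,
      hC.degree_center]
  have hH : (fullNeighbors G r D U).card + (U.filter fun u => G.degree u = D).card = k := by
    have h1 := Finset.card_filter_add_card_filter_not
      (s := (G.neighborFinset r).filter fun x => G.degree x = D) (fun x => x ∈ U)
    have h2 : ((G.neighborFinset r).filter fun x => G.degree x = D).filter (fun x => x ∈ U) =
        U.filter fun u => G.degree u = D := by
      ext x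
      simp only [Finset.mem_filter, mem_neighborFinset]
      constructor
      · rintro ⟨⟨_, h⟩, hx⟩
        exact ⟨hx, h⟩
      · rintro ⟨hx, h⟩
        exact ⟨⟨hG.fan.adj hC.adj x hx, h⟩, hx⟩
    rw [h2, Finset.filter_filter, hk] at h1
    rw [fullNeighbors]
    omega
  let Z := (G.neighborFinset s ∩ G.neighborFinset v) ∩ L
  have hZ : L.card + G.degree s + G.degree v ≤ Z.card + 2 * Fintype.card V := by
    have h1 := Finset.card_union_add_card_inter (G.neighborFinset s) (G.neighborFinset v)
    have h2 := Finset.card_union_add_card_inter (G.neighborFinset s ∩ G.neighborFinset v) L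
    have h3 := Finset.card_le_univ (G.neighborFinset s ∪ G.neighborFinset v)
    have h4 := Finset.card_le_univ (G.neighborFinset s ∩ G.neighborFinset v ∪ L)
    rw [card_neighborFinset_eq_degree, card_neighborFinset_eq_degree] at h1
    change _ ≤ ((G.neighborFinset s ∩ G.neighborFinset v) ∩ L).card + _
    omega
  have hsplit := Finset.card_filter_add_card_filter_not (s := Z) (fun z => ∃ τ, ψ.Pivot U v τ z)
  have h1 := hC.card_pivots hG hvU hvr hρ hρv (Z.filter fun z => ∃ τ, ψ.Pivot U v τ z)
    fun z hz => (Finset.mem_filter.1 hz).2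
  have h2 := hC.card_not_pivots hG hvU hvr hρ (Z.filter fun z => ¬ ∃ τ, ψ.Pivot U v τ z)
    fun z hz => by
      obtain ⟨h1, h2⟩ := Finset.mem_filter.1 hz
      simp only [Z, L, Finset.mem_inter, Finset.mem_filter, mem_neighborFinset] at h1
      have := hC.degree_le z
      exact ⟨h1.1.1, h1.1.2, by omega, h2⟩
  omega

end

/-! ### Maximum fans -/

section

variable {V : Type*} {G : SimpleGraph V} {r s : V} {D : ℕ}

section maximum

variable [Fintype V] [DecidableRel G.Adj] {ψ : G.NearColoring r s D} {S : Finset V} {k : ℕ}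
  (hrs : G.Adj r s) (hnc : ¬ G.lineGraph.Colorable D) (hdr : G.degree r = D)
  (hds : G.degree s < D) (hd : ∀ x, G.degree x ≤ D)
  (hmax : ∀ (ψ' : G.NearColoring r s D) (T : Finset V), ψ'.Fan T → T.card ≤ S.card)
  (hk : ((G.neighborFinset r).filter fun x => G.degree x = D).card = k)
  (hn : 4 * Fintype.card V + 9 * k ≤ 6 * D)
include hrs hnc hdr hds hd hmax hk hn

/-- A vertex outside a maximum fan that misses the color of the center has small degree: the fan minus
its last vertex is brought into the situation of `Core`, and the numbers are compared. -/
theorem Fan.false_of_missing_center (hS : ψ.Fan S) {v : V} {ρ : Fin D} (hvS : v ∉ S) (hvr : v ≠ r)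
    (hv : D + 1 ≤ G.degree v + k) (hρ : ψ.mate ρ r = r) (hρv : ψ.mate ρ v = v) : False := by
  cases hS with
  | root =>
    have h := ψ.card_missing_root hrs
    obtain ⟨c, hc⟩ := Finset.card_pos.1 (show 0 < (ψ.missing s).card by omega)
    have hc := mem_missing.1 hc
    have h1 : ψ.mate c r ≠ r :=
      (Fan.root (ψ := ψ)).ne_of_missing_center hrs hnc (Finset.mem_singleton_self s) hc
    have h2 : ψ.mate c r ∉ ({s} : Finset V) := by simpa using ψ.avoid c
    have := hmax ψ _ (Fan.root.step (Finset.mem_singleton_self s) hc rfl h2 h1)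
    rw [Finset.card_insert_of_notMem h2] at this
    simp at this
  | @step U u w c hU hu hc hw hwU hwr =>
    -- the vertex from which the last vertex of the fan was added becomes the root
    obtain ⟨ψ', hF, hout, hfull, -⟩ := hU.reroot hrs u hu
    have hrU := hU.center_notMem hrs
    have hcr : ψ.mate c r ∉ U := hw ▸ hwU
    have hC : Core G r u D U :=
      { adj := hU.adj hrs u hu
        degree_center := hdr
        degree_root := by
          by_cases hus : u = s
          · rwa [hus]
          · exact degree_lt_of_missing ψ (fun h => hrU (h ▸ hu)) hus hc
        degree_le := hd
        not_colorable := hnc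
        card_le := fun χ T hUT hT => by
          obtain ⟨χ', hT', -⟩ := hT.reroot (hU.adj hrs u hu) s (hUT hU.root_mem)
          have := hmax χ' T hT'
          rwa [Finset.card_insert_of_notMem hwU] at this }
    have hG : ψ'.Good U c :=
      ⟨hF, (hfull c hcr u).trans hc, by rwa [hfull c hcr]⟩
    have hvU : v ∉ U := fun h => hvS (Finset.mem_insert_of_mem h)
    exact hC.false_of_degree hG hvU hvr ((hfull ρ (by rwa [hρ]) r).trans hρ)
      ((hout v hvU hvr ρ).trans hρv) hk hv hn

/-- A Kempe change reduces a vertex sharing a missing color with the fan to one missing the color of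
the center. -/
theorem Fan.false_of_missing (hS : ψ.Fan S) {v : V} {c : Fin D} (hvS : v ∉ S) (hvr : v ≠ r)
    (hv : D + 1 ≤ G.degree v + k) (hcv : ψ.mate c v = v)
    (hc : ψ.mate c r = r ∨ ∃ u ∈ S, ψ.mate c u = u) : False := by
  have h := ψ.card_missing_center hrs
  rw [hdr] at h
  obtain ⟨ρ, hρ⟩ := Finset.card_pos.1 (show 0 < (ψ.missing r).card by omega)
  have hρ := mem_missing.1 hρ
  rcases hc with hc | ⟨u, hu, hcu⟩
  · exact hS.false_of_missing_center hrs hnc hdr hds hd hmax hk hn hvS hvr hv hc hcv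
  have hK := ψ.comp_closed ρ c v
  have hrK : r ∉ ψ.comp ρ c v := fun h' => ψ.three_ends (Or.inl hρ) (Or.inr hcu) (Or.inr hcv)
    (fun h => hS.center_notMem hrs (h ▸ hu)) hvr.symm (fun h => hvS (h ▸ hu))
    (hS.mem_comp hrs hnc hρ hu hcu) (mem_comp_symm h')
  exact (hS.kempe hrs hnc hρ hK hrK).false_of_missing_center hrs hnc hdr hds hd hmax hk hn hvS hvr
    hv ((kempe_of_notMem hK hrK).trans hρ)
    ((kempe_left hK (ψ.mem_comp_self _ _ _)).trans hcv)

/-- If there is a fan of maximum size, then vertices of large degree share no missing color. -/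
theorem Fan.eq_of_missing (hS : ψ.Fan S) {x y : V} {c : Fin D}
    (hx : D + 1 ≤ G.degree x + k) (hy : D + 1 ≤ G.degree y + k) (hcx : ψ.mate c x = x)
    (hcy : ψ.mate c y = y) : x = y := by
  have h := ψ.card_missing_center hrs
  rw [hdr] at h
  obtain ⟨ρ, hρ⟩ := Finset.card_pos.1 (show 0 < (ψ.missing r).card by omega)
  have hρ := mem_missing.1 hρ
  by_contra hne
  have key := fun {v} => hS.false_of_missing hrs hnc hdr hds hd hmax hk hn (v := v) (c := c)
  by_cases hxS : x ∈ S <;> by_cases hyS : y ∈ S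
  · exact hne (hS.elementary hrs hnc hρ hxS hyS hcx hcy)
  · by_cases hyr : y = r
    · exact hS.ne_of_missing_center hrs hnc hxS hcx (hyr ▸ hcy)
    · exact key hyS hyr hy hcy (Or.inr ⟨x, hxS, hcx⟩)
  · by_cases hxr : x = r
    · exact hS.ne_of_missing_center hrs hnc hyS hcy (hxr ▸ hcx)
    · exact key hxS hxr hx hcx (Or.inr ⟨y, hyS, hcy⟩)
  · by_cases hxr : x = r
    · exact key hyS (fun h => hne (hxr.trans h.symm)) hy hcy (Or.inl (hxr ▸ hcx))
    by_cases hyr : y = r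
    · exact key hxS hxr hx hcx (Or.inl (hyr ▸ hcy))
    -- one of the two vertices can be given the missing color of the center
    have swap : ∀ v, v ∉ S → v ≠ r → D + 1 ≤ G.degree v + k → ψ.mate c v = v →
        v ∈ ψ.comp ρ c r := by
      intro v hvS hvr hv hcv
      by_contra hcon
      have hK := ψ.comp_closed ρ c v
      have hrK : r ∉ ψ.comp ρ c v := fun h' => hcon (mem_comp_symm h')
      exact (hS.kempe hrs hnc hρ hK hrK).false_of_missing_center hrs hnc hdr hds hd hmax hk hn hvS
        hvr hv ((kempe_of_notMem hK hrK).trans hρ)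
        ((kempe_left hK (ψ.mem_comp_self _ _ _)).trans hcv)
    exact ψ.three_ends (Or.inl hρ) (Or.inr hcx) (Or.inr hcy) (Ne.symm hxr) (Ne.symm hyr) hne
      (swap x hxS hxr hx hcx) (swap y hyS hyr hy hcy)

end maximum

/-! ### Translation to edge colorings and multi-fans -/

/-- `ψ` records the edge coloring `φ` of `G - rs`. -/
def Represents (ψ : G.NearColoring r s D) (φ : (G.deleteEdges {s(r, s)}).EdgeColoring D) : Prop :=
  ∀ c x y, (∃ h : s(x, y) ∈ (G.deleteEdges {s(r, s)}).edgeSet, φ ⟨s(x, y), h⟩ = c) ↔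
    ψ.mate c x = y ∧ y ≠ x

theorem mem_edgeSet_deleteEdges {x y : V} : s(x, y) ∈ (G.deleteEdges {s(r, s)}).edgeSet ↔
    G.Adj x y ∧ s(x, y) ≠ s(r, s) := by
  simp

theorem Represents.mem_missing_iff {ψ : G.NearColoring r s D}
    {φ : (G.deleteEdges {s(r, s)}).EdgeColoring D} (h : ψ.Represents φ) {c : Fin D} {x : V} :
    c ∈ φ.missing x ↔ ψ.mate c x = x := by
  rw [EdgeColoring.missing, Set.mem_compl_iff, not_iff_comm]
  constructor
  · intro hne
    obtain ⟨h1, h2⟩ := (h c x _).2 ⟨rfl, hne⟩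
    exact ⟨⟨_, h1⟩, Sym2.mem_mk_left _ _, h2⟩
  · rintro ⟨⟨e, he⟩, hx, hc⟩
    obtain ⟨y, rfl⟩ := Sym2.mem_iff_exists.1 hx
    obtain ⟨h1, h2⟩ := (h c x y).1 ⟨he, hc⟩
    rwa [h1]

theorem exists_represents (hrs : G.Adj r s) (φ : (G.deleteEdges {s(r, s)}).EdgeColoring D) :
    ∃ ψ : G.NearColoring r s D, ψ.Represents φ := by
  let R : Fin D → V → V → Prop := fun c x y =>
    ∃ h : s(x, y) ∈ (G.deleteEdges {s(r, s)}).edgeSet, φ ⟨s(x, y), h⟩ = c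
  have Rsymm : ∀ {c x y}, R c x y → R c y x := by
    rintro c x y ⟨h, rfl⟩
    have hs : s(y, x) = s(x, y) := Sym2.eq_swap
    exact ⟨hs.symm ▸ h, congrArg φ (Subtype.ext hs)⟩
  have Radj : ∀ {c x y}, R c x y → G.Adj x y ∧ s(x, y) ≠ s(r, s) := fun ⟨h, _⟩ =>
    mem_edgeSet_deleteEdges.1 h
  have Runiq : ∀ {c x y y'}, R c x y → R c x y' → y = y' := by
    rintro c x y y' ⟨h1, h2⟩ ⟨h3, h4⟩
    by_contra hne
    refine φ.valid (v := ⟨s(x, y), h1⟩) (w := ⟨s(x, y'), h3⟩) ?_ (h2.trans h4.symm)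
    rw [lineGraph_adj_iff_exists]
    refine ⟨fun h => hne ?_, x, Sym2.mem_mk_left _ _, Sym2.mem_mk_left _ _⟩
    exact Sym2.congr_right.1 (Subtype.ext_iff.1 h)
  let m : Fin D → V → V := fun c x => if h : ∃ y, R c x y then h.choose else x
  have m_of : ∀ {c x y}, R c x y → m c x = y := fun {c x y} h => by
    have hex : ∃ y, R c x y := ⟨y, h⟩
    simp only [m, hex, dif_pos]
    exact Runiq hex.choose_spec h
  have of_m : ∀ {c x}, m c x ≠ x → R c x (m c x) := fun {c x} h => by
    by_cases hex : ∃ y, R c x y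
    · simp only [m, hex, dif_pos]
      exact hex.choose_spec
    · exact absurd (by simp only [m, hex]; rfl) h
  let ψ : G.NearColoring r s D :=
    { mate := m
      inv := fun c x => by
        by_cases h : m c x = x
        · rw [h, h]
        · exact m_of (Rsymm (of_m h))
      adj := fun c x h => (Radj (of_m h)).1
      avoid := fun c h => by
        by_cases h' : m c r = r
        · exact hrs.ne (h'.symm.trans h)
        · exact (Radj (of_m h')).2 (by rw [h])
      cover := fun x y hxy hne => ⟨φ ⟨s(x, y), mem_edgeSet_deleteEdges.2 ⟨hxy, hne⟩⟩,
        m_of ⟨_, rfl⟩⟩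
      uniq := fun c d x h h' => by
        obtain ⟨h1, h2⟩ := of_m h'
        obtain ⟨h3, h4⟩ := of_m (h ▸ h')
        rw [← h2, ← h4]
        congr 3 }
  refine ⟨ψ, fun c x y => ⟨fun h => ⟨m_of h, (Radj h).1.ne'⟩, ?_⟩⟩
  rintro ⟨rfl, h⟩
  exact of_m h

theorem exists_represented (ψ : G.NearColoring r s D) :
    ∃ φ : (G.deleteEdges {s(r, s)}).EdgeColoring D, ψ.Represents φ := by
  have hex : ∀ e : (G.deleteEdges {s(r, s)}).edgeSet, ∃ d : Fin D, ∀ x y, e.1 = s(x, y) →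
      ψ.mate d x = y := by
    rintro ⟨e, he⟩
    induction e with | _ x y
    obtain ⟨h1, h2⟩ := mem_edgeSet_deleteEdges.1 he
    obtain ⟨d, hd⟩ := ψ.cover x y h1 h2
    refine ⟨d, fun x' y' h => ?_⟩
    rcases Sym2.eq_iff.1 h with ⟨rfl, rfl⟩ | ⟨rfl, rfl⟩
    exacts [hd, ψ.mate_eq_comm.1 hd]
  choose col hcol using hex
  refine ⟨Coloring.mk col ?_, fun c x y => ⟨?_, ?_⟩⟩
  · rintro ⟨e, he⟩ ⟨f, hf⟩ hef heq
    rw [lineGraph_adj_iff_exists] at hef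
    obtain ⟨hne, x, hxe, hxf⟩ := hef
    obtain ⟨y, rfl⟩ := Sym2.mem_iff_exists.1 hxe
    obtain ⟨z, rfl⟩ := Sym2.mem_iff_exists.1 hxf
    have h1 := hcol ⟨_, he⟩ x y rfl
    have h2 := hcol ⟨_, hf⟩ x z rfl
    rw [heq] at h1
    obtain rfl := h1.symm.trans h2
    exact hne rfl
  · rintro ⟨h, rfl⟩
    exact ⟨hcol ⟨_, h⟩ x y rfl, (mem_edgeSet_deleteEdges.1 h).1.ne'⟩
  · rintro ⟨rfl, hne⟩
    have hadj := ψ.adj c x hne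
    have he : s(x, ψ.mate c x) ≠ s(r, s) := by
      intro h
      rcases Sym2.eq_iff.1 h with ⟨h1, h2⟩ | ⟨h1, h2⟩
      · exact ψ.avoid c (h1 ▸ h2)
      · exact ψ.avoid c (ψ.mate_eq_comm.1 (h1 ▸ h2))
    have hm := mem_edgeSet_deleteEdges.2 ⟨hadj, he⟩
    exact ⟨hm, ψ.uniq _ _ x (hcol ⟨_, hm⟩ x _ rfl) 
      fun h' => hne ((hcol ⟨_, hm⟩ x _ rfl).symm.trans h')⟩

section multiFan

variable {ψ : G.NearColoring r s D} {φ : (G.deleteEdges {s(r, s)}).EdgeColoring D}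
  (h : ψ.Represents φ)
include h

/-- The vertices `s₀, …, sₚ` of a multi-fan form a fan in the sense of `Fan`. -/
theorem Represents.fan_image (F : G.MultiFan r s φ) :
    ψ.Fan (Finset.univ.image F.vert) := by
  have key : ∀ n ≤ F.p, ψ.Fan ((Finset.univ.filter fun i : Fin (F.p + 1) => i.1 ≤ n).image
      F.vert) := by
    intro n
    induction n with
    | zero =>
      intro _
      have : (Finset.univ.filter fun i : Fin (F.p + 1) => i.1 ≤ 0) = {0} := by
        ext i
        simp only [Finset.mem_filter, Finset.mem_univ, true_and, Finset.mem_singleton,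
          Fin.ext_iff, Nat.le_zero, Fin.val_zero]
      rw [this, Finset.image_singleton, F.vert_zero]
      exact .root
    | succ n ih =>
      intro hn
      let i : Fin (F.p + 1) := ⟨n + 1, by omega⟩
      have hi : (Finset.univ.filter fun j : Fin (F.p + 1) => j.1 ≤ n + 1) =
          insert i (Finset.univ.filter fun j : Fin (F.p + 1) => j.1 ≤ n) := by
        ext j
        simp [Fin.ext_iff, i]
        omega
      rw [hi, Finset.image_insert]
      obtain ⟨j, hj, he, hc⟩ := F.color_mem i (by simp [Fin.ext_iff, i])
      have hj' : j.1 < n + 1 := hj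
      refine (ih (by omega)).add (u := F.vert j) (Finset.mem_image_of_mem _ ?_)
        (h.mem_missing_iff.1 hc) ((h _ _ _).1 ⟨he, rfl⟩).1 (F.adj i).ne'
      simp
      omega
  have := key F.p le_rfl
  rwa [Finset.filter_true_of_mem fun i _ => by omega] at this

theorem Represents.exists_multiFan (hrs : G.Adj r s) {S : Finset V} (hS : ψ.Fan S) :
    ∃ F : G.MultiFan r s φ, Set.range F.vert = S := by
  induction hS with
  | root =>
    exact ⟨⟨0, fun _ => s, fun i j _ => Subsingleton.elim (α := Fin 1) i j, fun _ => hrs, rfl,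
      fun i hi => absurd (Subsingleton.elim (α := Fin 1) i 0) hi⟩, by simp⟩
  | @step S u w c hS hu hc hw hwS hwr ih =>
    obtain ⟨F, hF⟩ := ih
    have hmem : ∀ i, F.vert i ∈ S := fun i => by
      rw [← Finset.mem_coe, ← hF]
      exact Set.mem_range_self i
    obtain ⟨j, hj⟩ : u ∈ Set.range F.vert := by rw [hF]; exact hu
    refine ⟨⟨F.p + 1, Fin.snoc F.vert w, ?_, ?_, ?_, ?_⟩, ?_⟩
    · intro a b
      refine Fin.lastCases ?_ (fun a => ?_) a <;> refine Fin.lastCases ?_ (fun b => ?_) b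
      · simp
      · simp only [Fin.snoc_last, Fin.snoc_castSucc]
        exact fun h' => absurd (h' ▸ hmem b) hwS
      · simp only [Fin.snoc_last, Fin.snoc_castSucc]
        exact fun h' => absurd (h' ▸ hmem a) hwS
      · simp only [Fin.snoc_castSucc]
        exact fun h' => congrArg _ (F.injective h')
    · intro a
      refine Fin.lastCases ?_ (fun a => ?_) a
      · rw [Fin.snoc_last]
        exact hw ▸ ψ.adj c r (hw ▸ hwr)
      · rw [Fin.snoc_castSucc]
        exact F.adj a
    · rw [← Fin.castSucc_zero, Fin.snoc_castSucc, F.vert_zero]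
    · intro a
      refine Fin.lastCases ?_ (fun a => ?_) a
      · intro _
        obtain ⟨he, hce⟩ := (h c r w).2 ⟨hw, hwr⟩
        refine ⟨j.castSucc, Fin.castSucc_lt_last j, ?_⟩
        rw [Fin.snoc_last, Fin.snoc_castSucc]
        exact ⟨he, by rw [hce, hj]; exact h.mem_missing_iff.2 hc⟩
      · intro ha
        obtain ⟨i, hi, h1⟩ := F.color_mem a (fun h' => ha (by rw [h', Fin.castSucc_zero]))
        refine ⟨i.castSucc, Fin.castSucc_lt_castSucc_iff.2 hi, ?_⟩
        rw [Fin.snoc_castSucc, Fin.snoc_castSucc]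
        exact h1
    · rw [Finset.coe_insert, ← hF]
      ext x
      simp only [Set.mem_range, Set.mem_insert_iff]
      constructor
      · rintro ⟨a, rfl⟩
        refine Fin.lastCases ?_ (fun a => ?_) a
        · exact Or.inl (by simp)
        · exact Or.inr ⟨a, by simp⟩
      · rintro (rfl | ⟨a, rfl⟩)
        · exact ⟨Fin.last _, by simp⟩
        · exact ⟨a.castSucc, by simp⟩

end multiFan

end

end NearColoring

theorem not_colorable_of_isClassTwo {V : Type*} [Fintype V] {G : SimpleGraph V}
    [DecidableRel G.Adj] (h : G.IsClassTwo) : ¬ G.lineGraph.Colorable G.maxDegree := by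
  intro hc
  have h1 := hc.chromaticNumber_le
  rw [IsClassTwo, chromaticIndex] at h
  rw [h] at h1
  exact absurd (by exact_mod_cast h1 : G.maxDegree + 1 ≤ G.maxDegree) (by omega)

/-- A light vertex has exactly `δ(G_Δ)` neighbors of maximum degree. -/
theorem IsLight.card_filter {V : Type*} [Fintype V] {G : SimpleGraph V} [DecidableRel G.Adj]
    {r : V} (h : G.IsLight r) :
    ((G.neighborFinset r).filter fun x => G.degree x = G.maxDegree).card = G.core.minDegree := by
  obtain ⟨hr, h⟩ := h
  rw [← h, ← card_neighborFinset_eq_degree]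
  symm
  refine Finset.card_bij (fun x _ => x.1) (fun x hx => ?_) (fun x _ y _ => Subtype.ext)
    fun x hx => ?_
  · have h1 := x.2
    simp only [coreVertices, Finset.coe_filter, Finset.mem_univ, true_and] at h1
    simp only [Finset.mem_filter, mem_neighborFinset] at hx ⊢
    exact ⟨hx, h1⟩
  · simp only [Finset.mem_filter, mem_neighborFinset] at hx
    exact ⟨⟨x, by simpa [coreVertices] using hx.2⟩, by simpa using hx.1, rfl⟩

theorem IsLight.degree_eq {V : Type*} [Fintype V] {G : SimpleGraph V} [DecidableRel G.Adj]
    {r : V} (h : G.IsLight r) : G.degree r = G.maxDegree := by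
  obtain ⟨hr, -⟩ := h
  simpa [coreVertices] using hr

end SimpleGraph

theorem lemma2p5 {V : Type*} [Fintype V] (G : SimpleGraph V) [DecidableRel G.Adj] (k : ℕ)
    (hclass : G.IsClassTwo) (hcrit : G.IsCritical) (hk : G.core.minDegree = k)
    (hΔ : (2 / 3 : ℝ) * (Fintype.card V : ℝ) + 3 * (k : ℝ) / 2 ≤ (G.maxDegree : ℝ))
    (r s : V) (hr : G.IsLight r) (hrs : G.Adj r s) (hs : G.degree s + 1 ≤ G.maxDegree)
    (φ : (G.deleteEdges {s(r, s)}).EdgeColoring G.maxDegree)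
    (F : G.MultiFan r s φ) (hF : F.IsMaximum) :
    φ.IsElementary {v : V | (G.maxDegree : ℤ) - (k : ℤ) + 1 ≤ (G.degree v : ℤ)} := by
  classical
  intro x hx y hy hne
  rw [Set.eq_empty_iff_forall_notMem]
  rintro c ⟨hcx, hcy⟩
  obtain ⟨ψ, h⟩ := SimpleGraph.NearColoring.exists_represents hrs φ
  have card_verts : ∀ {φ' : (G.deleteEdges {s(r, s)}).EdgeColoring G.maxDegree}
      (F' : G.MultiFan r s φ') (T : Finset V), Set.range F'.vert = T →
      F'.verts.ncard = T.card + 1 := by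
    intro φ' F' T hT
    have hrT : r ∉ Set.range F'.vert := by
      rintro ⟨i, hi⟩
      exact (F'.adj i).ne hi.symm
    rw [SimpleGraph.MultiFan.verts, Set.ncard_insert_of_notMem hrT, hT, Set.ncard_coe_finset]
  have hS := h.fan_image F
  have hmax : ∀ (ψ' : G.NearColoring r s G.maxDegree) (T : Finset V), ψ'.Fan T →
      T.card ≤ (Finset.univ.image F.vert).card := by
    intro ψ' T hT
    obtain ⟨φ', h'⟩ := ψ'.exists_represented
    obtain ⟨F', hF'⟩ := h'.exists_multiFan hrs hT
    have h1 := hF φ' F'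
    rw [card_verts F' T hF', card_verts F (Finset.univ.image F.vert) (by simp)] at h1
    omega
  have hn : 4 * Fintype.card V + 9 * k ≤ 6 * G.maxDegree := by
    have : (4 : ℝ) * (Fintype.card V : ℝ) + 9 * (k : ℝ) ≤ 6 * (G.maxDegree : ℝ) := by linarith
    exact_mod_cast this
  have hx' : G.maxDegree + 1 ≤ G.degree x + k := by
    have : (G.maxDegree : ℤ) - (k : ℤ) + 1 ≤ (G.degree x : ℤ) := hx
    omega
  have hy' : G.maxDegree + 1 ≤ G.degree y + k := by
    have : (G.maxDegree : ℤ) - (k : ℤ) + 1 ≤ (G.degree y : ℤ) := hy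
    omega
  refine hne (SimpleGraph.NearColoring.Fan.eq_of_missing (D := G.maxDegree) (k := k) hrs
    (SimpleGraph.not_colorable_of_isClassTwo hclass) hr.degree_eq (by omega)
    G.degree_le_maxDegree hmax ?_ hn hS hx' hy'
    (h.mem_missing_iff.1 hcx) (h.mem_missing_iff.1 hcy))
  rw [← hk, ← hr.card_filter]
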